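/- **Data.** Let $k$ be a field, $S$ a finite set, $A$ the $k$-vector space with basis $(e_a)_{a\in S}$. Diagrammatic state sum model data $(C,B,R)$ consist of $C_{abc}\in k$, $B^{ab}\in k$ $(a,b,c\in S)$ and $R\in k$ with $$C_{abc}\,B^{cd}=B^{de}\,C_{eab}\qquad(\text{summation over repeated indices}).$$ They are non-degenerate if $R\neq 0$, $B(\cdot,v)=0\Rightarrow v=0$ and $C(\cdot,\cdot,v)=0\Rightarrow v=0$. Then $B$ has an inverse $B_{ab}$, $B_{ac}B^{cb}=\delta_a^b$. Put $C_{ab}{}^{c}=C_{abd}B^{dc}$, $m(e_a\otimes e_b)=e_a\cdot e_b=C_{ab}{}^{c}e_c$, $B=B^{ab}e_a\otimes e_b\in A\otimes A$ and $\beta=m(B)=B^{ab}\,e_a\cdot e_b$. **Partition function.** Let $M\subset\mathbb R^2$ be compact with a triangulation $T$, i.e. a finite rectilinear simplicial complex with underlying space $M$ in which each simplex is a face of a triangle. A dual graph $G$ has one vertex in the interior of each triangle, joined inside the triangle, by simple polygonal legs that are disjoint except at that vertex, to one point in the relative interior of each of its three edges; the two legs meeting an interior edge have the same end point there and form a dual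 edge, and the leg meeting a boundary edge ends there. No part of $G$ is horizontal. For given states on the boundary edges, $|G|\in k$ is obtained by summing over states on all other pieces of lines the product of the following factors: $B_{lr}$ at each local maximum and $B^{lr}$ at each local minimum of the height on a line ($l$, $r$ being the states to the left and to the right); and at each dual vertex $C_{abc}$, where $a,b,c$ are the indices of its legs in counterclockwise order starting from the left (the downward legs from left to right, then the upward legs from right to left), and the index $c$ of each upward leg is raised by $C_{\cdots c\cdots}B^{cx}$. With $V$ the number of vertices of $T$ in the interior of $M$, $$Z(M)=R^V|G|.$$ The data *determine a planar state sum model* if for every compact $M\subset\mathbb R^2$, all triangulations $T,T'$ of $M$ related by a Pachner move (2-2: exchange of the diagonal of a convex quadrilateral formed by two triangles; 1-3: subdivision of a triangle by a new vertex in its interior; or the inverses), all dual graphs $G$ of $T$ and $G'$ of $T'$ that coincide near the boundary, and all boundary states, the two partition functions are equal. **Theorem.** Let $(C,B,R)$ be non-degenerate diagrammatic state sum model data. They determine a planar state sum model if and only if $m$, $B$ and $\beta$ determine on $A$ the structure of a special Frobenius algebra with identity element $1=R\beta$; that is, $m$ is associative with two-sided unit $R\beta$, there is a linear functional $\varepsilon\colon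 A\to k$ such that the bilinear form $\varepsilon\circ m$ is non-degenerate with inverse $B$ (so $\varepsilon(e_a\cdot e_b)=B_{ab}$), and $m(B)$ is a non-zero multiple of the identity. The form $\varepsilon\circ m$ need not be symmetric. -/

import Mathlib

open scoped TensorProduct

noncomputable section

namespace PlanarStateSum

/-! ### State sum model data -/

/-- The amplitudes of a state sum model with finite set of states `S` over the field `k`:
`C a b c` is $C_{abc}$, `B a b` is $B^{ab}$ and `R` is the vertex amplitude. -/
structure Data (k : Type*) [Field k] (S : Type*) where
  C : S → S → S → k
  B : Matrix S S k
  R : k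

namespace Data

variable {k : Type*} [Field k] {S : Type*} [Fintype S] [DecidableEq S]

/-- Non-degeneracy: `R ≠ 0`, `B(·, v) = 0` only for `v = 0`, and `C(·, ·, v) = 0` only for
`v = 0`. -/
def Nondegenerate (D : Data k S) : Prop :=
  D.R ≠ 0 ∧
  (∀ v : S → k, (∀ a, ∑ b, D.B a b * v b = 0) → v = 0) ∧
  (∀ v : S → k, (∀ a b, ∑ c, D.C a b c * v c = 0) → v = 0)

/-- The equation $C_{abc} B^{cd} = B^{de} C_{eab}$ required of diagrammatic data. -/
def IsDiagrammatic (D : Data k S) : Prop :=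
  ∀ a b d : S, ∑ c, D.C a b c * D.B c d = ∑ e, D.B d e * D.C e a b

/-- The multiplication `m` on the space `A = S → k` with basis `e_a = Pi.single a 1`, given by
$e_a \cdot e_b = C_{ab}{}^c e_c$ with $C_{ab}{}^c = C_{abd} B^{dc}$. -/
def mul (D : Data k S) : (S → k) →ₗ[k] (S → k) →ₗ[k] (S → k) :=
  LinearMap.mk₂ k (fun x y c => ∑ a, ∑ b, x a * y b * ∑ d, D.C a b d * D.B d c)
    (by intros; funext c; simp [add_mul, Finset.sum_add_distrib])
    (by intros; funext c; simp [Finset.mul_sum, mul_assoc])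
    (by intros; funext c; simp [add_mul, mul_add, Finset.sum_add_distrib])
    (by intros; funext c; simp [Finset.mul_sum, mul_left_comm, mul_assoc])

/-- `B` as the element $B^{ab}\, e_a \otimes e_b$ of `A ⊗ A`. -/
def bTensor (D : Data k S) : (S → k) ⊗[k] (S → k) :=
  ∑ a, ∑ b, D.B a b • ((Pi.single a 1 : S → k) ⊗ₜ[k] (Pi.single b 1 : S → k))

/-- The distinguished element `β = m(B)`. -/
def beta (D : Data k S) : S → k := TensorProduct.lift D.mul D.bTensor

end Data

/-! ### Special Frobenius algebras -/

section Frobenius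

variable {k : Type*} [Field k] {A : Type*} [AddCommGroup A] [Module k A]

/-- The multiplication `mul`, the unit `one` and the linear functional `ε` make the
finite-dimensional space `A` a Frobenius algebra. -/
structure IsFrobeniusAlgebra (mul : A →ₗ[k] A →ₗ[k] A) (one : A) (ε : A →ₗ[k] k) : Prop where
  finiteDimensional : FiniteDimensional k A
  mul_assoc : ∀ x y z, mul (mul x y) z = mul x (mul y z)
  one_mul : ∀ x, mul one x = x
  mul_one : ∀ x, mul x one = x
  nondegenerate : (mul.compr₂ ε).Nondegenerate

/-- The element `t` of `A ⊗ A` is inverse to the bilinear form `φ` on `A`: contracting `φ(x, ·)`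
with the first factor of `t` returns `x`. In components, $B_{ac} B^{cb} = \delta_a^b$. -/
def IsInverseTensor (φ : A →ₗ[k] A →ₗ[k] k) (t : A ⊗[k] A) : Prop :=
  ∀ x, TensorProduct.lid k A (LinearMap.rTensor A (φ x) t) = x

/-- A Frobenius algebra is special if the product `m(t)` of the inverse `t` of its bilinear form
`ε ∘ m` is a non-zero multiple of the identity. -/
def IsSpecial (mul : A →ₗ[k] A →ₗ[k] A) (one : A) (ε : A →ₗ[k] k) : Prop :=
  ∃ t : A ⊗[k] A, IsInverseTensor (mul.compr₂ ε) t ∧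
    ∃ c : k, c ≠ 0 ∧ TensorProduct.lift mul t = c • one

end Frobenius

/-- The data determine a special Frobenius algebra on `A`: the multiplication is `m`, the identity
element is `R β`, and the bilinear form `ε ∘ m` is inverse to `B`. -/
def Data.DeterminesSpecialFrobenius {k : Type*} [Field k] {S : Type*} [Fintype S] [DecidableEq S]
    (D : Data k S) : Prop :=
  ∃ ε : (S → k) →ₗ[k] k,
    IsFrobeniusAlgebra D.mul (D.R • D.beta) ε ∧
    IsInverseTensor (D.mul.compr₂ ε) D.bTensor ∧
    IsSpecial D.mul (D.R • D.beta) ε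

/-! ### Triangulations of subsets of the plane

The plane `ℝ²` is `ℂ`; the vertical height of a point is its imaginary part. -/

/-- A triangulation of `M ⊂ ℝ²`: a finite simplicial complex with underlying space `M` in which
every simplex is a face of a triangle. -/
structure Triangulation (M : Set ℂ) extends Geometry.SimplicialComplex ℝ ℂ where
  finite : faces.Finite
  pure : ∀ s ∈ faces, ∃ t ∈ faces, t.card = 3 ∧ s ⊆ t
  space_eq : toSimplicialComplex.space = M

namespace Triangulation

variable {M : Set ℂ}

/-- The triangles, as sets of three vertices. -/
def triangles (T : Triangulation M) : Set (Finset ℂ) := {t ∈ T.faces | t.card = 3}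

/-- The pairs of a triangle and one of its three edges. -/
structure Flag (T : Triangulation M) where
  tri : Finset ℂ
  edge : Finset ℂ
  tri_mem : tri ∈ T.triangles
  edge_subset : edge ⊆ tri
  edge_card : edge.card = 2

instance (T : Triangulation M) : Finite T.Flag := by
  have h : Finite (T.faces ×ˢ T.faces : Set (Finset ℂ × Finset ℂ)) :=
    (T.finite.prod T.finite).to_subtype
  refine Finite.of_injective
    (fun f : T.Flag => (⟨(f.tri, f.edge), f.tri_mem.1, T.down_closed f.tri_mem.1 f.edge_subset
      (Finset.card_pos.1 (by rw [f.edge_card]; norm_num))⟩ :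
        (T.faces ×ˢ T.faces : Set (Finset ℂ × Finset ℂ)))) ?_
  rintro ⟨t, e, _, _, _⟩ ⟨t', e', _, _, _⟩ hff
  have h1 := congrArg Subtype.val hff
  obtain ⟨rfl, rfl⟩ := Prod.mk.inj h1
  rfl

instance (T : Triangulation M) : Fintype T.Flag := Fintype.ofFinite _

/-- The edge of the flag is a boundary edge, i.e. it lies in no other triangle. -/
def Flag.IsBoundary {T : Triangulation M} (f : T.Flag) : Prop :=
  ∀ g : T.Flag, g.edge = f.edge → g = f

/-- The number `V` of vertices in the interior of `M`. -/
def numInteriorVertices (T : Triangulation M) : ℕ :=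
  {v : ℂ | {v} ∈ T.faces ∧ v ∈ interior M}.ncard

/-- The 2-2 move: two triangles `abc`, `abd` that form a convex quadrilateral with diagonals `ab`
and `cd` are replaced by `acd`, `bcd`. -/
def PachnerMove22 (T T' : Triangulation M) : Prop :=
  ∃ a b c d : ℂ, (openSegment ℝ a b ∩ openSegment ℝ c d).Nonempty ∧
    ({a, b, c} : Finset ℂ) ∈ T.triangles ∧ ({a, b, d} : Finset ℂ) ∈ T.triangles ∧
    T'.triangles = (T.triangles \ {{a, b, c}, {a, b, d}}) ∪ {{a, c, d}, {b, c, d}}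

/-- The 1-3 move: a triangle `abc` is replaced by the three triangles `abo`, `bco`, `cao`, for a
new vertex `o` inside `abc`. -/
def PachnerMove13 (T T' : Triangulation M) : Prop :=
  ∃ a b c o : ℂ, o ∈ interior (convexHull ℝ {a, b, c}) ∧
    ({a, b, c} : Finset ℂ) ∈ T.triangles ∧
    T'.triangles = (T.triangles \ {{a, b, c}}) ∪ {{a, b, o}, {b, c, o}, {c, a, o}}

end Triangulation

/-! ### Dual graphs -/

/-- The polygonal curve through `p 0, p 1, p 2, …`, with `p i` at parameter `i`. -/
def polyline (p : ℕ → ℂ) (s : ℝ) : ℂ :=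
  AffineMap.lineMap (p ⌊s⌋₊) (p (⌊s⌋₊ + 1)) (Int.fract s)

/-- A planar graph dual to the triangulation `T`. There is a dual vertex inside each triangle, and
for each edge of a triangle a leg, which is a simple polygonal curve
`pt f 0, pt f 1, …, pt f (len f)` inside the triangle from the dual vertex to a point in the
relative interior of the edge. The legs at one dual vertex are otherwise disjoint. The two legs
that meet an interior edge end in the same point and form a dual edge; the one leg that meets a
boundary edge is a dual edge that ends there. No part of the graph is horizontal. -/
structure DualGraph {M : Set ℂ} (T : Triangulation M) where
  len : T.Flag → ℕ
  pt : T.Flag → ℕ → ℂ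
  len_pos : ∀ f, 0 < len f
  start_eq : ∀ f g : T.Flag, f.tri = g.tri → pt f 0 = pt g 0
  end_eq : ∀ f g : T.Flag, f.edge = g.edge → pt f (len f) = pt g (len g)
  end_mem : ∀ f, pt f (len f) ∈ convexHull ℝ (f.edge : Set ℂ) \ (f.edge : Set ℂ)
  mem_interior : ∀ f, ∀ s ∈ Set.Ico (0 : ℝ) (len f),
    polyline (pt f) s ∈ interior (convexHull ℝ (f.tri : Set ℂ))
  injOn : ∀ f, Set.InjOn (polyline (pt f)) (Set.Icc (0 : ℝ) (len f))
  disjoint : ∀ f g : T.Flag, f.tri = g.tri → f ≠ g →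
    ∀ s ∈ Set.Icc (0 : ℝ) (len f), ∀ s' ∈ Set.Icc (0 : ℝ) (len g),
      polyline (pt f) s = polyline (pt g) s' → s = 0 ∧ s' = 0
  not_horizontal : ∀ f, ∀ i < len f, (pt f i).im ≠ (pt f (i + 1)).im

namespace DualGraph

variable {M : Set ℂ} {T T' : Triangulation M}

/-- The direction in which a leg leaves the dual vertex. -/
def firstDir (G : DualGraph T) (f : T.Flag) : ℂ := G.pt f 1 - G.pt f 0

/-- The direction in which a leg is seen from its end on the edge. -/
def lastDir (G : DualGraph T) (f : T.Flag) : ℂ := G.pt f (G.len f - 1) - G.pt f (G.len f)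

/-- The dual graphs of two triangulations of `M` with the same boundary edges coincide in a
neighbourhood of the boundary: on each boundary edge the dual edges have the same end point and
arrive there along the same ray. -/
def SameNearBoundary (G : DualGraph T) (G' : DualGraph T') : Prop :=
  ∀ (f : T.Flag) (f' : T'.Flag), f.IsBoundary → f'.IsBoundary → f.edge = f'.edge →
    G.pt f (G.len f) = G'.pt f' (G'.len f') ∧ SameRay ℝ (G.lastDir f) (G'.lastDir f')

end DualGraph

/-! ### Evaluation of the dual graph

Every straight piece of the graph carries a state. Directions are compared by `Complex.arg`, which
takes values in `(-π, π]`: downward directions have negative argument, increasing from left to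
right, and upward ones have positive argument, increasing from right to left. -/

namespace Data

variable {k : Type*} [Field k] {S : Type*} [Fintype S] [DecidableEq S]

open scoped Classical in
/-- The factor at a point of a line from which the two pieces of the line leave in the directions
`d₁`, `d₂`, with states `i`, `j`. At a maximum it is $B_{lr}$ (the inverse of `B`), at a minimum
$B^{lr}$, where `l` is the state on the left and `r` that on the right; at all other points the
states must agree. -/
def cornerAmp (D : Data k S) (d₁ d₂ : ℂ) : Matrix S S k := fun i j =>
  if d₁.im < 0 ∧ d₂.im < 0 then
    if d₁.arg < d₂.arg then D.B⁻¹ i j else D.B⁻¹ j i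
  else if 0 < d₁.im ∧ 0 < d₂.im then
    if d₂.arg < d₁.arg then D.B i j else D.B j i
  else if i = j then 1 else 0

open scoped Classical in
/-- The factor for the start of a leg at a dual vertex in direction `d`: an index of `C` is left as
it is for a leg that points downwards and raised to $C_{\dots c\dots} B^{cx}$ for a leg that
points upwards. -/
def startAmp (D : Data k S) (d : ℂ) : Matrix S S k :=
  if 0 < d.im then D.B else 1

variable {M : Set ℂ} {T : Triangulation M}

/-- The factor of a leg: the product, summed over the intermediate states, of the factors for its
start and for its corners. The row is the index of `C` at the dual vertex, the column is the
state at the end on the edge. -/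
def legAmp (D : Data k S) (G : DualGraph T) (f : T.Flag) : Matrix S S k :=
  D.startAmp (G.firstDir f) *
    ((List.range (G.len f - 1)).map fun i =>
      D.cornerAmp (G.pt f i - G.pt f (i + 1)) (G.pt f (i + 2) - G.pt f (i + 1))).prod

open scoped Classical in
/-- The three legs at a dual vertex in order of argument, i.e. counterclockwise starting from the
left: the downward ones from left to right, then the upward ones from right to left. There is
exactly one such triple for each triangle. -/
def vertexTriples (G : DualGraph T) : Finset (T.Flag × T.Flag × T.Flag) :=
  {p | p.1.tri = p.2.1.tri ∧ p.2.1.tri = p.2.2.tri ∧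
    (G.firstDir p.1).arg < (G.firstDir p.2.1).arg ∧
    (G.firstDir p.2.1).arg < (G.firstDir p.2.2).arg}

open scoped Classical in
/-- The two legs that meet at an interior edge, in order of argument. There is exactly one such
pair for each interior edge. -/
def edgePairs (G : DualGraph T) : Finset (T.Flag × T.Flag) :=
  {p | p.1.edge = p.2.edge ∧ (G.lastDir p.1).arg < (G.lastDir p.2).arg}

open scoped Classical in
/-- The evaluation `|G|` for the states `bs` on the boundary edges. The sum is over the indices
`z` of `C` at the dual vertices and the states `y` at the ends of the legs. -/
def evalGraph (D : Data k S) (G : DualGraph T) (bs : Finset ℂ → S) : k :=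
  ∑ z : T.Flag → S, ∑ y : T.Flag → S,
    (∏ p ∈ vertexTriples G, D.C (z p.1) (z p.2.1) (z p.2.2)) *
    (∏ f : T.Flag, D.legAmp G f (z f) (y f)) *
    (∏ p ∈ edgePairs G, D.cornerAmp (G.lastDir p.1) (G.lastDir p.2) (y p.1) (y p.2)) *
    (∏ f : T.Flag, if f.IsBoundary → y f = bs f.edge then 1 else 0)

/-- The partition function $Z(M) = R^V |G|$ of the diagrammatic state sum model. -/
def partitionFunction (D : Data k S) (G : DualGraph T) (bs : Finset ℂ → S) : k :=
  D.R ^ T.numInteriorVertices * D.evalGraph G bs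

/-- The data determine a planar state sum model: on every compact `M ⊂ ℝ²`, and for all boundary
states, the partition function is invariant under the Pachner moves, where the dual graph is
unchanged near the boundary and arbitrary elsewhere. -/
def IsPlanar (D : Data k S) : Prop :=
  ∀ (M : Set ℂ), IsCompact M → ∀ T T' : Triangulation M,
    (Triangulation.PachnerMove22 T T' ∨ Triangulation.PachnerMove13 T T') →
    ∀ (G : DualGraph T) (G' : DualGraph T'), G.SameNearBoundary G' →
    ∀ bs : Finset ℂ → S, D.partitionFunction G bs = D.partitionFunction G' bs

end Data

end PlanarStateSum

end

noncomputable section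

namespace PlanarStateSum

/-! ### Continuous choices of argument -/

/-! The value of a dual graph does not depend on how the graph is drawn inside the surface. Once
this is known, the two moves become two identities between `C`, `B` and `R`, and these are
equivalent to the axioms of a special Frobenius algebra.

Independence of the drawing. An extremum of the height on a line contributes `B`, its inverse or a
transpose, and this records a half turn of the tangent. Hence a leg contributes the matrix `turn n`,
where n counts the half turns of its tangent (`turn_mul_cornerAmp`, `legAmp_eq_turn`), and two legs
that meet on an interior edge contribute `turn N` with N odd. As `B` need not be symmetric, a full
turn is the matrix `nakayama`, in general not the identity. The relation between `C` and `B` says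
that the last leg of a dual vertex can be moved to the first place at the cost of a full turn
(`sum_C_nakayama`). What remains is topology: the turning of the three legs of a triangle has to be
compared with the outward normals of its edges. The secants between two arcs that meet only at their
common start have a continuous argument on a rectangle without a corner. Following it along the
sides shows, as in Hopf's Umlaufsatz, that the arguments of the normals singled out by the turning
of the legs come in the order of the legs and within one full turn
(`secant_angle_eq_of_endAngle_eq`, `abs_normal_angle_sub_lt`, `DualGraph.abs_normal_sub_lt`). Any
other choice of arguments within one turn, a framing, differs by full turns and a cyclic rotation,
which `C` does not notice. So `evalGraph_eq_framedSum` expresses the evaluation by the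
triangulation, a framing and the directions at the boundary alone.

The moves. A framed sum is a sum over outer states of an outer product times a local sum, and only
the local sum sees a move (`LocalChange.framedSum_eq`). In a suitable framing the local sums are
`quadAmp` and `quadAmp'` for the 2-2 move, `C` and `starAmp` for the 1-3 move, while the number of
interior vertices grows by 0 and by 1. Equality of the amplitudes, with a factor `R` for the 1-3
move, is therefore sufficient. It is also necessary: one move of each kind is realised by explicit
dual graphs, and the matrices at the boundary are invertible and can be cancelled
(`HasLocalChange.eq_of_evalGraph_eq`).

The algebra. Let ⟨x, y⟩ be the form with matrix `B⁻¹`. Then `C a b c` is both ⟨e_a e_b, e_c⟩ and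
⟨e_a, e_b e_c⟩, so the form is invariant. The 2-2 identity reads ⟨(xy)z, w⟩ = ⟨x(yz), w⟩, which is
associativity. Granted this, `starAmp` is ⟨e_a e_b, β e_c⟩, and non-degeneracy of `C` turns the 1-3
identity into the statement that Rβ is a left unit. Invariance makes it a right unit, and ε = ⟨·,
Rβ⟩ satisfies ε(xy) = ⟨x, y⟩. -/

/-- `θ` is an argument of the nonzero complex number `z`. -/
def IsAngle (θ : ℝ) (z : ℂ) : Prop := z ≠ 0 ∧ (θ : Real.Angle) = (z.arg : Real.Angle)

lemma isAngle_arg {z : ℂ} (hz : z ≠ 0) : IsAngle z.arg z := ⟨hz, rfl⟩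

lemma IsAngle.congr {θ θ' : ℝ} {z : ℂ} (h : IsAngle θ z)
    (hθ : (θ : Real.Angle) = (θ' : Real.Angle)) : IsAngle θ' z := ⟨h.1, hθ ▸ h.2⟩

lemma IsAngle.add_arg_div {θ : ℝ} {z w : ℂ} (h : IsAngle θ z) (hw : w ≠ 0) :
    IsAngle (θ + (w / z).arg) w := by
  refine ⟨hw, ?_⟩
  rw [Real.Angle.coe_add, h.2, Complex.arg_div_coe_angle hw h.1]; abel

lemma IsAngle.neg_add {θ : ℝ} {z : ℂ} (h : IsAngle θ z) : IsAngle (θ + Real.pi) (-z) :=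
  ⟨neg_ne_zero.2 h.1, by
    rw [Real.Angle.coe_add, h.2, Complex.arg_neg_coe_angle h.1]⟩

lemma IsAngle.neg_sub {θ : ℝ} {z : ℂ} (h : IsAngle θ z) : IsAngle (θ - Real.pi) (-z) :=
  h.neg_add.congr (by rw [Real.Angle.coe_add, Real.Angle.coe_sub, Real.Angle.sub_coe_pi_eq_add_coe_pi])

lemma IsAngle.smul {θ : ℝ} {z : ℂ} (h : IsAngle θ z) {r : ℝ} (hr : 0 < r) :
    IsAngle θ ((r : ℂ) * z) :=
  ⟨mul_ne_zero (by exact_mod_cast hr.ne') h.1, by rw [Complex.arg_real_mul _ hr, h.2]⟩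

lemma IsAngle.add_two_pi {θ : ℝ} {z : ℂ} (h : IsAngle θ z) (n : ℤ) :
    IsAngle (θ + 2 * Real.pi * n) z :=
  h.congr (Real.Angle.angle_eq_iff_two_pi_dvd_sub.2 ⟨-n, by push_cast; ring⟩)

lemma IsAngle.exists_int {θ θ' : ℝ} {z : ℂ} (h : IsAngle θ z) (h' : IsAngle θ' z) :
    ∃ n : ℤ, θ' = θ + 2 * Real.pi * n := by
  obtain ⟨n, hn⟩ := Real.Angle.angle_eq_iff_two_pi_dvd_sub.1 (h'.2.trans h.2.symm)
  exact ⟨n, by linarith⟩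

lemma IsAngle.unique {θ θ' : ℝ} {z : ℂ} (h : IsAngle θ z) (h' : IsAngle θ' z)
    (hlt : |θ - θ'| < 2 * Real.pi) : θ = θ' := by
  obtain ⟨n, rfl⟩ := h.exists_int h'
  have hp := Real.pi_pos
  rw [abs_lt] at hlt
  have h1 : (n : ℝ) < 1 := by nlinarith
  have h2 : (-1 : ℝ) < n := by nlinarith
  have h3 : n < 1 := by exact_mod_cast h1
  have h4 : -1 < n := by exact_mod_cast h2
  have : n = 0 := by omega
  simp [this]

/-- Of all arguments of `z` only one lies within π of `ω`, up to the boundary case, and the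
principal argument of the quotient produces it. Turning angles are recognised in this way below. -/
lemma IsAngle.eq_add_arg {θ ω : ℝ} {z w : ℂ} (h : IsAngle θ z) (hw : IsAngle ω w)
    (hlt : |θ - ω| < Real.pi) : θ = ω + (z / w).arg := by
  refine h.unique (hw.add_arg_div h.1) ?_
  have := Complex.abs_arg_le_pi (z / w)
  rw [abs_lt] at *
  rw [abs_le] at this
  constructor <;> linarith

lemma isAngle_iff_exp {θ : ℝ} {z : ℂ} :
    IsAngle θ z ↔ ∃ r : ℝ, 0 < r ∧ z = r * Complex.exp (θ * Complex.I) := by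
  constructor
  · intro h
    refine ⟨‖z‖, norm_pos_iff.2 h.1, ?_⟩
    obtain ⟨n, hn⟩ := (isAngle_arg h.1).exists_int h
    rw [hn]
    have : ((z.arg + 2 * Real.pi * n : ℝ) : ℂ) * Complex.I
        = z.arg * Complex.I + n * (2 * Real.pi * Complex.I) := by push_cast; ring
    rw [this, Complex.exp_add, Complex.exp_int_mul_two_pi_mul_I, mul_one,
      Complex.norm_mul_exp_arg_mul_I]
  · rintro ⟨r, hr, rfl⟩
    refine IsAngle.smul ⟨Complex.exp_ne_zero _, ?_⟩ hr
    rw [Complex.arg_exp_mul_I, Real.Angle.coe_toIocMod]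

section Lift

variable {E : Type*} [NormedAddCommGroup E] [NormedSpace ℝ E]

/-- The lifting criterion for coverings asks for local path connectedness; balls of a convex set are
convex. -/
lemma locallyPathConnectedSpace_of_convex {K : Set E} (hK : Convex ℝ K) :
    LocallyPathConnectedSpace K := by
  refine LocallyPathConnectedSpace.of_bases (p := fun _ r => 0 < r)
    (s := fun x r => Metric.ball x r) (fun x => Metric.nhds_basis_ball) ?_
  intro x r hr
  rw [Topology.IsInducing.subtypeVal.isPathConnected_iff]
  have : Subtype.val '' Metric.ball x r = Metric.ball (x : E) r ∩ K := by
    ext y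
    constructor
    · rintro ⟨y, hy, rfl⟩
      exact ⟨hy, y.2⟩
    · rintro ⟨hy, hyK⟩
      exact ⟨⟨y, hyK⟩, hy, rfl⟩
  rw [this]
  exact ((convex_ball _ _).inter hK).isPathConnected ⟨x, Metric.mem_ball_self hr, x.2⟩

/-- The exponential covers the punctured plane and `K` is contractible, so `F` lifts; the imaginary
part of the lift is the argument, and the value at `x₀` selects the lift. -/
lemma exists_continuous_angle {K : Set E} (hK : Convex ℝ K) {F : E → ℂ} (hF : ContinuousOn F K)
    (h0 : ∀ x ∈ K, F x ≠ 0) {x₀ : E} (hx₀ : x₀ ∈ K) {θ₀ : ℝ} (hθ₀ : IsAngle θ₀ (F x₀)) :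
    ∃ l : E → ℝ, ContinuousOn l K ∧ (∀ x ∈ K, IsAngle (l x) (F x)) ∧ l x₀ = θ₀ := by
  classical
  have := locallyPathConnectedSpace_of_convex hK
  have : ContractibleSpace K := hK.contractibleSpace ⟨x₀, hx₀⟩
  obtain ⟨r, hr, hz⟩ := isAngle_iff_exp.1 hθ₀
  obtain ⟨f, ⟨hf0, hf⟩, -⟩ := Complex.isCoveringMapOn_exp.existsUnique_continuousMap_lifts
    ⟨K.domRestrict F, continuousOn_iff_continuous_domRestrict.mp hF⟩ (a₀ := ⟨x₀, hx₀⟩)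
    (e₀ := Real.log r + θ₀ * Complex.I)
    (by
      rw [Complex.exp_add, ← Complex.ofReal_exp, Real.exp_log hr]
      exact hz.symm)
    (fun x => h0 x x.2)
  have hf' : ∀ x : K, Complex.exp (f x) = F x := fun x => congrFun hf x
  refine ⟨fun x => if hx : x ∈ K then (f ⟨x, hx⟩).im else 0, ?_, ?_, ?_⟩
  · rw [continuousOn_iff_continuous_domRestrict]
    have : Continuous fun x : K => (f x).im := Complex.continuous_im.comp f.continuous
    convert this using 2 with x
    simp
  · intro x hx
    rw [isAngle_iff_exp]
    refine ⟨Real.exp (f ⟨x, hx⟩).re, Real.exp_pos _, ?_⟩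
    simp only [dif_pos hx]
    rw [← hf' ⟨x, hx⟩, Complex.ofReal_exp, ← Complex.exp_add, Complex.re_add_im]
  · simp [hx₀, hf0]

end Lift

lemma angle_eqOn {X : Type*} [TopologicalSpace X] {K : Set X} (hK : IsPreconnected K) {F : X → ℂ}
    {l l' : X → ℝ} (hl : ContinuousOn l K) (hl' : ContinuousOn l' K)
    (h : ∀ x ∈ K, IsAngle (l x) (F x)) (h' : ∀ x ∈ K, IsAngle (l' x) (F x))
    {x₀ : X} (hx₀ : x₀ ∈ K) (h0 : l x₀ = l' x₀) : ∀ x ∈ K, l x = l' x := by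
  intro x hx
  have hp := Real.two_pi_pos
  have hc : ContinuousOn (fun x => (l' x - l x) / (2 * Real.pi)) K := (hl'.sub hl).div_const _
  have hint : ∀ y ∈ K, ∃ n : ℤ, (l' y - l y) / (2 * Real.pi) = n := by
    intro y hy
    obtain ⟨n, hn⟩ := (h y hy).exists_int (h' y hy)
    exact ⟨n, by rw [hn]; field_simp; ring⟩
  -- The difference divided by 2π is continuous and integer valued, and its image is an interval. If
  -- it contained 0 and a non-zero integer, it would contain 1/2 or -1/2.
  have him := hK.image _ hc
  by_contra hne
  have hx1 : (l' x - l x) / (2 * Real.pi) ≠ 0 :=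
    div_ne_zero (sub_ne_zero.2 (Ne.symm hne)) hp.ne'
  have hx01 : (l' x₀ - l x₀) / (2 * Real.pi) = 0 := by rw [h0]; simp
  obtain ⟨n, hn⟩ := hint x hx
  have hn0 : n ≠ 0 := by rintro rfl; exact hx1 (by simpa using hn)
  have hoc := him.ordConnected
  have m0 : (0 : ℝ) ∈ (fun x => (l' x - l x) / (2 * Real.pi)) '' K := ⟨x₀, hx₀, hx01⟩
  have mn : (n : ℝ) ∈ (fun x => (l' x - l x) / (2 * Real.pi)) '' K := ⟨x, hx, hn⟩
  rcases lt_or_gt_of_ne hn0 with hlt | hlt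
  · have : (n : ℝ) ≤ -1 := by exact_mod_cast (by omega : n ≤ -1)
    obtain ⟨y, hy, hy2⟩ := hoc.out mn m0 (show (-1/2 : ℝ) ∈ Set.Icc (n : ℝ) 0 by
      constructor <;> linarith)
    obtain ⟨m, hm⟩ := hint y hy
    simp only [hm] at hy2
    have : (2 * m : ℝ) = -1 := by linarith
    have : 2 * m = -1 := by exact_mod_cast this
    omega
  · have : (1 : ℝ) ≤ n := by exact_mod_cast (by omega : 1 ≤ n)
    obtain ⟨y, hy, hy2⟩ := hoc.out m0 mn (show (1/2 : ℝ) ∈ Set.Icc 0 (n : ℝ) by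
      constructor <;> linarith)
    obtain ⟨m, hm⟩ := hint y hy
    simp only [hm] at hy2
    have : (2 * m : ℝ) = 1 := by linarith
    have : 2 * m = 1 := by exact_mod_cast this
    omega

/-- While the quotient avoids the negative real axis, the principal argument relative to `w` is
continuous, so its agreement with a lift at one point spreads. Lifts are evaluated in this way
without counting turns. -/
lemma angle_eqOn_slit {X : Type*} [TopologicalSpace X] {K : Set X} (hK : IsPreconnected K)
    {F : X → ℂ} (hF : ContinuousOn F K) {l : X → ℝ} (hl : ContinuousOn l K)
    (h : ∀ x ∈ K, IsAngle (l x) (F x)) {ω : ℝ} {w : ℂ} (hw : IsAngle ω w)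
    (hs : ∀ x ∈ K, F x / w ∈ Complex.slitPlane)
    {x₀ : X} (hx₀ : x₀ ∈ K) (h0 : l x₀ = ω + (F x₀ / w).arg) :
    ∀ x ∈ K, l x = ω + (F x / w).arg := by
  refine angle_eqOn hK hl ?_ h (fun x hx => hw.add_arg_div (h x hx).1) hx₀ h0
  refine continuousOn_const.add fun x hx => ?_
  have hc : ContinuousWithinAt (fun x => F x / w) K x := (hF.div_const w) x hx
  exact (Complex.continuousAt_arg (hs x hx)).comp_continuousWithinAt (f := fun x => F x / w) hc

lemma abs_arg_lt_pi_div_two {z : ℂ} (hz : 0 < z.re) : |z.arg| < Real.pi / 2 :=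
  Complex.abs_arg_lt_pi_div_two_iff.2 (Or.inl hz)

lemma abs_arg_lt_pi {z : ℂ} (hz : z ∈ Complex.slitPlane) : |z.arg| < Real.pi := by
  rw [Complex.mem_slitPlane_iff_arg] at hz
  exact lt_of_le_of_ne (Complex.abs_arg_le_pi z) fun h => by
    rcases eq_or_eq_neg_of_abs_eq h with h | h
    · exact hz.1 h
    · exact absurd (Complex.neg_pi_lt_arg z) (by simp [h])

lemma mem_slitPlane_of_re_pos {z : ℂ} (hz : 0 < z.re) : z ∈ Complex.slitPlane := Or.inl hz

/-! ### Secants of polygonal arcs -/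

/-- The right end is included: the floor jumps there, but both pieces take the value `p (i + 1)`. -/
lemma polyline_of_mem_Icc (p : ℕ → ℂ) {i : ℕ} {s : ℝ} (h1 : (i : ℝ) ≤ s) (h2 : s ≤ i + 1) :
    polyline p s = AffineMap.lineMap (p i) (p (i + 1)) (s - i) := by
  rcases h2.lt_or_eq with h2 | rfl
  · have hfl : ⌊s⌋₊ = i := (Nat.floor_eq_iff (le_trans (Nat.cast_nonneg _) h1)).2 ⟨h1, h2⟩
    have hfr : Int.fract s = s - i := by
      rw [Int.fract_eq_iff]
      exact ⟨by linarith, by linarith, i, by simp⟩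
    rw [polyline, hfl, hfr]
  · have hfl : ⌊(i : ℝ) + 1⌋₊ = i + 1 := by
      exact_mod_cast Nat.floor_natCast (R := ℝ) (i + 1)
    have hfr : Int.fract ((i : ℝ) + 1) = 0 := by
      exact_mod_cast Int.fract_natCast (R := ℝ) (i + 1)
    rw [polyline, hfl, hfr]
    simp

lemma polyline_natCast (p : ℕ → ℂ) (i : ℕ) : polyline p i = p i := by
  rw [polyline_of_mem_Icc p le_rfl (by simp)]; simp

lemma polyline_zero (p : ℕ → ℂ) : polyline p 0 = p 0 := by
  simpa using polyline_natCast p 0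

lemma polyline_of_mem_unit (p : ℕ → ℂ) {s : ℝ} (h1 : 0 ≤ s) (h2 : s ≤ 1) :
    polyline p s = p 0 + s * (p 1 - p 0) := by
  rw [polyline_of_mem_Icc p (i := 0) (by simpa) (by simpa)]
  simp [AffineMap.lineMap_apply]; ring

lemma polyline_succ (p : ℕ → ℂ) {s : ℝ} (hs : 0 ≤ s) :
    polyline (fun j => p (j + 1)) s = polyline p (s + 1) := by
  have h1 := Nat.floor_le hs
  have h2 := Nat.lt_floor_add_one s
  rw [polyline_of_mem_Icc (fun j => p (j + 1)) h1 h2.le,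
    polyline_of_mem_Icc p (i := ⌊s⌋₊ + 1) (by push_cast; linarith) (by push_cast; linarith)]
  push_cast
  congr 1
  ring

lemma continuousOn_polyline (p : ℕ → ℂ) (n : ℕ) :
    ContinuousOn (polyline p) (Set.Icc 0 n) := by
  induction n with
  | zero => simp
  | succ n ih =>
    have : Set.Icc (0 : ℝ) (n + 1 : ℕ) = Set.Icc 0 (n : ℝ) ∪ Set.Icc (n : ℝ) (n + 1 : ℕ) :=
      (Set.Icc_union_Icc_eq_Icc (by positivity) (by push_cast; linarith)).symm
    rw [this]
    refine ih.union_of_isClosed ?_ isClosed_Icc isClosed_Icc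
    refine ContinuousOn.congr
      (f := fun s : ℝ => AffineMap.lineMap (p n) (p (n + 1)) (s - n)) ?_ ?_
    · exact (AffineMap.lineMap_continuous.comp (by fun_prop)).continuousOn
    · intro s hs
      exact polyline_of_mem_Icc p hs.1 (by simpa using hs.2)

lemma isPreconnected_Ioc {a b : ℝ} : IsPreconnected (Set.Ioc a b) := Set.ordConnected_Ioc.isPreconnected

/-- For two arcs that start at the same point and are otherwise disjoint, the directions of the
secants between them have a continuous argument, which extends continuous arguments of the secants
from the common point. -/
lemma exists_secant_angle {f g : ℝ → ℂ} {a b : ℝ} (ha : 1 ≤ a) (hb : 1 ≤ b) (h0 : f 0 = g 0)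
    (hf : ContinuousOn f (Set.Icc 0 a)) (hg : ContinuousOn g (Set.Icc 0 b))
    (hne : ∀ s ∈ Set.Icc 0 a, ∀ t ∈ Set.Icc 0 b, f s = g t → s = 0 ∧ t = 0)
    {u v : ℂ} (hfu : ∀ s : ℝ, 0 ≤ s → s ≤ 1 → f s = f 0 + s * u)
    (hgv : ∀ s : ℝ, 0 ≤ s → s ≤ 1 → g s = g 0 + s * v)
    {lf lg : ℝ → ℝ} (hlf : ContinuousOn lf (Set.Ioc 0 a)) (hlg : ContinuousOn lg (Set.Ioc 0 b))
    (hlf' : ∀ s ∈ Set.Ioc 0 a, IsAngle (lf s) (f s - f 0))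
    (hlg' : ∀ s ∈ Set.Ioc 0 b, IsAngle (lg s) (g s - g 0))
    (hlt : |lg 1 - (lf 1 + Real.pi)| < Real.pi) :
    ∃ l : ℝ × ℝ → ℝ,
      ContinuousOn l {p | p.1 ∈ Set.Icc 0 a ∧ p.2 ∈ Set.Icc 0 b ∧ 0 < p.1 + p.2} ∧
      (∀ p ∈ {p : ℝ × ℝ | p.1 ∈ Set.Icc 0 a ∧ p.2 ∈ Set.Icc 0 b ∧ 0 < p.1 + p.2},
        IsAngle (l p) (g p.2 - f p.1)) ∧
      (∀ s ∈ Set.Ioc 0 a, l (s, 0) = lf s + Real.pi) ∧ ∀ t ∈ Set.Ioc 0 b, l (0, t) = lg t := by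
  -- The secant vanishes only at the corner (0, 0) of the rectangle. The half plane of positive
  -- coordinate sum cuts off just this corner, so what remains is convex and carries a continuous
  -- argument.
  set K : Set (ℝ × ℝ) := {p | p.1 ∈ Set.Icc 0 a ∧ p.2 ∈ Set.Icc 0 b ∧ 0 < p.1 + p.2} with hK
  have hKc : Convex ℝ K := by
    have h1 : Convex ℝ (Set.Icc (0 : ℝ) a ×ˢ Set.Icc (0 : ℝ) b) :=
      (convex_Icc 0 a).prod (convex_Icc 0 b)
    have h2 : Convex ℝ {p : ℝ × ℝ | 0 < p.1 + p.2} :=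
      convex_halfSpace_gt (IsLinearMap.mk (by intros; simp; ring) (by intros; simp; ring)) 0
    convert h1.inter h2 using 1
    ext p
    simp only [hK, Set.mem_ofPred_eq, Set.mem_inter_iff, Set.mem_prod, and_assoc]
  have hFc : ContinuousOn (fun p : ℝ × ℝ => g p.2 - f p.1) K :=
    (hg.comp continuous_snd.continuousOn fun p hp => hp.2.1).sub
      (hf.comp continuous_fst.continuousOn fun p hp => hp.1)
  have hF0 : ∀ p ∈ K, g p.2 - f p.1 ≠ 0 := by
    intro p hp h
    obtain ⟨h1, h2⟩ := hne _ hp.1 _ hp.2.1 (sub_eq_zero.1 h).symm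
    have := hp.2.2
    rw [h1, h2] at this
    simp at this
  have h01 : (0, 1) ∈ K := ⟨⟨le_rfl, by linarith⟩, ⟨by norm_num, hb⟩, by norm_num⟩
  have h10 : (1, 0) ∈ K := ⟨⟨by norm_num, ha⟩, ⟨le_rfl, by linarith⟩, by norm_num⟩
  have hv := hlg' 1 ⟨by norm_num, hb⟩
  rw [hgv 1 (by norm_num) le_rfl] at hv
  have hu := hlf' 1 ⟨by norm_num, ha⟩
  rw [hfu 1 (by norm_num) le_rfl] at hu
  simp only [Complex.ofReal_one, one_mul, add_sub_cancel_left] at hu hv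
  obtain ⟨l, hl, hl', hl01⟩ := exists_continuous_angle hKc hFc hF0 h01 (θ₀ := lg 1)
    (by simpa only [h0, hgv 1 (by norm_num) le_rfl, Complex.ofReal_one, one_mul, add_sub_cancel_left]
      using hv)
  -- The lift is normalised at (0, 1). To find its value at (1, 0), follow the segment between these
  -- points, on which the secant is a convex combination of `v` and `-u`.
  have hl10 : l (1, 0) = lf 1 + Real.pi := by
    have hseg : ∀ τ ∈ Set.Icc (0 : ℝ) 1, (1 - τ, τ) ∈ K := fun τ hτ =>
      ⟨⟨by linarith [hτ.2], by linarith [hτ.1]⟩, ⟨hτ.1, by linarith [hτ.2]⟩, by simp⟩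
    have hFs : ∀ τ ∈ Set.Icc (0 : ℝ) 1, g τ - f (1 - τ) = τ * v - (1 - τ) * u := by
      intro τ hτ
      rw [hgv τ hτ.1 hτ.2, hfu (1 - τ) (by linarith [hτ.2]) (by linarith [hτ.1]), h0]
      push_cast; ring
    have hcm : ContinuousOn (fun τ : ℝ => ((1 - τ, τ) : ℝ × ℝ)) (Set.Icc 0 1) := by fun_prop
    have key := angle_eqOn_slit (K := Set.Icc (0 : ℝ) 1) isPreconnected_Icc
      (F := fun τ => g τ - f (1 - τ)) (l := fun τ => l (1 - τ, τ))
      (hFc.comp hcm hseg) (hl.comp hcm hseg) (fun τ hτ => hl' _ (hseg τ hτ)) hv ?_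
      (x₀ := 1) (by simp) (by
        rw [hFs 1 (by simp)]
        simp [hl01, div_self hv.1])
    · have h2 := key 0 (by simp)
      have h3 := hFs 0 (by simp)
      simp only [Complex.ofReal_zero, zero_mul, sub_zero, one_mul, zero_sub] at h2 h3
      rw [h3] at h2
      rw [h2]
      exact (hu.neg_add.eq_add_arg hv (by rw [abs_sub_comm]; exact hlt)).symm
    · intro τ hτ
      simp only [hFs τ hτ]
      rw [sub_div, mul_div_assoc, div_self hv.1, mul_one, mul_div_assoc]
      rw [Complex.mem_slitPlane_iff]
      by_contra! hcon
      obtain ⟨h1, h2⟩ := hcon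
      have him : ((τ : ℂ) - (1 - τ) * (u / v)).im = -((1 - τ) * (u / v).im) := by
        simp
      have hre : ((τ : ℂ) - (1 - τ) * (u / v)).re = τ - (1 - τ) * (u / v).re := by
        simp
      rw [him] at h2
      rw [hre] at h1
      rcases hτ.2.lt_or_eq with hτ1 | rfl
      -- If the combination lay on the negative real axis relative to `v`, then `u` would be a
      -- positive multiple of `v`, and `lg 1 - lf 1` a multiple of 2π. But `hlt` puts this
      -- difference strictly between 0 and 2π.
      · have hi : (u / v).im = 0 := by
          rcases mul_eq_zero.1 (neg_eq_zero.1 h2) with h | h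
          · linarith
          · exact h
        have hr : 0 ≤ (u / v).re := by
          by_contra! hneg
          nlinarith [hτ.1]
        have huv : u = ((u / v).re : ℂ) * v := by
          have : u / v = ((u / v).re : ℂ) := Complex.ext (by simp) (by simp [hi])
          rw [← this, div_mul_cancel₀ _ hv.1]
        have hr' : 0 < (u / v).re := lt_of_le_of_ne hr fun h => hu.1 (by rw [huv, ← h]; simp)
        have hu2 : IsAngle (lg 1) u := by rw [huv]; exact hv.smul hr'
        obtain ⟨n, hn⟩ := hu.exists_int hu2
        rw [hn, abs_lt] at hlt
        have hp := Real.pi_pos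
        have hn1 : (n : ℝ) < 1 := by nlinarith
        have hn2 : (0 : ℝ) < n := by nlinarith
        have hn3 : n < 1 := by exact_mod_cast hn1
        have hn4 : 0 < n := by exact_mod_cast hn2
        omega
      · norm_num at h1
  refine ⟨l, hl, hl', ?_, ?_⟩
  · have hm : ∀ s ∈ Set.Ioc 0 a, ((s, 0) : ℝ × ℝ) ∈ K := fun s hs =>
      ⟨⟨hs.1.le, hs.2⟩, ⟨le_rfl, by linarith⟩, by simpa using hs.1⟩
    have hc : ContinuousOn (fun s : ℝ => ((s, 0) : ℝ × ℝ)) (Set.Ioc 0 a) := by fun_prop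
    refine angle_eqOn isPreconnected_Ioc (F := fun s => -(f s - f 0)) (hl.comp hc hm)
      (hlf.add continuousOn_const) ?_ (fun s hs => (hlf' s hs).neg_add) (x₀ := 1) ⟨by norm_num, ha⟩ hl10
    intro s hs
    have := hl' _ (hm s hs)
    simpa only [neg_sub, h0] using this
  · have hm : ∀ s ∈ Set.Ioc 0 b, ((0, s) : ℝ × ℝ) ∈ K := fun s hs =>
      ⟨⟨le_rfl, by linarith⟩, ⟨hs.1.le, hs.2⟩, by simpa using hs.1⟩
    have hc : ContinuousOn (fun s : ℝ => ((0, s) : ℝ × ℝ)) (Set.Ioc 0 b) := by fun_prop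
    refine angle_eqOn isPreconnected_Ioc (F := fun s => g s - g 0) (hl.comp hc hm)
      hlg ?_ hlg' (x₀ := 1) ⟨by norm_num, hb⟩ hl01
    intro s hs
    have := hl' _ (hm s hs)
    simpa only [h0] using this

/-- Two arcs that start at the same point, are otherwise disjoint and leave a convex region with
outward normals `w`, `w'` have the normals in the same cyclic order as their initial
directions. -/
lemma abs_normal_angle_sub_lt {f g : ℝ → ℂ} {a b : ℝ} (ha : 1 ≤ a) (hb : 1 ≤ b) (h0 : f 0 = g 0)
    (hf : ContinuousOn f (Set.Icc 0 a)) (hg : ContinuousOn g (Set.Icc 0 b))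
    (hne : ∀ s ∈ Set.Icc 0 a, ∀ t ∈ Set.Icc 0 b, f s = g t → s = 0 ∧ t = 0)
    {u v : ℂ} (hfu : ∀ s : ℝ, 0 ≤ s → s ≤ 1 → f s = f 0 + s * u)
    (hgv : ∀ s : ℝ, 0 ≤ s → s ≤ 1 → g s = g 0 + s * v)
    {lf lg : ℝ → ℝ} (hlf : ContinuousOn lf (Set.Ioc 0 a)) (hlg : ContinuousOn lg (Set.Ioc 0 b))
    (hlf' : ∀ s ∈ Set.Ioc 0 a, IsAngle (lf s) (f s - f 0))
    (hlg' : ∀ s ∈ Set.Ioc 0 b, IsAngle (lg s) (g s - g 0))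
    (hlt : |lg 1 - (lf 1 + Real.pi)| < Real.pi)
    {Φ Φ' : ℝ} {w w' : ℂ} (hw : IsAngle Φ w) (hw' : IsAngle Φ' w')
    (hfw : ∀ t ∈ Set.Icc 0 b, 0 < ((f a - g t) / w).re)
    (hgw : ∀ s ∈ Set.Icc 0 a, 0 < ((g b - f s) / w').re)
    (hlfa : lf a = Φ + ((f a - f 0) / w).arg) (hlgb : lg b = Φ' + ((g b - g 0) / w').arg) :
    |Φ' - (Φ + Real.pi)| < Real.pi := by
  obtain ⟨l, hl, hl', hl1, hl2⟩ := exists_secant_angle ha hb h0 hf hg hne hfu hgv hlf hlg hlf' hlg' hlt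
  -- On the side `s = a` the secants start at the end of `f` and stay in the open half plane of
  -- `-w`; on the side `t = b` they end at the end of `g` and stay in that of `w'`. At the common
  -- corner (a, b) the argument is thus within π/2 of both `Φ + π` and `Φ'`.
  have e1 := angle_eqOn_slit (K := Set.Icc 0 b) isPreconnected_Icc (F := fun t => g t - f a)
    (l := fun t => l (a, t)) (hg.sub continuousOn_const)
    (hl.comp (by fun_prop) fun t ht => ⟨⟨by linarith, le_rfl⟩, ht, by simp; linarith [ht.1]⟩)
    (fun t ht => hl' (a, t) ⟨⟨by linarith, le_rfl⟩, ht, by simp; linarith [ht.1]⟩)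
    hw.neg_add
    (fun t ht => mem_slitPlane_of_re_pos (by
      have := hfw t ht; rwa [div_neg, ← neg_div, neg_sub]))
    (x₀ := 0) ⟨le_rfl, by linarith⟩ (by
      rw [hl1 a ⟨by linarith, le_rfl⟩, hlfa, div_neg, ← neg_div, neg_sub, h0]; ring)
    b ⟨by linarith, le_rfl⟩
  have e2 := angle_eqOn_slit (K := Set.Icc 0 a) isPreconnected_Icc (F := fun s => g b - f s)
    (l := fun s => l (s, b)) (continuousOn_const.sub hf)
    (hl.comp (by fun_prop) fun t ht => ⟨ht, ⟨by linarith, le_rfl⟩, by simp; linarith [ht.1]⟩)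
    (fun t ht => hl' (t, b) ⟨ht, ⟨by linarith, le_rfl⟩, by simp; linarith [ht.1]⟩)
    hw' (fun s hs => mem_slitPlane_of_re_pos (hgw s hs)) (x₀ := 0) ⟨le_rfl, by linarith⟩ (by
      rw [hl2 b ⟨by linarith, le_rfl⟩, hlgb, h0])
    a ⟨by linarith, le_rfl⟩
  have b1 := abs_arg_lt_pi_div_two (z := (g b - f a) / -w) (by
    have := hfw b ⟨by linarith, le_rfl⟩; rwa [div_neg, ← neg_div, neg_sub])
  have b2 := abs_arg_lt_pi_div_two (hgw a ⟨by linarith, le_rfl⟩)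
  rw [abs_lt] at *
  constructor <;> linarith

/-- The argument with which a polygonal arc with initial argument `α` arrives at its end. -/
def endAngle (α : ℝ) (p : ℕ → ℂ) (n : ℕ) : ℝ :=
  α + ∑ i ∈ Finset.range (n - 1), ((p (i + 2) - p (i + 1)) / (p (i + 1) - p i)).arg

lemma polyline_injOn_ne {p : ℕ → ℂ} {n : ℕ} (h : Set.InjOn (polyline p) (Set.Icc 0 n)) {i j : ℕ}
    (hi : i ≤ n) (hj : j ≤ n) (hij : i ≠ j) : p i ≠ p j := by
  intro he
  rw [← polyline_natCast p i, ← polyline_natCast p j] at he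
  have := h ⟨by positivity, Nat.cast_le.2 hi⟩ ⟨by positivity, Nat.cast_le.2 hj⟩ he
  exact hij (Nat.cast_injective this)

/-- A simple polygonal arc does not turn back. -/
lemma abs_turn_lt_pi {p : ℕ → ℂ} {n : ℕ} (h : Set.InjOn (polyline p) (Set.Icc 0 n)) {i : ℕ}
    (hi : i + 2 ≤ n) : |((p (i + 2) - p (i + 1)) / (p (i + 1) - p i)).arg| < Real.pi := by
  have h0 : p (i + 1) - p i ≠ 0 := sub_ne_zero.2 (polyline_injOn_ne h (by omega) (by omega) (by omega))
  have h1 : p (i + 2) - p (i + 1) ≠ 0 :=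
    sub_ne_zero.2 (polyline_injOn_ne h (by omega) (by omega) (by omega))
  apply abs_arg_lt_pi
  rw [Complex.mem_slitPlane_iff]
  by_contra! hcon
  obtain ⟨hre, him⟩ := hcon
  set c := ((p (i + 2) - p (i + 1)) / (p (i + 1) - p i)).re with hc
  have he : p (i + 2) - p (i + 1) = c * (p (i + 1) - p i) := by
    have : (p (i + 2) - p (i + 1)) / (p (i + 1) - p i) = (c : ℂ) :=
      Complex.ext (by simp [hc]) (by simp [him])
    rw [← this, div_mul_cancel₀ _ h0]
  have hc0 : c < 0 := lt_of_le_of_ne hre fun h => h1 (by rw [he, h]; simp)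
  have h1c : 0 < 1 - c := by linarith
  -- If a segment is followed by `c < 0` times itself, the two overlap: `s` solves `1 + s * c = s`,
  -- so the parameters `i + s` and `i + 1 + s` give the same point.
  set s : ℝ := 1 / (1 - c) with hs
  have hs0 : 0 < s := by positivity
  have hs1 : s < 1 := by rw [hs, div_lt_one h1c]; linarith
  have hsc : s * c = s - 1 := by rw [hs]; field_simp; ring
  have e1 : polyline p (i + 1 + s) = p i + (s : ℂ) * (p (i + 1) - p i) := by
    rw [polyline_of_mem_Icc p (i := i + 1) (by push_cast; linarith) (by push_cast; linarith)]
    have hsc' : (s : ℂ) * c = s - 1 := by exact_mod_cast hsc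
    have : ((i + 1 + s - (i + 1 : ℕ) : ℝ) : ℂ) = s := by push_cast; ring
    rw [AffineMap.lineMap_apply, vsub_eq_sub, vadd_eq_add, Complex.real_smul, this, he, ← mul_assoc,
      hsc']
    ring
  have e2 : polyline p (i + s) = p i + (s : ℂ) * (p (i + 1) - p i) := by
    rw [polyline_of_mem_Icc p (i := i) (by linarith) (by linarith)]
    rw [AffineMap.lineMap_apply, vsub_eq_sub, vadd_eq_add, Complex.real_smul]
    push_cast; ring
  have hn : (i : ℝ) + 2 ≤ n := by exact_mod_cast hi
  have := h ⟨by positivity, by linarith⟩ ⟨by positivity, by linarith⟩ (e1.trans e2.symm)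
  linarith

/-- The argument with which a polygonal arc arrives at a boundary with outward normal `w` and a
continuous argument of the secants from the start of the arc determine the same argument
of `w`. -/
lemma secant_angle_eq_of_endAngle_eq {w : ℂ} {Φ : ℝ} (hw : IsAngle Φ w) (n : ℕ) (p : ℕ → ℂ)
    (hinj : Set.InjOn (polyline p) (Set.Icc 0 (n + 1 : ℕ)))
    (hpos : ∀ s ∈ Set.Ico (0 : ℝ) (n + 1 : ℕ), 0 < ((p (n + 1) - polyline p s) / w).re)
    {lp : ℝ → ℝ} (hlp : ContinuousOn lp (Set.Ioc 0 (n + 1 : ℕ)))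
    (hlp' : ∀ s ∈ Set.Ioc (0 : ℝ) (n + 1 : ℕ), IsAngle (lp s) (polyline p s - p 0))
    (hend : endAngle (lp 1) p (n + 1) = Φ + ((p (n + 1) - p n) / w).arg) :
    lp (n + 1 : ℕ) = Φ + ((p (n + 1) - p 0) / w).arg := by
  -- The first segment is removed. The arrival argument does not change if the turn at `p 1` is
  -- added to the initial argument, so it remains to compare the secants from `p 0` with those from
  -- `p 1`.
  induction n generalizing p lp with
  | zero => simpa [endAngle] using hend
  | succ n ih =>
    have hn0 : (0 : ℝ) ≤ n := Nat.cast_nonneg n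
    set q : ℕ → ℂ := fun j => p (j + 1) with hq
    have hqp : ∀ s : ℝ, 0 ≤ s → polyline q s = polyline p (s + 1) := fun s hs => polyline_succ p hs
    have hqinj : Set.InjOn (polyline q) (Set.Icc 0 (n + 1 : ℕ)) := by
      intro s hs t ht hst
      rw [hqp s hs.1, hqp t ht.1] at hst
      have h1 := hs.2
      have h2 := ht.2
      push_cast at h1 h2
      have := hinj ⟨by linarith [hs.1], by push_cast; linarith⟩
        ⟨by linarith [ht.1], by push_cast; linarith⟩ hst
      linarith
    have hd0 : p 1 - p 0 ≠ 0 := sub_ne_zero.2 (polyline_injOn_ne hinj (by omega) (by omega) (by omega))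
    have hd1 : q 1 - q 0 ≠ 0 := sub_ne_zero.2 (polyline_injOn_ne hqinj (by omega) (by omega) (by omega))
    have hlp1 : IsAngle (lp 1) (p 1 - p 0) := by
      have := hlp' 1 ⟨by norm_num, by push_cast; linarith⟩
      rwa [← Nat.cast_one, polyline_natCast, Nat.cast_one] at this
    have hturn : |((q 1 - q 0) / (p 1 - p 0)).arg| < Real.pi := abs_turn_lt_pi hinj (i := 0) (by omega)
    have hIoc : Set.Ioc (0 : ℝ) (n + 1 : ℕ) ⊆ Set.Icc 0 (n + 1 : ℕ) := Set.Ioc_subset_Icc_self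
    have h1mem : (1 : ℝ) ∈ Set.Ioc (0 : ℝ) (n + 1 : ℕ) := ⟨by norm_num, by push_cast; linarith⟩
    -- The secants from `p 1` get the argument that continues the first tangent after the turn at `p
    -- 1`.
    obtain ⟨lq, hlq, hlq', hlq1⟩ := exists_continuous_angle (convex_Ioc (0 : ℝ) (n + 1 : ℕ))
      (F := fun s => polyline q s - q 0)
      (((continuousOn_polyline q (n + 1)).mono hIoc).sub continuousOn_const)
      (fun s hs h => by
        rw [sub_eq_zero, ← polyline_zero q] at h
        have := hqinj (hIoc hs) ⟨le_rfl, by positivity⟩ h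
        linarith [hs.1]) h1mem (θ₀ := lp 1 + ((q 1 - q 0) / (p 1 - p 0)).arg)
      (by
        have := polyline_natCast q 1
        rw [Nat.cast_one] at this
        simp only [this]
        exact hlp1.add_arg_div hd1)
    have hend' : endAngle (lq 1) q (n + 1) = Φ + ((q (n + 1) - q n) / w).arg := by
      rw [← hend, hlq1, endAngle, endAngle]
      simp only [Nat.add_sub_cancel]
      rw [Finset.sum_range_succ']
      simp only [hq, zero_add]
      ring_nf
    have hposq : ∀ s ∈ Set.Ico (0 : ℝ) (n + 1 : ℕ), 0 < ((q (n + 1) - polyline q s) / w).re := by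
      intro s hs
      rw [hqp s hs.1]
      have := hs.2
      push_cast at this
      exact hpos (s + 1) ⟨by linarith [hs.1], by push_cast; linarith⟩
    have hIH := ih q hqinj hposq hlq hlq' hend'
    have hfp : ∀ s ∈ Set.Icc (0 : ℝ) 1, p 1 + (s : ℂ) * (p 0 - p 1) = polyline p (1 - s) := by
      intro s hs
      rw [polyline_of_mem_unit p (by linarith [hs.2]) (by linarith [hs.1])]
      push_cast; ring
    -- The first segment run backwards and the rest of the arc are two arcs from `p 1` that meet
    -- nowhere else. Their secants join the secants from `p 0` to those from `p 1`.
    obtain ⟨l, hl, hl', hl1, hl2⟩ := exists_secant_angle (f := fun s : ℝ => p 1 + (s : ℂ) * (p 0 - p 1))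
      (g := polyline q) (a := 1) (b := (n + 1 : ℕ)) le_rfl (by push_cast; linarith)
      (by simp [polyline_zero, hq]) (by fun_prop) (continuousOn_polyline q _)
      (by
        intro s hs t ht hst
        rw [hfp s hs, hqp t ht.1] at hst
        have := ht.2
        push_cast at this
        have := hinj ⟨by linarith [hs.2], by push_cast; linarith [hs.1]⟩
          ⟨by linarith [ht.1], by push_cast; linarith⟩ hst
        constructor <;> linarith [hs.1, ht.1])
      (u := p 0 - p 1) (v := q 1 - q 0) (by intro s _ _; simp)
      (by intro s h1 h2; rw [polyline_zero]; exact polyline_of_mem_unit q h1 h2)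
      (lf := fun _ => lp 1 - Real.pi) (lg := lq) continuousOn_const hlq
      (by
        intro s hs
        have := (hlp1.neg_sub).smul hs.1
        simpa using this)
      (by intro s hs; rw [polyline_zero]; exact hlq' s hs)
      (by rw [hlq1]; simpa using hturn)
    -- With the foot fixed at `p 0` the secants are those of the original arc, with the parameter
    -- shifted by one.
    have e1 : l (1, (n + 1 : ℕ)) = lp ((n + 1 : ℕ) + 1) := by
      refine angle_eqOn (K := Set.Icc (0 : ℝ) (n + 1 : ℕ)) isPreconnected_Icc
        (F := fun t => polyline q t - p 0) (l := fun t => l (1, t)) (l' := fun t => lp (t + 1))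
        (hl.comp (by fun_prop) fun t ht => ⟨⟨by norm_num, le_rfl⟩, ht, by simp; linarith [ht.1]⟩)
        (hlp.comp (by fun_prop) fun t ht => ⟨by linarith [ht.1], ?_⟩) ?_ ?_
        (x₀ := 0) ⟨le_rfl, by positivity⟩ ?_ _ ⟨by positivity, le_rfl⟩
      · have := ht.2
        push_cast at this ⊢
        linarith
      · intro t ht
        have := hl' (1, t) ⟨⟨by norm_num, le_rfl⟩, ht, by simp; linarith [ht.1]⟩
        simpa using this
      · intro t ht
        rw [hqp t ht.1]
        refine hlp' (t + 1) ⟨by linarith [ht.1], ?_⟩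
        have := ht.2
        push_cast at this ⊢
        linarith
      · simp only [hl1 1 ⟨by norm_num, le_rfl⟩]; simp
    -- With the tip fixed at the end of the arc, the foot moves from `p 1` back to `p 0`; by `hpos`
    -- the secant never leaves the half plane of `w`.
    have e2 := angle_eqOn_slit (K := Set.Icc (0 : ℝ) 1) isPreconnected_Icc
      (F := fun s => polyline q (n + 1 : ℕ) - (p 1 + (s : ℂ) * (p 0 - p 1)))
      (l := fun s => l (s, (n + 1 : ℕ))) (by fun_prop)
      (hl.comp (by fun_prop) fun t ht => ⟨ht, ⟨by positivity, le_rfl⟩, by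
        simp only; push_cast; linarith [ht.1]⟩)
      (fun t ht => hl' (t, (n + 1 : ℕ)) ⟨ht, ⟨by positivity, le_rfl⟩, by
        simp only; push_cast; linarith [ht.1]⟩)
      hw
      (fun s hs => mem_slitPlane_of_re_pos (by
        rw [hfp s hs, polyline_natCast]
        exact hpos (1 - s) ⟨by linarith [hs.2], by push_cast; linarith [hs.1]⟩))
      (x₀ := 0) ⟨le_rfl, by norm_num⟩
      (by
        rw [hl2 _ ⟨by positivity, le_rfl⟩, hIH, polyline_natCast]
        simp [hq])
      1 ⟨by norm_num, le_rfl⟩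
    have hcast : ((n + 1 + 1 : ℕ) : ℝ) = ((n + 1 : ℕ) : ℝ) + 1 := by push_cast; ring
    rw [hcast, ← e1, e2, polyline_natCast]
    simp [hq]

/-! ### Half turns -/

/-- The half plane that contains the direction with argument `θ`: even for the downward ones. -/
def halfTurns (θ : ℝ) : ℤ := ⌊θ / Real.pi⌋ + 1

lemma halfTurns_add_pi_mul (θ : ℝ) (n : ℤ) : halfTurns (θ + Real.pi * n) = halfTurns θ + n := by
  rw [halfTurns, add_div, mul_div_cancel_left₀ _ Real.pi_ne_zero, Int.floor_add_intCast, halfTurns]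
  ring

lemma halfTurns_add_two_pi_mul (θ : ℝ) (n : ℤ) :
    halfTurns (θ + 2 * Real.pi * n) = halfTurns θ + 2 * n := by
  rw [← halfTurns_add_pi_mul]; congr 1; push_cast; ring

lemma halfTurns_eq_zero {θ : ℝ} (h1 : -Real.pi < θ) (h2 : θ < 0) : halfTurns θ = 0 := by
  have : ⌊θ / Real.pi⌋ = -1 := by
    rw [Int.floor_eq_iff, le_div_iff₀ Real.pi_pos, div_lt_iff₀ Real.pi_pos]
    constructor <;> push_cast <;> linarith
  rw [halfTurns, this]; norm_num

lemma halfTurns_eq_one {θ : ℝ} (h1 : 0 < θ) (h2 : θ < Real.pi) : halfTurns θ = 1 := by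
  have : ⌊θ / Real.pi⌋ = 0 := by
    rw [Int.floor_eq_iff, le_div_iff₀ Real.pi_pos, div_lt_iff₀ Real.pi_pos]
    constructor <;> push_cast <;> linarith
  rw [halfTurns, this]; norm_num

lemma arg_mem_of_im_neg {z : ℂ} (h : z.im < 0) : -Real.pi < z.arg ∧ z.arg < 0 :=
  ⟨Complex.neg_pi_lt_arg z, Complex.arg_neg_iff.2 h⟩

lemma arg_mem_of_im_pos {z : ℂ} (h : 0 < z.im) : 0 < z.arg ∧ z.arg < Real.pi := by
  refine ⟨lt_of_le_of_ne (Complex.arg_nonneg_iff.2 h.le) fun h0 => ?_,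
    lt_of_le_of_ne (Complex.arg_le_pi z) fun h0 => ?_⟩
  · exact h.ne' (Complex.arg_eq_zero_iff.1 h0.symm).2
  · exact h.ne' (Complex.arg_eq_pi_iff.1 h0).2

/-! ### Matrices of half turns -/

namespace Data

variable {k : Type*} [Field k] {S : Type*} [Fintype S] [DecidableEq S]

/-- The matrix of a full counterclockwise turn. -/
def nakayama (D : Data k S) : Matrix S S k := D.B * D.B⁻¹.transpose

/-- The matrix of a line after `n` half turns. -/
def turn (D : Data k S) (n : ℤ) : Matrix S S k :=
  D.nakayama ^ (n / 2) * if n % 2 = 0 then 1 else D.B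

lemma isUnit_det {D : Data k S} (hD : D.Nondegenerate) : IsUnit D.B.det := by
  rw [← Matrix.isUnit_iff_isUnit_det, ← Matrix.mulVec_injective_iff_isUnit]
  intro v w hvw
  rw [← sub_eq_zero]
  apply hD.2.1
  intro a
  have := congrFun hvw a
  simp only [Matrix.mulVec, dotProduct] at this
  simp [mul_sub, this]

variable {D : Data k S} (hB : IsUnit D.B.det)
include hB

lemma isUnit_det_nakayama : IsUnit D.nakayama.det := by
  rw [nakayama, Matrix.det_mul, Matrix.det_transpose]
  exact hB.mul (Matrix.isUnit_nonsing_inv_det _ hB)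

lemma nakayama_mul_transpose : D.nakayama * D.B.transpose = D.B := by
  rw [nakayama, Matrix.mul_assoc, ← Matrix.transpose_mul, Matrix.mul_nonsing_inv _ hB,
    Matrix.transpose_one, Matrix.mul_one]

lemma mul_nakayama_transpose : D.B * D.nakayama.transpose = D.B.transpose := by
  rw [nakayama, Matrix.transpose_mul, Matrix.transpose_transpose, ← Matrix.mul_assoc,
    Matrix.mul_nonsing_inv _ hB, Matrix.one_mul]

lemma nakayama_zpow_add (m n : ℤ) :
    D.nakayama ^ (m + n) = D.nakayama ^ m * D.nakayama ^ n :=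
  Matrix.zpow_add (isUnit_det_nakayama hB) m n

lemma turn_add_two_mul (n j : ℤ) : D.turn (n + 2 * j) = D.nakayama ^ j * D.turn n := by
  rw [turn, turn, show (n + 2 * j) / 2 = j + n / 2 by omega, nakayama_zpow_add hB,
    show (n + 2 * j) % 2 = n % 2 by omega, Matrix.mul_assoc]

omit hB in
lemma turn_zero : D.turn 0 = 1 := by simp [turn]

omit hB in
lemma turn_one : D.turn 1 = D.B := by simp [turn]

lemma turn_neg_one : D.turn (-1) = D.B.transpose := by
  have h := turn_add_two_mul hB (-1) 1
  norm_num [turn_one] at h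
  have h2 := nakayama_mul_transpose hB
  have h3 : IsUnit D.nakayama := (Matrix.isUnit_iff_isUnit_det _).2 (isUnit_det_nakayama hB)
  exact h3.mul_left_cancel (h.symm.trans h2.symm)

lemma isUnit_turn (n : ℤ) : IsUnit (D.turn n) := by
  rw [turn]
  refine IsUnit.mul ?_ ?_
  · rw [Matrix.isUnit_iff_isUnit_det]
    exact (isUnit_det_nakayama hB).det_zpow _
  · split_ifs
    · exact isUnit_one
    · exact (Matrix.isUnit_iff_isUnit_det _).2 hB

/-- As a tensor with two indices `B` is invariant under a full turn applied to both, because the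
full turn exchanges `B` and its transpose from one side or the other. For odd `N`, `turn N` is `B`
times a power of `nakayama` and inherits this. -/
lemma nakayama_mul_turn_transpose {N : ℤ} (hN : N % 2 = 1) :
    D.nakayama * (D.turn N * D.nakayama.transpose) = D.turn N := by
  have h : D.turn N = D.nakayama ^ (N / 2) * D.B := by simp [turn, hN]
  rw [h, Matrix.mul_assoc, mul_nakayama_transpose hB, ← Matrix.mul_assoc]
  have : D.nakayama * D.nakayama ^ (N / 2) = D.nakayama ^ (N / 2) * D.nakayama := by
    have h1 := nakayama_zpow_add hB 1 (N / 2)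
    have h2 := nakayama_zpow_add hB (N / 2) 1
    rw [zpow_one] at h1 h2
    rw [← h1, ← h2, add_comm]
  rw [this, Matrix.mul_assoc, nakayama_mul_transpose hB]

lemma zpow_mul_turn_transpose {N : ℤ} (hN : N % 2 = 1) (j : ℤ) :
    D.nakayama ^ j * (D.turn N * (D.nakayama ^ j).transpose) = D.turn N := by
  have hu := isUnit_det_nakayama hB
  induction j using Int.induction_on with
  | zero => simp
  | succ j ih =>
    rw [nakayama_zpow_add hB, zpow_one, Matrix.transpose_mul, Matrix.mul_assoc,
      ← Matrix.mul_assoc (D.turn N), ← Matrix.mul_assoc D.nakayama, nakayama_mul_turn_transpose hB hN, ih]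
  | pred j ih =>
    rw [← ih]
    conv_lhs => rw [ih, ← nakayama_mul_turn_transpose hB hN]
    have h1 : D.nakayama ^ (-(j : ℤ)) = D.nakayama ^ (-(j : ℤ) - 1) * D.nakayama := by
      have h2 := nakayama_zpow_add hB (-(j : ℤ) - 1) 1
      rwa [zpow_one, sub_add_cancel] at h2
    rw [h1, Matrix.transpose_mul]
    simp only [Matrix.mul_assoc]

/-- Applied to the two indices of a line, half turns common to both ends cancel and only the
difference is left. This uses the invariance of odd turns under `nakayama`. -/
lemma turn_add_mul_transpose {N : ℤ} (hN : N % 2 = 1) (n : ℤ) :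
    D.turn (n + N) * (D.turn n).transpose = D.turn N := by
  obtain ⟨j, hj | hj⟩ : ∃ j, n = 0 + 2 * j ∨ n = 1 + 2 * j := ⟨n / 2, by omega⟩
  · subst hj
    rw [show 0 + 2 * j + N = N + 2 * j by ring, turn_add_two_mul hB, turn_add_two_mul hB, turn_zero,
      Matrix.mul_one, Matrix.mul_assoc, zpow_mul_turn_transpose hB hN]
  · subst hj
    obtain ⟨i, rfl⟩ : ∃ i, N = 1 + 2 * i := ⟨N / 2, by omega⟩
    rw [show 1 + 2 * j + (1 + 2 * i) = 0 + 2 * (j + i + 1) by ring, turn_add_two_mul hB,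
      turn_add_two_mul hB, turn_zero, Matrix.mul_one, nakayama_zpow_add hB, nakayama_zpow_add hB,
      zpow_one, turn_one, Matrix.transpose_mul]
    have := zpow_mul_turn_transpose hB hN j
    rw [turn_add_two_mul hB, turn_one] at this
    conv_rhs => rw [turn_add_two_mul hB, turn_one, ← this]
    conv_lhs => rw [Matrix.mul_assoc, Matrix.mul_assoc, ← Matrix.mul_assoc D.nakayama, nakayama_mul_transpose hB]
    rw [Matrix.mul_assoc]

lemma turn_transpose {N : ℤ} (hN : N % 2 = 1) : (D.turn N).transpose = D.turn (-N) := by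
  have h := turn_add_mul_transpose hB (N := -N) (by omega) N
  simpa [turn_zero] using h

/-- The factor of a corner is the matrix of the turn at the corner. -/
lemma turn_mul_cornerAmp {θ : ℝ} {d d' : ℂ} (hθ : IsAngle θ d) (hd : d.im ≠ 0) (hd' : d'.im ≠ 0)
    (hlt : |(d' / d).arg| < Real.pi) :
    D.turn (halfTurns θ) * D.cornerAmp (-d) d' = D.turn (halfTurns (θ + (d' / d).arg)) := by
  have hd0 : d' ≠ 0 := by rintro rfl; simp at hd'
  have hπ := Real.pi_pos
  -- Both sides are reduced to principal arguments: `j` counts the full turns in `θ`, and `e` is the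
  -- correction if the turn at the corner crosses the branch cut.
  obtain ⟨j, hj⟩ := (isAngle_arg hθ.1).exists_int hθ
  obtain ⟨e, he⟩ := (isAngle_arg hd0).exists_int ((isAngle_arg hθ.1).add_arg_div hd0)
  have h1 : θ + (d' / d).arg = d'.arg + 2 * Real.pi * (j + e : ℤ) := by push_cast; linarith
  rw [h1, hj, halfTurns_add_two_pi_mul, halfTurns_add_two_pi_mul, turn_add_two_mul hB, turn_add_two_mul hB,
    nakayama_zpow_add hB, Matrix.mul_assoc, Matrix.mul_assoc]
  congr 1
  have ht : (d' / d).arg = d'.arg - d.arg + 2 * Real.pi * e := by linarith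
  rw [ht, abs_lt] at hlt
  have small : ∀ {x : ℤ}, (x : ℝ) < 1 → (-1 : ℝ) < x → x = 0 := by
    intro x h1 h2
    have h1 : x < 1 := by exact_mod_cast h1
    have h2 : -1 < x := by exact_mod_cast h2
    omega
  have hone : ∀ i j : S, (1 : Matrix S S k) i j = if i = j then 1 else 0 := fun i j =>
    Matrix.one_apply
  rcases lt_or_gt_of_ne hd with hd | hd <;> rcases lt_or_gt_of_ne hd' with hd' | hd'
  · obtain ⟨a1, a2⟩ := arg_mem_of_im_neg hd
    obtain ⟨b1, b2⟩ := arg_mem_of_im_neg hd'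
    have he0 : e = 0 := small (by nlinarith) (by nlinarith)
    have hc : D.cornerAmp (-d) d' = 1 := by
      ext i j
      simp [cornerAmp, hd, hd', hd.not_gt, hd'.not_gt, hone]
    rw [hc, he0, halfTurns_eq_zero a1 a2, halfTurns_eq_zero b1 b2, turn_zero]; simp
  · obtain ⟨a1, a2⟩ := arg_mem_of_im_neg hd
    obtain ⟨b1, b2⟩ := arg_mem_of_im_pos hd'
    have hna : (-d).arg = d.arg + Real.pi := Complex.arg_neg_eq_arg_add_pi_of_im_neg hd
    have hc : D.cornerAmp (-d) d' = if d'.arg < d.arg + Real.pi then D.B else D.B.transpose := by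
      ext i j
      rw [cornerAmp, if_neg (by simp [hd.not_gt]), if_pos (by simp [hd, hd']), hna]
      split_ifs <;> rfl
    rw [hc, halfTurns_eq_zero a1 a2, halfTurns_eq_one b1 b2, turn_zero, turn_one, Matrix.one_mul]
    -- At a minimum a counterclockwise turn gives `B` and `e = 0`; a clockwise turn gives the
    -- transpose, which is `turn (-1)`, and `e = -1`.
    split_ifs with h
    · have he0 : e = 0 := small (by nlinarith) (by nlinarith)
      simp [he0]
    · have he0 : e + 1 = 0 := small (by push_cast; nlinarith) (by push_cast; nlinarith)
      have he1 : e = -1 := by omega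
      have := turn_add_two_mul hB 1 (-1)
      rw [turn_one] at this
      rw [he1, ← this]
      norm_num
      exact (turn_neg_one hB).symm
  · obtain ⟨a1, a2⟩ := arg_mem_of_im_pos hd
    obtain ⟨b1, b2⟩ := arg_mem_of_im_neg hd'
    have hna : (-d).arg = d.arg - Real.pi := Complex.arg_neg_eq_arg_sub_pi_of_im_pos hd
    have hc : D.cornerAmp (-d) d' = if d.arg - Real.pi < d'.arg then D.B⁻¹ else D.B⁻¹.transpose := by
      ext i j
      rw [cornerAmp, if_pos (by simp [hd, hd']), hna]
      split_ifs <;> rfl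
    rw [hc, halfTurns_eq_one a1 a2, halfTurns_eq_zero b1 b2, turn_zero, turn_one, Matrix.mul_one]
    -- At a maximum a clockwise turn undoes the half turn, with `e = 0`; a counterclockwise one
    -- completes the full turn `nakayama`, with `e = 1`.
    split_ifs with h
    · have he0 : e = 0 := small (by nlinarith) (by nlinarith)
      rw [he0, Matrix.mul_nonsing_inv _ hB, zpow_zero]
    · have he0 : e - 1 = 0 := small (by push_cast; nlinarith) (by push_cast; nlinarith)
      have he1 : e = 1 := by omega
      rw [he1, zpow_one, nakayama]
  · obtain ⟨a1, a2⟩ := arg_mem_of_im_pos hd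
    obtain ⟨b1, b2⟩ := arg_mem_of_im_pos hd'
    have he0 : e = 0 := small (by nlinarith) (by nlinarith)
    have hc : D.cornerAmp (-d) d' = 1 := by
      ext i j
      simp [cornerAmp, hd, hd', hd.not_gt, hd'.not_gt, hone]
    rw [hc, he0, halfTurns_eq_one a1 a2, halfTurns_eq_one b1 b2]; simp

end Data

/-! ### Factors of legs, of lines and of rotated dual vertices -/

namespace DualGraph

variable {M : Set ℂ} {T : Triangulation M} (G : DualGraph T)

/-- The argument with which a leg arrives at its edge. -/
def legAngle (f : T.Flag) : ℝ := endAngle (G.firstDir f).arg (G.pt f) (G.len f)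

lemma dir_ne_zero (f : T.Flag) {i : ℕ} (hi : i < G.len f) : G.pt f (i + 1) - G.pt f i ≠ 0 :=
  sub_ne_zero.2 (polyline_injOn_ne (G.injOn f) (by omega) (by omega) (by omega))

lemma dir_im_ne_zero (f : T.Flag) {i : ℕ} (hi : i < G.len f) :
    (G.pt f (i + 1) - G.pt f i).im ≠ 0 := by
  rw [Complex.sub_im]
  exact sub_ne_zero.2 (G.not_horizontal f i hi).symm

lemma firstDir_ne_zero (f : T.Flag) : G.firstDir f ≠ 0 := G.dir_ne_zero f (G.len_pos f)

lemma neg_lastDir (f : T.Flag) :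
    -G.lastDir f = G.pt f (G.len f - 1 + 1) - G.pt f (G.len f - 1) := by
  rw [lastDir, neg_sub, Nat.sub_add_cancel (G.len_pos f)]

lemma lastDir_ne_zero (f : T.Flag) : G.lastDir f ≠ 0 := by
  rw [← neg_ne_zero, neg_lastDir]
  exact G.dir_ne_zero f (by have := G.len_pos f; omega)

lemma lastDir_im_ne_zero (f : T.Flag) : (G.lastDir f).im ≠ 0 := by
  have := G.dir_im_ne_zero f (i := G.len f - 1) (by have := G.len_pos f; omega)
  rw [← neg_lastDir, Complex.neg_im] at this
  exact neg_ne_zero.1 this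

lemma isAngle_partial (f : T.Flag) {m : ℕ} (hm : m < G.len f) :
    IsAngle ((G.firstDir f).arg + ∑ i ∈ Finset.range m,
      ((G.pt f (i + 2) - G.pt f (i + 1)) / (G.pt f (i + 1) - G.pt f i)).arg)
      (G.pt f (m + 1) - G.pt f m) := by
  induction m with
  | zero => simpa [DualGraph.firstDir] using isAngle_arg (G.firstDir_ne_zero f)
  | succ m ih =>
    rw [Finset.sum_range_succ, ← add_assoc]
    exact (ih (by omega)).add_arg_div (G.dir_ne_zero f hm)

lemma isAngle_legAngle (f : T.Flag) : IsAngle (G.legAngle f) (-G.lastDir f) := by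
  rw [neg_lastDir]
  exact G.isAngle_partial f (by have := G.len_pos f; omega)

end DualGraph

namespace Data

variable {k : Type*} [Field k] {S : Type*} [Fintype S] [DecidableEq S] {D : Data k S}
  {M : Set ℂ} {T : Triangulation M}

/-- The start of a leg contributes the half turns of its first direction, and each corner multiplies
the partial product by the turn made there. Hence only the total turning matters. -/
lemma legAmp_eq_turn (hB : IsUnit D.B.det) (G : DualGraph T) (f : T.Flag) :
    D.legAmp G f = D.turn (halfTurns (G.legAngle f)) := by
  have key : ∀ m, m < G.len f → D.startAmp (G.firstDir f) *
      ((List.range m).map fun i =>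
        D.cornerAmp (G.pt f i - G.pt f (i + 1)) (G.pt f (i + 2) - G.pt f (i + 1))).prod =
      D.turn (halfTurns ((G.firstDir f).arg + ∑ i ∈ Finset.range m,
        ((G.pt f (i + 2) - G.pt f (i + 1)) / (G.pt f (i + 1) - G.pt f i)).arg)) := by
    intro m hm
    induction m with
    | zero =>
      have := G.dir_im_ne_zero f (G.len_pos f)
      rw [zero_add] at this
      change (G.firstDir f).im ≠ 0 at this
      rcases lt_or_gt_of_ne this with h | h
      · obtain ⟨h1, h2⟩ := arg_mem_of_im_neg h
        simp [startAmp, h.not_gt, halfTurns_eq_zero h1 h2, turn_zero]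
      · obtain ⟨h1, h2⟩ := arg_mem_of_im_pos h
        simp [startAmp, h, halfTurns_eq_one h1 h2, turn_one]
    | succ m ih =>
      rw [List.range_succ, List.map_append, List.prod_append, ← Matrix.mul_assoc, ih (by omega),
        Finset.sum_range_succ, ← add_assoc, ← turn_mul_cornerAmp hB (G.isAngle_partial f (by omega))
          (G.dir_im_ne_zero f (by omega)) (G.dir_im_ne_zero f hm) (abs_turn_lt_pi (G.injOn f) (by omega))]
      simp
  exact key _ (by have := G.len_pos f; omega)

/-- The two legs at an interior edge form a line whose factor is the matrix of the total turn. -/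
lemma turn_mul_cornerAmp_mul_turn (hB : IsUnit D.B.det) {θ θ' : ℝ} {d d' : ℂ}
    (hθ : IsAngle θ (-d)) (hθ' : IsAngle θ' (-d')) (hd : d.im ≠ 0) (hd' : d'.im ≠ 0)
    {N : ℤ} (hN : N % 2 = 1) (hlt : |θ - (θ' + Real.pi * N)| < Real.pi) :
    D.turn (halfTurns θ) * D.cornerAmp d d' * (D.turn (halfTurns θ')).transpose = D.turn N := by
  -- The line arrives along the first leg and goes on against the arrival direction of the second,
  -- whence the odd multiple of π.
  have h1 : IsAngle (θ' + Real.pi * N) d' := by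
    have h := hθ'.neg_add
    rw [neg_neg] at h
    refine h.congr (Real.Angle.angle_eq_iff_two_pi_dvd_sub.2 ⟨-(N / 2), ?_⟩)
    obtain ⟨i, rfl⟩ : ∃ i, N = 1 + 2 * i := ⟨N / 2, by omega⟩
    rw [show (1 + 2 * i) / 2 = i by omega]
    push_cast; ring
  have h2 : θ' + Real.pi * N = θ + (d' / -d).arg :=
    h1.eq_add_arg hθ (by rw [abs_sub_comm]; exact hlt)
  have h3 := turn_mul_cornerAmp hB hθ (d' := d') (by simpa using hd) hd' (by
    rw [show (d' / -d).arg = θ' + Real.pi * N - θ by linarith, abs_sub_comm]; exact hlt)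
  rw [neg_neg] at h3
  rw [h3, ← h2, halfTurns_add_pi_mul, turn_add_mul_transpose hB hN]

/-- Moving the last leg of a dual vertex around to the first place gives it a full turn. -/
lemma sum_C_nakayama (hB : IsUnit D.B.det) (hD : D.IsDiagrammatic) (a b c' : S) :
    ∑ c, D.C a b c * D.nakayama c c' = D.C c' a b := by
  simp only [nakayama, Matrix.mul_apply, Matrix.transpose_apply, Finset.mul_sum]
  rw [Finset.sum_comm]
  simp only [← mul_assoc, ← Finset.sum_mul]
  -- The relation between `C` and `B` moves the raised index to the front, where the inverse of `B`
  -- lowers it again.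
  simp only [hD a b, Finset.sum_mul]
  rw [Finset.sum_comm]
  have : ∀ e, ∑ d, D.B d e * D.C e a b * D.B⁻¹ c' d = (if c' = e then 1 else 0) * D.C e a b := by
    intro e
    rw [← Matrix.one_apply (i := c') (j := e), ← Matrix.nonsing_inv_mul _ hB, Matrix.mul_apply,
      Finset.sum_mul]
    exact Finset.sum_congr rfl fun d _ => by ring
  simp [this]

end Data

/-! ### Orientation of triangles and outward normals -/

/-- The cross product of two vectors of the plane. -/
def cross (u v : ℂ) : ℝ := u.re * v.im - u.im * v.re

/-- The height of a point in the direction with argument `Φ`. -/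
def height (Φ : ℝ) (x : ℂ) : ℝ := x.re * Real.cos Φ + x.im * Real.sin Φ

lemma height_add (Φ : ℝ) (x y : ℂ) : height Φ (x + y) = height Φ x + height Φ y := by
  simp [height]; ring

lemma height_sub (Φ : ℝ) (x y : ℂ) : height Φ (x - y) = height Φ x - height Φ y := by
  simp [height]; ring

lemma height_smul (Φ r : ℝ) (x : ℂ) : height Φ (r • x) = r * height Φ x := by
  simp [height]; ring

lemma isLinearMap_height (Φ : ℝ) : IsLinearMap ℝ (height Φ) :=
  ⟨height_add Φ, fun r x => height_smul Φ r x⟩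

lemma isAngle_exp (Φ : ℝ) : IsAngle Φ (Complex.exp (Φ * Complex.I)) :=
  isAngle_iff_exp.2 ⟨1, one_pos, by simp⟩

lemma exp_mul_I_re (Φ : ℝ) : (Complex.exp (Φ * Complex.I)).re = Real.cos Φ :=
  Complex.exp_ofReal_mul_I_re Φ

lemma exp_mul_I_im (Φ : ℝ) : (Complex.exp (Φ * Complex.I)).im = Real.sin Φ :=
  Complex.exp_ofReal_mul_I_im Φ

lemma height_exp (Φ : ℝ) : height Φ (Complex.exp (Φ * Complex.I)) = 1 := by
  rw [height, exp_mul_I_re, exp_mul_I_im]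
  nlinarith [Real.sin_sq_add_cos_sq Φ]

lemma re_div_exp (Φ : ℝ) (z : ℂ) : (z / Complex.exp (Φ * Complex.I)).re = height Φ z := by
  rw [Complex.div_re, Complex.normSq_apply, exp_mul_I_re, exp_mul_I_im, height]
  have : Real.cos Φ * Real.cos Φ + Real.sin Φ * Real.sin Φ = 1 := by
    nlinarith [Real.sin_sq_add_cos_sq Φ]
  rw [this]; ring

lemma height_add_pi (Φ : ℝ) (z : ℂ) : height (Φ + Real.pi) z = -height Φ z := by
  simp [height]; ring

lemma height_add_two_pi_mul (Φ : ℝ) (n : ℤ) (z : ℂ) :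
    height (Φ + 2 * Real.pi * n) z = height Φ z := by
  rw [height, height, show Φ + 2 * Real.pi * n = Φ + n * (2 * Real.pi) by ring,
    Real.cos_add_int_mul_two_pi, Real.sin_add_int_mul_two_pi]

lemma IsAngle.exists_re_im {θ : ℝ} {z : ℂ} (h : IsAngle θ z) :
    ∃ r : ℝ, 0 < r ∧ z.re = r * Real.cos θ ∧ z.im = r * Real.sin θ := by
  obtain ⟨r, hr, rfl⟩ := isAngle_iff_exp.1 h
  exact ⟨r, hr, by simp, by simp⟩

lemma isAngle_of_re_im {θ : ℝ} {z : ℂ} {r : ℝ} (hr : 0 < r) (h1 : z.re = r * Real.cos θ)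
    (h2 : z.im = r * Real.sin θ) : IsAngle θ z :=
  isAngle_iff_exp.2 ⟨r, hr, Complex.ext (by simp [h1]) (by simp [h2])⟩

lemma IsAngle.sin_sub_pos {θ θ' : ℝ} {z z' : ℂ} (h : IsAngle θ z) (h' : IsAngle θ' z') :
    0 < Real.sin (θ' - θ) ↔ 0 < cross z z' := by
  obtain ⟨r, hr, h1, h2⟩ := h.exists_re_im
  obtain ⟨r', hr', h1', h2'⟩ := h'.exists_re_im
  have : cross z z' = (r * r') * Real.sin (θ' - θ) := by
    rw [cross, h1, h2, h1', h2', Real.sin_sub]; ring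
  rw [this, mul_pos_iff_of_pos_left (by positivity)]

lemma cross_rot (u v : ℂ) : cross (-Complex.I * u) (-Complex.I * v) = cross u v := by
  simp [cross]; ring

/-- Cramer's rule in the basis `u`, `v`. -/
lemma eq_of_cross_ne_zero {u v : ℂ} (h : cross u v ≠ 0) (z : ℂ) :
    z = ((cross z v / cross u v : ℝ) : ℂ) * u + ((cross u z / cross u v : ℝ) : ℂ) * v := by
  apply Complex.ext
  · rw [Complex.add_re, Complex.re_ofReal_mul, Complex.re_ofReal_mul, div_mul_eq_mul_div,
      div_mul_eq_mul_div, ← add_div, eq_div_iff h]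
    simp only [cross]; ring
  · rw [Complex.add_im, Complex.im_ofReal_mul, Complex.im_ofReal_mul, div_mul_eq_mul_div,
      div_mul_eq_mul_div, ← add_div, eq_div_iff h]
    simp only [cross]; ring

/-- `Φ` is an argument of the outward normal of the edge `e` of the triangle `t`. -/
def IsOutward (t e : Finset ℂ) (Φ : ℝ) : Prop :=
  ∃ c, (∀ x ∈ e, height Φ x = c) ∧ ∀ x ∈ t, x ∉ e → height Φ x < c

lemma isOutward_add_two_pi_mul {t e : Finset ℂ} {Φ : ℝ} (h : IsOutward t e Φ) (n : ℤ) :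
    IsOutward t e (Φ + 2 * Real.pi * n) := by
  simpa only [IsOutward, height_add_two_pi_mul] using h

/-- The outward normal of a counterclockwise triangle is the edge vector rotated clockwise by a
right angle. Constancy of the height on the edge makes `y - x` a multiple of (-sin Φ, cos Φ), and
the third vertex fixes the sign of the factor. -/
lemma isOutward_iff {x y w : ℂ} (h : 0 < cross (y - x) (w - x)) {Φ : ℝ} :
    IsOutward {x, y, w} {x, y} Φ ↔ IsAngle Φ (-Complex.I * (y - x)) := by
  have hwx : w ≠ x := by rintro rfl; simp [cross] at h
  have hwy : w ≠ y := by rintro rfl; simp [cross] at h; linarith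
  have hsc := Real.sin_sq_add_cos_sq Φ
  constructor
  · rintro ⟨c, h1, h2⟩
    have hx := h1 x (by simp)
    have hy := h1 y (by simp)
    have hw := h2 w (by simp) (by simp [hwx, hwy])
    have h3 : height Φ (y - x) = 0 := by rw [height_sub]; linarith
    have h4 : height Φ (w - x) < 0 := by rw [height_sub]; linarith
    simp only [height] at h3 h4
    set a := (y - x).re
    set b := (y - x).im
    have e1 : a = -(b * Real.cos Φ - a * Real.sin Φ) * Real.sin Φ := by
      linear_combination (Real.cos Φ) * h3 - a * hsc
    have e2 : b = (b * Real.cos Φ - a * Real.sin Φ) * Real.cos Φ := by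
      linear_combination (Real.sin Φ) * h3 - b * hsc
    have e3 : cross (y - x) (w - x) = (b * Real.cos Φ - a * Real.sin Φ) *
        -((w - x).re * Real.cos Φ + (w - x).im * Real.sin Φ) := by
      change a * (w - x).im - b * (w - x).re = _
      linear_combination (w - x).im * e1 - (w - x).re * e2
    rw [e3] at h
    have hr : 0 < b * Real.cos Φ - a * Real.sin Φ := by
      by_contra! hcon
      nlinarith
    refine isAngle_of_re_im hr ?_ ?_
    · rw [← e2]; simp [b]
    · have : (-Complex.I * (y - x)).im = -a := by simp [a]
      rw [this]; linarith
  · intro hΦ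
    obtain ⟨r, hr, h1, h2⟩ := hΦ.exists_re_im
    have ha : (y - x).re = -(r * Real.sin Φ) := by rw [← h2]; simp
    have hb : (y - x).im = r * Real.cos Φ := by rw [← h1]; simp
    refine ⟨height Φ x, ?_, ?_⟩
    · intro z hz
      simp only [Finset.mem_insert, Finset.mem_singleton] at hz
      rcases hz with rfl | rfl
      · rfl
      · have : height Φ (z - x) = 0 := by rw [height, ha, hb]; ring
        rw [height_sub] at this; linarith
    · intro z hz hz'
      simp only [Finset.mem_insert, Finset.mem_singleton] at hz hz'
      obtain rfl : z = w := by tauto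
      rw [cross, ha, hb] at h
      have : 0 < r * -height Φ (z - x) := by rw [height]; linarith
      have := (mul_pos_iff_of_pos_left hr).1 this
      rw [height_sub] at this; linarith

/-! ### Heights on a triangle and on its edges -/

section Hull

variable {t e : Finset ℂ} {Φ c : ℝ}

lemma height_le_of_mem_convexHull (h : ∀ x ∈ t, height Φ x ≤ c) {x : ℂ}
    (hx : x ∈ convexHull ℝ (t : Set ℂ)) : height Φ x ≤ c := by
  have hc : Convex ℝ {x | height Φ x ≤ c} := convex_halfSpace_le (isLinearMap_height Φ) c
  exact convexHull_min (fun y hy => h y hy) hc hx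

lemma height_eq_of_mem_convexHull (h : ∀ x ∈ e, height Φ x = c) {x : ℂ}
    (hx : x ∈ convexHull ℝ (e : Set ℂ)) : height Φ x = c := by
  have hc : Convex ℝ {x | height Φ x = c} := convex_hyperplane (isLinearMap_height Φ) c
  exact convexHull_min (fun y hy => h y hy) hc hx

/-- An interior point can be pushed a little in the direction `Φ` without leaving the hull. -/
lemma height_lt_of_mem_interior (h : ∀ x ∈ t, height Φ x ≤ c) {x : ℂ}
    (hx : x ∈ interior (convexHull ℝ (t : Set ℂ))) : height Φ x < c := by
  have hev : ∀ᶠ ε : ℝ in nhds 0, x + ε • Complex.exp (Φ * Complex.I) ∈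
      convexHull ℝ (t : Set ℂ) := by
    have hcont : ContinuousAt (fun ε : ℝ => x + ε • Complex.exp (Φ * Complex.I)) 0 := by fun_prop
    refine hcont.eventually_mem ?_
    simpa using mem_interior_iff_mem_nhds.1 hx
  obtain ⟨δ, hδ, hball⟩ := Metric.eventually_nhds_iff.1 hev
  have := height_le_of_mem_convexHull h (hball (y := δ / 2) (by
    rw [Real.dist_eq, sub_zero, abs_of_pos (by positivity)]; linarith))
  rw [height_add, height_smul, height_exp] at this
  linarith

/-- A second edge has a vertex off `e`, and a point between its ends has positive weight at both of
them. -/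
lemma height_lt_of_mem_edge {e' : Finset ℂ} (h1 : ∀ x ∈ e, height Φ x = c)
    (h2 : ∀ x ∈ t, x ∉ e → height Φ x < c) (he : e.card = 2) (he' : e'.card = 2) (ht : e' ⊆ t)
    (hne : e' ≠ e) {x : ℂ} (hx : x ∈ convexHull ℝ (e' : Set ℂ) \ (e' : Set ℂ)) :
    height Φ x < c := by
  have hle : ∀ y ∈ t, height Φ y ≤ c := fun y hy => by
    by_cases hye : y ∈ e
    · exact (h1 y hye).le
    · exact (h2 y hy hye).le
  obtain ⟨p, q, hpq, rfl⟩ := Finset.card_eq_two.1 he'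
  obtain ⟨hx1, hx2⟩ := hx
  rw [Finset.coe_pair, convexHull_pair] at hx1
  obtain ⟨α, β, hα, hβ, hαβ, rfl⟩ := hx1
  have hα' : 0 < α := lt_of_le_of_ne hα fun h => hx2 (by
    have : β = 1 := by linarith
    simp [← h, this])
  have hβ' : 0 < β := lt_of_le_of_ne hβ fun h => hx2 (by
    have : α = 1 := by linarith
    simp [← h, this])
  rw [height_add, height_smul, height_smul]
  have hp := hle p (ht (by simp))
  have hq := hle q (ht (by simp))
  have hsum : α * c + β * c = c := by rw [← add_mul, hαβ, one_mul]
  have hp' := mul_le_mul_of_nonneg_left hp hα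
  have hq' := mul_le_mul_of_nonneg_left hq hβ
  by_cases hpe : p ∈ e
  · by_cases hqe : q ∈ e
    · exact absurd (Finset.eq_of_subset_of_card_le (by
        intro z hz
        simp only [Finset.mem_insert, Finset.mem_singleton] at hz
        rcases hz with rfl | rfl <;> assumption) (by omega)) hne
    · have := mul_lt_mul_of_pos_left (h2 q (ht (by simp)) hqe) hβ'
      linarith
  · have := mul_lt_mul_of_pos_left (h2 p (ht (by simp)) hpe) hα'
    linarith

end Hull

/-! ### Flags -/

lemma cross_ne_zero_of_affineIndependent {x y w : ℂ} (hxy : x ≠ y) (hxw : x ≠ w) (hyw : y ≠ w)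
    (h : AffineIndependent ℝ ((↑) : ({x, y, w} : Finset ℂ) → ℂ)) :
    cross (y - x) (w - x) ≠ 0 := by
  intro hc
  have h3 : AffineIndependent ℝ ![x, y, w] := by
    let φ : Fin 3 ↪ ({x, y, w} : Finset ℂ) :=
      ⟨![⟨x, by simp⟩, ⟨y, by simp⟩, ⟨w, by simp⟩], by
        intro i j hij
        fin_cases i <;> fin_cases j <;> simp_all [Ne.symm]⟩
    convert h.comp_embedding φ using 1
    funext i
    fin_cases i <;> rfl
  rw [affineIndependent_iff_not_collinear_set] at h3
  apply h3
  rw [collinear_iff_of_mem (p₀ := x) (by simp)]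
  have hn : (y - x).re ^ 2 + (y - x).im ^ 2 ≠ 0 := by
    intro h0
    apply hxy
    have h1 : (y - x).re = 0 := by nlinarith [sq_nonneg (y - x).re, sq_nonneg (y - x).im]
    have h2 : (y - x).im = 0 := by nlinarith [sq_nonneg (y - x).re, sq_nonneg (y - x).im]
    exact (sub_eq_zero.1 (Complex.ext h1 h2)).symm
  refine ⟨y - x, ?_⟩
  intro p hp
  simp only [Set.mem_insert_iff, Set.mem_singleton_iff] at hp
  rcases hp with rfl | rfl | rfl
  · exact ⟨0, by simp⟩
  · exact ⟨1, by simp⟩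
  -- The coefficient of the orthogonal projection onto `y - x`; the vanishing cross product says
  -- that nothing else is left.
  · refine ⟨((p - x).re * (y - x).re + (p - x).im * (y - x).im) /
      ((y - x).re ^ 2 + (y - x).im ^ 2), ?_⟩
    rw [vadd_eq_add, ← sub_eq_iff_eq_add]
    rw [cross] at hc
    apply Complex.ext
    · rw [Complex.smul_re, smul_eq_mul]
      field_simp
      linear_combination -(y - x).im * hc
    · rw [Complex.smul_im, smul_eq_mul]
      field_simp
      linear_combination (y - x).re * hc

lemma affineIndependent_of_cross_ne_zero {x y w : ℂ} (h : cross (y - x) (w - x) ≠ 0) :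
    AffineIndependent ℝ ((↑) : ({x, y, w} : Finset ℂ) → ℂ) := by
  have h3 : AffineIndependent ℝ ![x, y, w] := by
    rw [affineIndependent_iff_not_collinear_set, collinear_iff_of_mem (p₀ := x) (by simp)]
    rintro ⟨v, hv⟩
    obtain ⟨r, hr⟩ := hv y (by simp)
    obtain ⟨s, hs⟩ := hv w (by simp)
    rw [vadd_eq_add, ← sub_eq_iff_eq_add] at hr hs
    apply h
    rw [hr, hs]
    simp [cross]; ring
  have h4 := h3.range
  have : Set.range ![x, y, w] = (({x, y, w} : Finset ℂ) : Set ℂ) := by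
    ext z; simp [eq_comm]; tauto
  rw [this] at h4
  exact h4

namespace Triangulation

variable {M : Set ℂ} {T : Triangulation M}

lemma Flag.ext {f g : T.Flag} (h1 : f.tri = g.tri) (h2 : f.edge = g.edge) : f = g := by
  obtain ⟨t, e, _, _, _⟩ := f
  obtain ⟨t', e', _, _, _⟩ := g
  obtain rfl : t = t' := h1
  obtain rfl : e = e' := h2
  rfl

lemma cross_ne_zero {x y w : ℂ} (h : ({x, y, w} : Finset ℂ) ∈ T.triangles) :
    cross (y - x) (w - x) ≠ 0 := by
  have hcard := h.2
  have hxy : x ≠ y := by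
    rintro rfl
    have := Finset.card_le_two (a := x) (b := w)
    rw [show ({x, x, w} : Finset ℂ) = {x, w} by ext; simp] at hcard
    omega
  have hxw : x ≠ w := by
    rintro rfl
    have := Finset.card_le_two (a := x) (b := y)
    rw [show ({x, y, x} : Finset ℂ) = {x, y} by ext; simp; tauto] at hcard
    omega
  have hyw : y ≠ w := by
    rintro rfl
    have := Finset.card_le_two (a := x) (b := y)
    rw [show ({x, y, y} : Finset ℂ) = {x, y} by ext; simp] at hcard
    omega
  exact cross_ne_zero_of_affineIndependent hxy hxw hyw (T.indep h.1)

lemma Flag.exists_vertices (f : T.Flag) :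
    ∃ x y w, f.tri = {x, y, w} ∧ f.edge = {x, y} ∧ 0 < cross (y - x) (w - x) := by
  obtain ⟨x, y, hxy, he⟩ := Finset.card_eq_two.1 f.edge_card
  have hcard : (f.tri \ f.edge).card = 1 := by
    rw [Finset.card_sdiff_of_subset f.edge_subset, f.tri_mem.2, f.edge_card]
  obtain ⟨w, hw⟩ := Finset.card_eq_one.1 hcard
  have ht : f.tri = {x, y, w} := by
    rw [← Finset.union_sdiff_of_subset f.edge_subset, hw, he]
    ext; simp
  have hc := cross_ne_zero (T := T) (ht ▸ f.tri_mem)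
  rcases lt_or_gt_of_ne hc with h | h
  · refine ⟨y, x, w, by rw [ht]; ext; simp; tauto, by rw [he, Finset.pair_comm], ?_⟩
    simp only [cross, Complex.sub_re, Complex.sub_im] at h ⊢
    linarith
  · exact ⟨x, y, w, ht, he, h⟩

lemma Flag.exists_isOutward (f : T.Flag) :
    ∃ Φ, -Real.pi < Φ ∧ Φ ≤ Real.pi ∧ IsOutward f.tri f.edge Φ := by
  obtain ⟨x, y, w, ht, he, hc⟩ := f.exists_vertices
  have hyx : y - x ≠ 0 := by intro h; simp [h, cross] at hc
  refine ⟨(-Complex.I * (y - x)).arg, Complex.neg_pi_lt_arg _, Complex.arg_le_pi _, ?_⟩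
  rw [ht, he, isOutward_iff hc]
  exact isAngle_arg (mul_ne_zero (by simp) hyx)

lemma Flag.exists_int_of_isOutward (f : T.Flag) {Φ Φ' : ℝ} (h : IsOutward f.tri f.edge Φ)
    (h' : IsOutward f.tri f.edge Φ') : ∃ n : ℤ, Φ' = Φ + 2 * Real.pi * n := by
  obtain ⟨x, y, w, ht, he, hc⟩ := f.exists_vertices
  rw [ht, he, isOutward_iff hc] at h h'
  exact h.exists_int h'

lemma Flag.eq_of_isOutward {f g : T.Flag} (hfg : f.tri = g.tri) {Φ : ℝ}
    (hf : IsOutward f.tri f.edge Φ) (hg : IsOutward g.tri g.edge Φ) : f = g := by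
  by_contra hne
  have hne' : f.edge ≠ g.edge := fun h => hne (Flag.ext hfg h)
  have hsub : ∀ {f g : T.Flag}, f.edge ≠ g.edge → ∃ x ∈ f.edge, x ∉ g.edge := by
    intro f g h
    by_contra! hcon
    exact h (Finset.eq_of_subset_of_card_le hcon (by rw [f.edge_card, g.edge_card]))
  obtain ⟨c, h1, h2⟩ := hf
  obtain ⟨c', h1', h2'⟩ := hg
  obtain ⟨x, hx, hx'⟩ := hsub hne'
  obtain ⟨y, hy, hy'⟩ := hsub hne'.symm
  have a1 := h1 x hx
  have a2 := h2' x (hfg ▸ f.edge_subset hx) hx'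
  have a3 := h1' y hy
  have a4 := h2 y (hfg ▸ g.edge_subset hy) hy'
  linarith

/-- Triangles on the same side of a common edge coincide. -/
lemma eq_of_same_side {x y w w' : ℂ} (h : ({x, y, w} : Finset ℂ) ∈ T.triangles)
    (h' : ({x, y, w'} : Finset ℂ) ∈ T.triangles) (hc : 0 < cross (y - x) (w - x))
    (hc' : 0 < cross (y - x) (w' - x)) : w = w' := by
  by_contra hne
  have hwx : w ≠ x := by rintro rfl; simp [cross] at hc
  have hwy : w ≠ y := by rintro rfl; simp [cross] at hc; linarith
  have hint := T.inter_subset_convexHull h.1 h'.1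
  have hcap : (({x, y, w} : Finset ℂ) : Set ℂ) ∩ ({x, y, w'} : Finset ℂ) ⊆ {x, y} := by
    intro z
    simp only [Finset.coe_insert, Finset.coe_singleton, Set.mem_inter_iff, Set.mem_insert_iff,
      Set.mem_singleton_iff]
    rintro ⟨rfl | rfl | rfl, h2⟩
    · simp
    · simp
    · rcases h2 with h2 | h2 | h2 <;> simp_all
  -- The barycentric coordinates `p`, `q`, `r` of `w` in the triangle `x y w'`; here `r > 0` because
  -- `w` and `w'` are on the same side.
  set r := cross (y - x) (w - x) / cross (y - x) (w' - x) with hr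
  have hr0 : 0 < r := div_pos hc hc'
  set q := cross (w - x) (w' - x) / cross (y - x) (w' - x) with hq
  have hrq : w - x = (q : ℂ) * (y - x) + r * (w' - x) :=
    eq_of_cross_ne_zero hc'.ne' _
  set p := 1 - q - r with hp
  -- The midpoint of the edge, moved by the fraction `ε` towards `w`, lies in the first triangle.
  -- This `ε` is small enough to keep its coordinates in the second one non-negative. So it is
  -- common to both triangles but off their common edge, which no simplicial complex allows.
  set ε := 1 / (1 + 2 * |p| + 2 * |q| + |r|) with hε
  have hden : 0 < 1 + 2 * |p| + 2 * |q| + |r| := by positivity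
  have hε0 : 0 < ε := by positivity
  have hε1 : ε * (1 + 2 * |p| + 2 * |q| + |r|) = 1 := by rw [hε]; field_simp
  have hεp : ε * |p| ≥ 0 := by positivity
  have hεq : ε * |q| ≥ 0 := by positivity
  have hεr : ε * |r| ≥ 0 := by positivity
  have mem3 : ∀ {a b c : ℂ} {α β γ : ℝ}, 0 ≤ α → 0 ≤ β → 0 ≤ γ → α + β + γ = 1 →
      α • a + β • b + γ • c ∈ convexHull ℝ (({a, b, c} : Finset ℂ) : Set ℂ) := by
    intro a b c α β γ hα hβ hγ hs
    have hconv := convex_convexHull ℝ (({a, b, c} : Finset ℂ) : Set ℂ)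
    have hsub := subset_convexHull ℝ (({a, b, c} : Finset ℂ) : Set ℂ)
    have := hconv.sum_mem (t := Finset.univ) (w := ![α, β, γ]) (z := ![a, b, c])
      (by intro i _; fin_cases i <;> assumption) (by simp [Fin.sum_univ_three, hs])
      (by intro i _; fin_cases i <;> exact hsub (by simp))
    simpa [Fin.sum_univ_three] using this
  have m1 := mem3 (a := x) (b := y) (c := w) (α := (1 - ε) / 2) (β := (1 - ε) / 2) (γ := ε)
    (by nlinarith) (by nlinarith) hε0.le (by ring)
  have m2 := mem3 (a := x) (b := y) (c := w') (α := (1 - ε) / 2 + ε * p)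
    (β := (1 - ε) / 2 + ε * q) (γ := ε * r)
    (by nlinarith [neg_abs_le p]) (by nlinarith [neg_abs_le q]) (by positivity) (by rw [hp]; ring)
  have heq : ((1 - ε) / 2 + ε * p) • x + ((1 - ε) / 2 + ε * q) • y + (ε * r) • w' =
      ((1 - ε) / 2) • x + ((1 - ε) / 2) • y + ε • w := by
    simp only [Complex.real_smul, hp]
    push_cast
    linear_combination -(ε : ℂ) * hrq
  rw [heq] at m2
  have hm := convexHull_mono hcap (hint ⟨m1, m2⟩)
  have hyx : y - x ≠ 0 := by intro h; simp [h, cross] at hc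
  obtain ⟨c, h1, h2⟩ := (isOutward_iff hc).2
    (isAngle_arg (mul_ne_zero (by simp : -Complex.I ≠ 0) hyx))
  have e1 := height_eq_of_mem_convexHull h1 (by rw [Finset.coe_pair]; exact hm)
  have e2 := h2 w (by simp) (by simp [hwx, hwy])
  have e3 := h1 x (by simp)
  have e4 := h1 y (by simp)
  rw [height_add, height_add, height_smul, height_smul, height_smul, e3, e4] at e1
  nlinarith

/-- If both triangles ran through the edge in the same counterclockwise direction, they would lie on
the same side of it and coincide. So the directions, and with them the outward normals, are
opposite. -/
lemma Flag.exists_odd {f g : T.Flag} (hfg : f ≠ g) (he : f.edge = g.edge) {Φ Φ' : ℝ}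
    (hf : IsOutward f.tri f.edge Φ) (hg : IsOutward g.tri g.edge Φ') :
    ∃ N : ℤ, N % 2 = 1 ∧ Φ = Φ' + Real.pi * N := by
  obtain ⟨x, y, w, ht, he1, hc⟩ := f.exists_vertices
  obtain ⟨x', y', w', ht', he1', hc'⟩ := g.exists_vertices
  rw [ht, he1, isOutward_iff hc] at hf
  rw [ht', he1', isOutward_iff hc'] at hg
  have hee : ({x, y} : Finset ℂ) = {x', y'} := by rw [← he1, ← he1', he]
  have hcases : (x' = x ∧ y' = y) ∨ (x' = y ∧ y' = x) := by
    have hx : x' ∈ ({x, y} : Finset ℂ) := by rw [hee]; simp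
    have hy : y' ∈ ({x, y} : Finset ℂ) := by rw [hee]; simp
    have hxy' : x' ≠ y' := by rintro rfl; simp [cross] at hc'
    simp only [Finset.mem_insert, Finset.mem_singleton] at hx hy
    rcases hx with rfl | rfl <;> rcases hy with rfl | rfl <;> simp_all
  rcases hcases with ⟨rfl, rfl⟩ | ⟨rfl, rfl⟩
  · refine absurd (Flag.ext ?_ he) hfg
    rw [ht, ht', eq_of_same_side (ht ▸ f.tri_mem) (ht' ▸ g.tri_mem) hc hc']
  · have h1 := hg.neg_add
    rw [← mul_neg, neg_sub] at h1
    obtain ⟨n, hn⟩ := h1.exists_int hf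
    exact ⟨1 + 2 * n, by omega, by rw [hn]; push_cast; ring⟩

/-- At most two triangles meet at an edge. -/
lemma Flag.eq_or_eq {f g h : T.Flag} (hfg : f ≠ g) (he : f.edge = g.edge) (hh : f.edge = h.edge) :
    h = f ∨ h = g := by
  by_contra! hcon
  obtain ⟨Φ, -, -, hf⟩ := f.exists_isOutward
  obtain ⟨Φ', -, -, hg⟩ := g.exists_isOutward
  obtain ⟨Φ'', -, -, hh'⟩ := h.exists_isOutward
  obtain ⟨N, hN, e1⟩ := Flag.exists_odd hfg he hf hg
  obtain ⟨N', hN', e2⟩ := Flag.exists_odd hcon.1.symm hh hf hh'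
  obtain ⟨N'', hN'', e3⟩ := Flag.exists_odd hcon.2.symm (he.symm.trans hh) hg hh'
  -- Three pairwise opposite normals are impossible: of the three odd numbers one would be the sum
  -- of the others.
  have : Real.pi * ((N + N'' - N' : ℤ) : ℝ) = 0 := by push_cast; linarith
  rcases mul_eq_zero.1 this with h | h
  · exact Real.pi_ne_zero h
  · have : N + N'' - N' = 0 := by exact_mod_cast h
    omega

lemma eq_pair_of_subset {x y w : ℂ} {e : Finset ℂ} (he : e ⊆ {x, y, w}) (hc : e.card = 2) :
    e = {x, y} ∨ e = {y, w} ∨ e = {w, x} := by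
  obtain ⟨p, q, hpq, rfl⟩ := Finset.card_eq_two.1 hc
  have hp : p ∈ ({x, y, w} : Finset ℂ) := he (by simp)
  have hq : q ∈ ({x, y, w} : Finset ℂ) := he (by simp)
  simp only [Finset.mem_insert, Finset.mem_singleton] at hp hq
  rcases hp with rfl | rfl | rfl <;> rcases hq with rfl | rfl | rfl <;>
    simp_all [Finset.pair_comm]

/-- The three flags of a triangle. -/
lemma exists_flags {t : Finset ℂ} (h : t ∈ T.triangles) :
    ∃ f₁ f₂ f₃ : T.Flag, f₁ ≠ f₂ ∧ f₁ ≠ f₃ ∧ f₂ ≠ f₃ ∧ f₁.tri = t ∧ f₂.tri = t ∧ f₃.tri = t ∧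
      ∀ f : T.Flag, f.tri = t → f = f₁ ∨ f = f₂ ∨ f = f₃ := by
  obtain ⟨x, y, w, hxy, hxw, hyw, rfl⟩ := Finset.card_eq_three.1 h.2
  refine ⟨⟨_, {x, y}, h, by intro z; simp; tauto, Finset.card_pair hxy⟩,
    ⟨_, {y, w}, h, by intro z; simp; tauto, Finset.card_pair hyw⟩,
    ⟨_, {w, x}, h, by intro z; simp; tauto, Finset.card_pair hxw.symm⟩, ?_, ?_, ?_, rfl, rfl, rfl, ?_⟩
  · intro he
    have : ({x, y} : Finset ℂ) = {y, w} := congrArg Flag.edge he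
    have hx : x ∈ ({y, w} : Finset ℂ) := by rw [← this]; simp
    simp_all
  · intro he
    have this : ({x, y} : Finset ℂ) = {w, x} := congrArg Flag.edge he
    have hx : y ∈ ({w, x} : Finset ℂ) := by rw [← this]; simp
    simp_all [Ne.symm]
  · intro he
    have this : ({y, w} : Finset ℂ) = {w, x} := congrArg Flag.edge he
    have hx : y ∈ ({w, x} : Finset ℂ) := by rw [← this]; simp
    simp_all [Ne.symm]
  · intro f hf
    rcases eq_pair_of_subset (hf ▸ f.edge_subset) f.edge_card with he | he | he
    · exact Or.inl (Flag.ext hf he)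
    · exact Or.inr (Or.inl (Flag.ext hf he))
    · exact Or.inr (Or.inr (Flag.ext hf he))

/-- Three flags of a triangle in the order given by a function that separates them. -/
lemma exists_sorted_flags {t : Finset ℂ} (h : t ∈ T.triangles) (χ : T.Flag → ℝ)
    (hχ : ∀ f g : T.Flag, f.tri = g.tri → χ f = χ g → f = g) :
    ∃ f₁ f₂ f₃ : T.Flag, χ f₁ < χ f₂ ∧ χ f₂ < χ f₃ ∧ f₁.tri = t ∧ f₂.tri = t ∧ f₃.tri = t ∧
      ∀ f : T.Flag, f.tri = t → f = f₁ ∨ f = f₂ ∨ f = f₃ := by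
  obtain ⟨a, b, c, hab, hac, hbc, ha, hb, hc, hcov⟩ := exists_flags h
  have h1 : χ a ≠ χ b := fun e => hab (hχ _ _ (ha.trans hb.symm) e)
  have h2 : χ a ≠ χ c := fun e => hac (hχ _ _ (ha.trans hc.symm) e)
  have h3 : χ b ≠ χ c := fun e => hbc (hχ _ _ (hb.trans hc.symm) e)
  rcases lt_or_gt_of_ne h1 with h1 | h1 <;> rcases lt_or_gt_of_ne h2 with h2 | h2 <;>
    rcases lt_or_gt_of_ne h3 with h3 | h3
  · exact ⟨a, b, c, h1, h3, ha, hb, hc, hcov⟩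
  · exact ⟨a, c, b, h2, h3, ha, hc, hb, fun f hf => by have := hcov f hf; tauto⟩
  · linarith
  · exact ⟨c, a, b, h2, h1, hc, ha, hb, fun f hf => by have := hcov f hf; tauto⟩
  · exact ⟨b, a, c, h1, h2, hb, ha, hc, fun f hf => by have := hcov f hf; tauto⟩
  · linarith
  · exact ⟨b, c, a, h3, h2, hb, hc, ha, fun f hf => by have := hcov f hf; tauto⟩
  · exact ⟨c, b, a, h3, h1, hc, hb, ha, fun f hf => by have := hcov f hf; tauto⟩

/-- A choice of arguments of the outward normals that is compatible with the cyclic order of the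
edges of each triangle. -/
structure IsFraming (Φ : T.Flag → ℝ) : Prop where
  isOutward : ∀ f, IsOutward f.tri f.edge (Φ f)
  abs_sub_lt : ∀ f g : T.Flag, f.tri = g.tri → |Φ f - Φ g| < 2 * Real.pi

lemma IsFraming.injective {Φ : T.Flag → ℝ} (hΦ : IsFraming Φ) (f g : T.Flag) (h : f.tri = g.tri)
    (hfg : Φ f = Φ g) : f = g :=
  Flag.eq_of_isOutward h (hΦ.isOutward f) (hfg ▸ hΦ.isOutward g)

end Triangulation

/-! ### The legs of a dual graph and the normals of the edges -/

namespace DualGraph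

variable {M : Set ℂ} {T : Triangulation M} (G : DualGraph T)

/-- Among all points of the legs in a triangle, the end of a leg is strictly the highest in the
direction of the normal of its own edge. This is the half plane condition in the statements on
secants. -/
lemma height_end_sub_pos {f g : T.Flag} (hfg : f.tri = g.tri) {Φ : ℝ}
    (hΦ : IsOutward f.tri f.edge Φ) {s : ℝ} (hs : s ∈ Set.Icc (0 : ℝ) (G.len g))
    (hne : f ≠ g ∨ s < G.len g) :
    0 < height Φ (G.pt f (G.len f) - polyline (G.pt g) s) := by
  obtain ⟨c, h1, h2⟩ := hΦ
  have hle : ∀ y ∈ f.tri, height Φ y ≤ c := fun y hy => by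
    by_cases hye : y ∈ f.edge
    · exact (h1 y hye).le
    · exact (h2 y hy hye).le
  rw [height_sub, height_eq_of_mem_convexHull h1 (G.end_mem f).1, sub_pos]
  rcases hs.2.lt_or_eq with hlt | rfl
  · refine height_lt_of_mem_interior hle ?_
    rw [hfg]
    exact G.mem_interior g s ⟨hs.1, hlt⟩
  · have hne' : f ≠ g := by
      rcases hne with h | h
      · exact h
      · exact absurd h (lt_irrefl _)
    rw [polyline_natCast]
    exact height_lt_of_mem_edge h1 h2 f.edge_card g.edge_card (hfg ▸ g.edge_subset)
      (fun h => hne' (Triangulation.Flag.ext hfg h.symm)) (G.end_mem g)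

lemma height_neg_lastDir_pos {f : T.Flag} {Φ : ℝ} (hΦ : IsOutward f.tri f.edge Φ) :
    0 < height Φ (-G.lastDir f) := by
  have hl := G.len_pos f
  have hl' : ((G.len f - 1 : ℕ) : ℝ) < G.len f := by exact_mod_cast (by omega : G.len f - 1 < G.len f)
  have := G.height_end_sub_pos rfl hΦ (s := (G.len f - 1 : ℕ))
    ⟨by positivity, hl'.le⟩ (Or.inr hl')
  rw [polyline_natCast] at this
  rwa [lastDir, neg_sub]

lemma exists_secant_angle_leg (f : T.Flag) : ∃ l : ℝ → ℝ,
    ContinuousOn l (Set.Ioc 0 (G.len f)) ∧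
    (∀ s ∈ Set.Ioc (0 : ℝ) (G.len f), IsAngle (l s) (polyline (G.pt f) s - G.pt f 0)) ∧
    l 1 = (G.firstDir f).arg := by
  have h1 : (1 : ℝ) ≤ G.len f := by exact_mod_cast G.len_pos f
  refine exists_continuous_angle (convex_Ioc (0 : ℝ) (G.len f))
    (F := fun s => polyline (G.pt f) s - G.pt f 0)
    (((continuousOn_polyline _ _).mono Set.Ioc_subset_Icc_self).sub continuousOn_const) ?_
    (x₀ := 1) ⟨one_pos, h1⟩ ?_
  · intro s hs h
    rw [sub_eq_zero, ← polyline_zero (G.pt f)] at h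
    have := G.injOn f ⟨hs.1.le, hs.2⟩ ⟨le_rfl, by positivity⟩ h
    linarith [hs.1]
  · have := polyline_natCast (G.pt f) 1
    rw [Nat.cast_one] at this
    simp only [this]
    exact isAngle_arg (G.firstDir_ne_zero f)

lemma arg_firstDir_injective {f g : T.Flag} (hfg : f.tri = g.tri)
    (h : (G.firstDir f).arg = (G.firstDir g).arg) : f = g := by
  by_contra hne
  obtain ⟨r, hr, hr1, hr2⟩ := (isAngle_arg (G.firstDir_ne_zero f)).exists_re_im
  obtain ⟨r', hr', hr1', hr2'⟩ := (isAngle_arg (G.firstDir_ne_zero g)).exists_re_im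
  have e : (r' : ℂ) * G.firstDir f = r * G.firstDir g := by
    apply Complex.ext
    · rw [Complex.re_ofReal_mul, Complex.re_ofReal_mul, hr1, hr1', h]; ring
    · rw [Complex.im_ofReal_mul, Complex.im_ofReal_mul, hr2, hr2', h]; ring
  have h1 : (1 : ℝ) ≤ G.len f := by exact_mod_cast G.len_pos f
  have h2 : (1 : ℝ) ≤ G.len g := by exact_mod_cast G.len_pos g
  have b1 : r' / (r + r') ≤ 1 := by rw [div_le_one (by positivity)]; linarith
  have b2 : r / (r + r') ≤ 1 := by rw [div_le_one (by positivity)]; linarith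
  have p1 : 0 < r' / (r + r') := by positivity
  have p2 : 0 < r / (r + r') := by positivity
  -- The parameters are inversely proportional to the lengths `r`, `r'` of the first segments, so
  -- both points are equally far from the dual vertex, and they are at most 1.
  have := G.disjoint f g hfg hne (r' / (r + r')) ⟨p1.le, b1.trans h1⟩
    (r / (r + r')) ⟨p2.le, b2.trans h2⟩ (by
      rw [polyline_of_mem_unit _ p1.le b1, polyline_of_mem_unit _ p2.le b2, G.start_eq f g hfg]
      congr 1
      push_cast
      rw [div_mul_eq_mul_div, div_mul_eq_mul_div, ← G.start_eq f g hfg]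
      congr 1
      rw [G.start_eq f g hfg, ← firstDir, ← e, firstDir, G.start_eq f g hfg])
  linarith [this.1]

/-- `Φ` and `Φ'` are those arguments of the normals that the total turning of the legs singles out.
As the legs do not cross, these arguments keep the order of the initial arguments and stay within
one turn, however much the legs wind. -/
lemma abs_normal_sub_lt {f g : T.Flag} (hfg : f.tri = g.tri)
    (hlt : (G.firstDir f).arg < (G.firstDir g).arg) {Φ Φ' : ℝ}
    (hf : IsOutward f.tri f.edge Φ) (hg : IsOutward g.tri g.edge Φ')
    (hΦ : |G.legAngle f - Φ| < Real.pi / 2) (hΦ' : |G.legAngle g - Φ'| < Real.pi / 2) :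
    Φ < Φ' ∧ Φ' < Φ + 2 * Real.pi := by
  have hπ := Real.pi_pos
  have hne : f ≠ g := by rintro rfl; exact lt_irrefl _ hlt
  -- The hypotheses concern the tangent on arrival; the comparison of two legs needs the argument of
  -- the last secant instead.
  have key : ∀ (f : T.Flag) {Φ : ℝ}, IsOutward f.tri f.edge Φ → |G.legAngle f - Φ| < Real.pi / 2 →
      ∀ l : ℝ → ℝ, ContinuousOn l (Set.Ioc 0 (G.len f)) →
      (∀ s ∈ Set.Ioc (0 : ℝ) (G.len f), IsAngle (l s) (polyline (G.pt f) s - G.pt f 0)) →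
      l 1 = (G.firstDir f).arg →
      l (G.len f) = Φ + ((G.pt f (G.len f) - G.pt f 0) / Complex.exp (Φ * Complex.I)).arg := by
    intro f Φ hf hΦ l hl hl' hl1
    have ha := (G.isAngle_legAngle f).eq_add_arg (isAngle_exp Φ) (by linarith)
    have hp : ∀ s ∈ Set.Ico (0 : ℝ) (G.len f),
        0 < ((G.pt f (G.len f) - polyline (G.pt f) s) / Complex.exp (Φ * Complex.I)).re := by
      intro s hs
      rw [re_div_exp]
      exact G.height_end_sub_pos rfl hf ⟨hs.1, hs.2.le⟩ (Or.inr hs.2)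
    have hinj := G.injOn f
    have hld := G.neg_lastDir f
    rw [legAngle, ← hl1] at ha
    obtain ⟨n, hn⟩ : ∃ n, G.len f = n + 1 := ⟨G.len f - 1, by have := G.len_pos f; omega⟩
    rw [hn] at hl hl' hp hinj ha hld ⊢
    rw [hld] at ha
    exact secant_angle_eq_of_endAngle_eq (isAngle_exp Φ) n (G.pt f) hinj hp hl hl' ha
  obtain ⟨lf, hlf, hlf', hlf1⟩ := G.exists_secant_angle_leg f
  obtain ⟨lg, hlg, hlg', hlg1⟩ := G.exists_secant_angle_leg g
  have h1 : (1 : ℝ) ≤ G.len f := by exact_mod_cast G.len_pos f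
  have h2 : (1 : ℝ) ≤ G.len g := by exact_mod_cast G.len_pos g
  have := abs_normal_angle_sub_lt h1 h2
    (by rw [polyline_zero, polyline_zero, G.start_eq f g hfg])
    (continuousOn_polyline _ _) (continuousOn_polyline _ _) (G.disjoint f g hfg hne)
    (fun s hs hs' => by rw [polyline_zero]; exact polyline_of_mem_unit _ hs hs')
    (fun s hs hs' => by rw [polyline_zero]; exact polyline_of_mem_unit _ hs hs')
    hlf hlg (by simpa only [polyline_zero] using hlf') (by simpa only [polyline_zero] using hlg')
    (by
      rw [hlf1, hlg1, abs_lt]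
      have := Complex.neg_pi_lt_arg (G.firstDir f)
      have := Complex.arg_le_pi (G.firstDir g)
      constructor <;> linarith)
    (isAngle_exp Φ) (isAngle_exp Φ')
    (fun t ht => by
      rw [re_div_exp, polyline_natCast]
      exact G.height_end_sub_pos hfg hf ht (Or.inl hne))
    (fun t ht => by
      rw [re_div_exp, polyline_natCast]
      exact G.height_end_sub_pos hfg.symm hg ht (Or.inl hne.symm))
    (by rw [polyline_natCast, polyline_zero]; exact key f hf hΦ lf hlf hlf' hlf1)
    (by rw [polyline_natCast, polyline_zero]; exact key g hg hΦ' lg hlg hlg' hlg1)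
  rw [abs_lt] at this
  constructor <;> linarith

/-- The argument near `Φ` of the direction in which a leg arrives at its edge. -/
def arrivalAngle (Φ : ℝ) (f : T.Flag) : ℝ :=
  Φ + (-G.lastDir f / Complex.exp (Φ * Complex.I)).arg

lemma isAngle_arrivalAngle (Φ : ℝ) (f : T.Flag) : IsAngle (G.arrivalAngle Φ f) (-G.lastDir f) :=
  (isAngle_exp Φ).add_arg_div (neg_ne_zero.2 (G.lastDir_ne_zero f))

lemma abs_arrivalAngle_sub_lt {f : T.Flag} {Φ : ℝ} (hΦ : IsOutward f.tri f.edge Φ) :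
    |G.arrivalAngle Φ f - Φ| < Real.pi / 2 := by
  rw [arrivalAngle, add_sub_cancel_left]
  apply abs_arg_lt_pi_div_two
  rw [re_div_exp]
  exact G.height_neg_lastDir_pos hΦ

/-- The argument of the normal that a leg determines by its total turn. -/
lemma exists_normal (f : T.Flag) {Φ : ℝ} (hΦ : IsOutward f.tri f.edge Φ) :
    ∃ n : ℤ, G.legAngle f = G.arrivalAngle Φ f + 2 * Real.pi * n ∧
      |G.legAngle f - (Φ + 2 * Real.pi * n)| < Real.pi / 2 := by
  obtain ⟨n, hn⟩ := (G.isAngle_arrivalAngle Φ f).exists_int (G.isAngle_legAngle f)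
  refine ⟨n, hn, ?_⟩
  have := G.abs_arrivalAngle_sub_lt hΦ
  rwa [hn, show G.arrivalAngle Φ f + 2 * Real.pi * n - (Φ + 2 * Real.pi * n) =
    G.arrivalAngle Φ f - Φ by ring]

/-- Seen from their common end, the two legs lie on opposite sides of the edge. So comparing
arguments does order each pair of legs. -/
lemma arg_lastDir_ne {f g : T.Flag} (hfg : f ≠ g) (he : f.edge = g.edge) :
    (G.lastDir f).arg ≠ (G.lastDir g).arg := by
  intro h
  obtain ⟨Φ, -, -, hf⟩ := f.exists_isOutward
  obtain ⟨Φ', -, -, hg⟩ := g.exists_isOutward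
  obtain ⟨N, hN, hΦ⟩ := Triangulation.Flag.exists_odd hfg he hf hg
  have h1 := G.height_neg_lastDir_pos hf
  have h2 := G.height_neg_lastDir_pos hg
  have h3 : height Φ (-G.lastDir f) = -height Φ' (-G.lastDir f) := by
    obtain ⟨i, rfl⟩ : ∃ i, N = 1 + 2 * i := ⟨N / 2, by omega⟩
    rw [hΦ, show Φ' + Real.pi * ((1 + 2 * i : ℤ) : ℝ) = Φ' + Real.pi + 2 * Real.pi * i by
      push_cast; ring, height_add_two_pi_mul, height_add_pi]
  obtain ⟨r, hr, hr1, hr2⟩ := (isAngle_arg (G.lastDir_ne_zero f)).exists_re_im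
  obtain ⟨r', hr', hr1', hr2'⟩ := (isAngle_arg (G.lastDir_ne_zero g)).exists_re_im
  have h4 : r' * height Φ' (-G.lastDir f) = r * height Φ' (-G.lastDir g) := by
    simp only [height, Complex.neg_re, Complex.neg_im, hr1, hr2, hr1', hr2', h]; ring
  have h5 : 0 < r * height Φ' (-G.lastDir g) := by positivity
  rw [← h4] at h5
  have := (mul_pos_iff_of_pos_left hr').1 h5
  linarith

end DualGraph

/-! ### Sums over states -/

section Sums

variable {k : Type*} [CommSemiring k] {S : Type*} [Fintype S]

lemma sum_fun_one {ι : Type*} [Fintype ι] [DecidableEq ι] (i : ι) (hcov : ∀ j, j = i)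
    (H : S → k) : ∑ ζ : ι → S, H (ζ i) = ∑ a, H a :=
  Fintype.sum_equiv ⟨fun ζ => ζ i, fun a _ => a, fun ζ => by funext j; rw [hcov j], fun _ => rfl⟩
    _ _ fun _ => rfl

lemma sum_fun_two {ι : Type*} [Fintype ι] [DecidableEq ι] (i j : ι) (hij : i ≠ j)
    (hcov : ∀ l, l = i ∨ l = j) (H : S → S → k) :
    ∑ ζ : ι → S, H (ζ i) (ζ j) = ∑ a, ∑ b, H a b := by
  rw [← Fintype.sum_prod_type']
  refine Fintype.sum_equiv ⟨fun ζ => (ζ i, ζ j), fun a l => if l = i then a.1 else a.2, ?_, ?_⟩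
    _ _ fun _ => rfl
  · intro ζ
    funext l
    rcases hcov l with rfl | rfl <;> simp [hij.symm]
  · intro a
    simp [hij.symm]

lemma sum_fun_three {ι : Type*} [Fintype ι] [DecidableEq ι] (i j l : ι) (hij : i ≠ j) (hil : i ≠ l)
    (hjl : j ≠ l) (hcov : ∀ m, m = i ∨ m = j ∨ m = l) (H : S → S → S → k) :
    ∑ ζ : ι → S, H (ζ i) (ζ j) (ζ l) = ∑ a, ∑ b, ∑ c, H a b c := by
  have : ∑ a, ∑ b, ∑ c, H a b c = ∑ p : S × S × S, H p.1 p.2.1 p.2.2 := by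
    simp only [Fintype.sum_prod_type]
  rw [this]
  refine Fintype.sum_equiv ⟨fun ζ => (ζ i, ζ j, ζ l),
    fun a m => if m = i then a.1 else if m = j then a.2.1 else a.2.2, ?_, ?_⟩
    _ _ fun _ => rfl
  · intro ζ
    funext m
    rcases hcov m with rfl | rfl | rfl <;> simp [hij.symm, hil.symm, hjl.symm]
  · intro a
    simp [hij.symm, hil.symm, hjl.symm]

/-- The extension of a function on a fibre by a given function. -/
def fiberExtend {F τ : Type*} [DecidableEq τ] (π : F → τ) (z₀ : F → S) (t : τ)
    (ζ : {f // π f = t} → S) : F → S := fun f => if h : π f = t then ζ ⟨f, h⟩ else z₀ f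

/-- A sum of products of functions that each depend on one fibre is a product of sums. -/
lemma sum_prod_fiber {F τ : Type*} [Fintype F] [DecidableEq F] [Fintype τ] [DecidableEq τ]
    (π : F → τ) (z₀ : F → S) (g : τ → (F → S) → k)
    (hg : ∀ t z z', (∀ f, π f = t → z f = z' f) → g t z = g t z') :
    ∑ z : F → S, ∏ t, g t z =
      ∏ t, ∑ ζ : {f // π f = t} → S, g t (fiberExtend π z₀ t ζ) := by
  rw [Finset.prod_univ_sum]
  simp only [Fintype.piFinset_univ]
  refine Fintype.sum_equiv ⟨fun z t f => z f.1, fun x f => x (π f) ⟨f, rfl⟩, fun z => rfl, ?_⟩ _ _ ?_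
  · intro x
    funext t f
    obtain ⟨f, rfl⟩ := f
    rfl
  · intro z
    refine Finset.prod_congr rfl fun t _ => hg t _ _ fun f hf => ?_
    simp [fiberExtend, hf]

end Sums

open Triangulation

/-! ### Evaluation in terms of the normals of the edges -/

section Net

variable {M : Set ℂ} {T : Triangulation M}

open scoped Classical in
/-- The triples of flags of one triangle in the order given by `χ`. -/
def sortedTriples (χ : T.Flag → ℝ) : Finset (T.Flag × T.Flag × T.Flag) :=
  {p | p.1.tri = p.2.1.tri ∧ p.2.1.tri = p.2.2.tri ∧ χ p.1 < χ p.2.1 ∧ χ p.2.1 < χ p.2.2}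

open scoped Classical in
/-- The pairs of flags of one edge in the order given by `χ`. -/
def sortedPairs (χ : T.Flag → ℝ) : Finset (T.Flag × T.Flag) :=
  {p | p.1.edge = p.2.edge ∧ χ p.1 < χ p.2}

lemma mem_sortedTriples {χ : T.Flag → ℝ} {p : T.Flag × T.Flag × T.Flag} :
    p ∈ sortedTriples χ ↔
      p.1.tri = p.2.1.tri ∧ p.2.1.tri = p.2.2.tri ∧ χ p.1 < χ p.2.1 ∧ χ p.2.1 < χ p.2.2 := by
  simp [sortedTriples]

lemma mem_sortedPairs {χ : T.Flag → ℝ} {p : T.Flag × T.Flag} :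
    p ∈ sortedPairs χ ↔ p.1.edge = p.2.edge ∧ χ p.1 < χ p.2 := by
  simp [sortedPairs]

lemma eq_of_mem_sortedTriples {χ : T.Flag → ℝ} {p : T.Flag × T.Flag × T.Flag}
    (hp : p ∈ sortedTriples χ) {f₁ f₂ f₃ : T.Flag} (h12 : χ f₁ < χ f₂) (h23 : χ f₂ < χ f₃)
    (hcov : ∀ f : T.Flag, f.tri = p.1.tri → f = f₁ ∨ f = f₂ ∨ f = f₃) : p = (f₁, f₂, f₃) := by
  obtain ⟨p1, p2, p3⟩ := p
  obtain ⟨e1, e2, l1, l2⟩ := mem_sortedTriples.1 hp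
  simp only at e1 e2 l1 l2 hcov
  rcases hcov p1 rfl with rfl | rfl | rfl <;> rcases hcov p2 e1.symm with rfl | rfl | rfl <;>
    rcases hcov p3 (e2.symm.trans e1.symm) with rfl | rfl | rfl <;> first | rfl | (exfalso; linarith)

instance : Fintype T.triangles := (T.finite.subset fun _ h => h.1).fintype

/-- The sorted triple of each triangle. -/
lemma exists_triple {χ : T.Flag → ℝ} (hχ : ∀ f g : T.Flag, f.tri = g.tri → χ f = χ g → f = g)
    (t : T.triangles) : ∃ p ∈ sortedTriples χ, p.1.tri = t ∧
      ∀ f : T.Flag, f.tri = t → f = p.1 ∨ f = p.2.1 ∨ f = p.2.2 := by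
  obtain ⟨f₁, f₂, f₃, h12, h23, h1, h2, h3, hcov⟩ := exists_sorted_flags t.2 χ hχ
  exact ⟨(f₁, f₂, f₃), mem_sortedTriples.2 ⟨h1.trans h2.symm, h2.trans h3.symm, h12, h23⟩, h1, hcov⟩

lemma prod_sortedTriples {k : Type*} [CommMonoid k] {χ : T.Flag → ℝ}
    {P : T.triangles → T.Flag × T.Flag × T.Flag}
    (hP : ∀ t, P t ∈ sortedTriples χ ∧ (P t).1.tri = t ∧
      ∀ f : T.Flag, f.tri = t → f = (P t).1 ∨ f = (P t).2.1 ∨ f = (P t).2.2)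
    (c : T.Flag × T.Flag × T.Flag → k) : ∏ p ∈ sortedTriples χ, c p = ∏ t, c (P t) := by
  symm
  refine Finset.prod_bij (fun t _ => P t) (fun t _ => (hP t).1) ?_ ?_ fun _ _ => rfl
  · intro t _ t' _ h
    apply Subtype.ext
    rw [← (hP t).2.1, ← (hP t').2.1, h]
  · intro p hp
    refine ⟨⟨p.1.tri, p.1.tri_mem⟩, Finset.mem_univ _, ?_⟩
    obtain ⟨h1, h2, h3⟩ := hP ⟨p.1.tri, p.1.tri_mem⟩
    obtain ⟨-, -, l1, l2⟩ := mem_sortedTriples.1 h1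
    exact (eq_of_mem_sortedTriples hp l1 l2 h3).symm

lemma ne_of_mem_sortedTriples {χ : T.Flag → ℝ} {p : T.Flag × T.Flag × T.Flag}
    (hp : p ∈ sortedTriples χ) : p.1 ≠ p.2.1 ∧ p.1 ≠ p.2.2 ∧ p.2.1 ≠ p.2.2 := by
  obtain ⟨-, -, l1, l2⟩ := mem_sortedTriples.1 hp
  refine ⟨fun h => ?_, fun h => ?_, fun h => ?_⟩
  · rw [h] at l1; exact lt_irrefl _ l1
  · rw [h] at l1; linarith
  · rw [h] at l2; exact lt_irrefl _ l2

lemma prod_flags {k : Type*} [CommMonoid k] {χ : T.Flag → ℝ}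
    {P : T.triangles → T.Flag × T.Flag × T.Flag}
    (hP : ∀ t, P t ∈ sortedTriples χ ∧ (P t).1.tri = t ∧
      ∀ f : T.Flag, f.tri = t → f = (P t).1 ∨ f = (P t).2.1 ∨ f = (P t).2.2)
    (m : T.Flag → k) : ∏ f, m f = ∏ t, m (P t).1 * (m (P t).2.1 * m (P t).2.2) := by
  classical
  rw [← Finset.prod_fiberwise (s := Finset.univ) (g := fun f : T.Flag => (⟨f.tri, f.tri_mem⟩ : T.triangles))]
  refine Finset.prod_congr rfl fun t _ => ?_
  obtain ⟨h1, h2, h3⟩ := hP t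
  obtain ⟨e1, e2, -, -⟩ := mem_sortedTriples.1 h1
  obtain ⟨n1, n2, n3⟩ := ne_of_mem_sortedTriples h1
  have : (Finset.univ.filter fun f : T.Flag => (⟨f.tri, f.tri_mem⟩ : T.triangles) = t) =
      {(P t).1, (P t).2.1, (P t).2.2} := by
    ext f
    simp only [Finset.mem_filter, Finset.mem_univ, true_and, Finset.mem_insert,
      Finset.mem_singleton, Subtype.ext_iff]
    refine ⟨h3 f, ?_⟩
    rintro (rfl | rfl | rfl)
    · exact h2
    · exact e1.symm.trans h2
    · exact (e2.symm.trans e1.symm).trans h2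
  rw [this, Finset.prod_insert (by simp [n1, n2]), Finset.prod_insert (by simp [n3]),
    Finset.prod_singleton]

end Net

/-! ### Factorisation of the evaluation over triangles and edges -/

namespace Data

variable {k : Type*} [Field k] {S : Type*} [Fintype S] [DecidableEq S]

/-- The amplitude of a dual vertex with its legs transformed by three matrices. -/
def vertexAmp (D : Data k S) (A₁ A₂ A₃ : Matrix S S k) (y₁ y₂ y₃ : S) : k :=
  ∑ a, ∑ b, ∑ c, D.C a b c * (A₁ a y₁ * (A₂ b y₂ * A₃ c y₃))

variable {D : Data k S}

/-- A full turn on the last leg is absorbed by moving this leg to the first place, by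
`sum_C_nakayama`. -/
lemma vertexAmp_rotate (hB : IsUnit D.B.det) (hD : D.IsDiagrammatic) (A₁ A₂ A₃ : Matrix S S k)
    (y₁ y₂ y₃ : S) :
    D.vertexAmp A₁ A₂ (D.nakayama * A₃) y₁ y₂ y₃ = D.vertexAmp A₃ A₁ A₂ y₃ y₁ y₂ := by
  have h1 : D.vertexAmp A₁ A₂ (D.nakayama * A₃) y₁ y₂ y₃ =
      ∑ a, ∑ b, ∑ c, D.C c a b * (A₃ c y₃ * (A₁ a y₁ * A₂ b y₂)) := by
    refine Finset.sum_congr rfl fun a _ => Finset.sum_congr rfl fun b _ => ?_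
    simp only [Matrix.mul_apply, ← sum_C_nakayama hB hD a b, Finset.mul_sum, Finset.sum_mul]
    rw [Finset.sum_comm]
    exact Finset.sum_congr rfl fun c _ => Finset.sum_congr rfl fun d _ => by ring
  rw [h1, vertexAmp]
  rw [Finset.sum_comm' (t' := Finset.univ) (s' := fun _ => Finset.univ) (by simp)]
  conv_rhs => rw [Finset.sum_comm]
  conv_rhs =>
    enter [2, a]
    rw [Finset.sum_comm]
  rw [Finset.sum_comm]

/-- Three rotations restore the order of the legs and absorb one full turn on each of them. -/
lemma vertexAmp_nakayama (hB : IsUnit D.B.det) (hD : D.IsDiagrammatic) (A₁ A₂ A₃ : Matrix S S k)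
    (y₁ y₂ y₃ : S) :
    D.vertexAmp (D.nakayama * A₁) (D.nakayama * A₂) (D.nakayama * A₃) y₁ y₂ y₃ =
      D.vertexAmp A₁ A₂ A₃ y₁ y₂ y₃ := by
  rw [vertexAmp_rotate hB hD, vertexAmp_rotate hB hD, vertexAmp_rotate hB hD]

lemma vertexAmp_zpow (hB : IsUnit D.B.det) (hD : D.IsDiagrammatic) (j : ℤ) (A₁ A₂ A₃ : Matrix S S k)
    (y₁ y₂ y₃ : S) :
    D.vertexAmp (D.nakayama ^ j * A₁) (D.nakayama ^ j * A₂) (D.nakayama ^ j * A₃) y₁ y₂ y₃ =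
      D.vertexAmp A₁ A₂ A₃ y₁ y₂ y₃ := by
  have hs : ∀ i : ℤ, ∀ A : Matrix S S k,
      D.nakayama ^ (i + 1) * A = D.nakayama * (D.nakayama ^ i * A) := by
    intro i A
    have := nakayama_zpow_add hB 1 i
    rw [zpow_one] at this
    rw [add_comm, this, Matrix.mul_assoc]
  induction j using Int.induction_on generalizing A₁ A₂ A₃ with
  | zero => simp
  | succ j ih => rw [hs, hs, hs, vertexAmp_nakayama hB hD, ih]
  | pred j ih =>
    rw [← vertexAmp_nakayama hB hD, ← hs, ← hs, ← hs]
    simpa using ih A₁ A₂ A₃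

variable {M : Set ℂ} {T : Triangulation M}

open scoped Classical in
-- The indices at a dual vertex belong to the flags of one triangle only, so the sum over all
-- indices is a product of separate sums.
lemma sum_vertices {χ : T.Flag → ℝ} {P : T.triangles → T.Flag × T.Flag × T.Flag}
    (hP : ∀ t, P t ∈ sortedTriples χ ∧ (P t).1.tri = t ∧
      ∀ f : T.Flag, f.tri = t → f = (P t).1 ∨ f = (P t).2.1 ∨ f = (P t).2.2)
    (A : T.Flag → Matrix S S k) (y : T.Flag → S) :
    ∑ z : T.Flag → S, (∏ p ∈ sortedTriples χ, D.C (z p.1) (z p.2.1) (z p.2.2)) *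
      ∏ f, A f (z f) (y f) =
    ∏ t, D.vertexAmp (A (P t).1) (A (P t).2.1) (A (P t).2.2) (y (P t).1) (y (P t).2.1)
      (y (P t).2.2) := by
  classical
  have h1 : ∀ z : T.Flag → S, (∏ p ∈ sortedTriples χ, D.C (z p.1) (z p.2.1) (z p.2.2)) *
      ∏ f, A f (z f) (y f) = ∏ t, (D.C (z (P t).1) (z (P t).2.1) (z (P t).2.2) *
        (A (P t).1 (z (P t).1) (y (P t).1) * (A (P t).2.1 (z (P t).2.1) (y (P t).2.1) *
          A (P t).2.2 (z (P t).2.2) (y (P t).2.2)))) := by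
    intro z
    rw [prod_sortedTriples hP (fun p => D.C (z p.1) (z p.2.1) (z p.2.2)),
      prod_flags hP (fun f => A f (z f) (y f)), ← Finset.prod_mul_distrib]
  simp only [h1]
  have hm : ∀ t, (P t).1.tri = t ∧ (P t).2.1.tri = t ∧ (P t).2.2.tri = t := by
    intro t
    obtain ⟨e1, e2, -, -⟩ := mem_sortedTriples.1 (hP t).1
    have := (hP t).2.1
    exact ⟨this, e1.symm.trans this, (e2.symm.trans e1.symm).trans this⟩
  rw [sum_prod_fiber (fun f : T.Flag => (⟨f.tri, f.tri_mem⟩ : T.triangles)) y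
    (fun t z => D.C (z (P t).1) (z (P t).2.1) (z (P t).2.2) *
        (A (P t).1 (z (P t).1) (y (P t).1) * (A (P t).2.1 (z (P t).2.1) (y (P t).2.1) *
          A (P t).2.2 (z (P t).2.2) (y (P t).2.2))))]
  · refine Finset.prod_congr rfl fun t _ => ?_
    obtain ⟨m1, m2, m3⟩ := hm t
    obtain ⟨n1, n2, n3⟩ := ne_of_mem_sortedTriples (hP t).1
    have e := sum_fun_three (k := k) (S := S)
      (ι := {f : T.Flag // (⟨f.tri, f.tri_mem⟩ : T.triangles) = t})
      ⟨(P t).1, Subtype.ext m1⟩ ⟨(P t).2.1, Subtype.ext m2⟩ ⟨(P t).2.2, Subtype.ext m3⟩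
      (by simpa using n1) (by simpa using n2) (by simpa using n3)
      (by
        rintro ⟨f, hf⟩
        simpa using (hP t).2.2 f (congrArg Subtype.val hf))
      (fun a b c => D.C a b c * (A (P t).1 a (y (P t).1) * (A (P t).2.1 b (y (P t).2.1) *
          A (P t).2.2 c (y (P t).2.2))))
    rw [vertexAmp, ← e]
    refine Finset.sum_congr rfl fun ζ _ => ?_
    simp [fiberExtend, m1, m2, m3]
  · intro t z z' h
    obtain ⟨m1, m2, m3⟩ := hm t
    simp only [h _ (Subtype.ext m1), h _ (Subtype.ext m2), h _ (Subtype.ext m3)]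

/-- The turning of the legs and the framing give two choices of arguments for the three normals,
both spread over less than one turn. They differ by a common number of full turns and at most one
further turn on the last legs, which rotating the dual vertex compensates. -/
lemma vertexAmp_arrivalAngle (hB : IsUnit D.B.det) (hD : D.IsDiagrammatic) (G : DualGraph T)
    {Φ : T.Flag → ℝ} (hΦ : IsFraming Φ) (y : T.Flag → S) {p q : T.Flag × T.Flag × T.Flag}
    (hp : p ∈ sortedTriples fun f => (G.firstDir f).arg) (hq : q ∈ sortedTriples Φ)
    (hcov : ∀ f : T.Flag, f.tri = q.1.tri → f = p.1 ∨ f = p.2.1 ∨ f = p.2.2)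
    (hpq : p.1.tri = q.1.tri) :
    D.vertexAmp (D.legAmp G p.1) (D.legAmp G p.2.1) (D.legAmp G p.2.2) (y p.1) (y p.2.1) (y p.2.2) =
    D.vertexAmp (D.turn (halfTurns (G.arrivalAngle (Φ q.1) q.1)))
      (D.turn (halfTurns (G.arrivalAngle (Φ q.2.1) q.2.1)))
      (D.turn (halfTurns (G.arrivalAngle (Φ q.2.2) q.2.2))) (y q.1) (y q.2.1) (y q.2.2) := by
  obtain ⟨f₁, f₂, f₃⟩ := p
  simp only at hcov hpq ⊢
  obtain ⟨e1, e2, l1, l2⟩ := mem_sortedTriples.1 hp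
  simp only at e1 e2 l1 l2
  obtain ⟨n₁, a₁, b₁⟩ := G.exists_normal f₁ (hΦ.isOutward f₁)
  obtain ⟨n₂, a₂, b₂⟩ := G.exists_normal f₂ (hΦ.isOutward f₂)
  obtain ⟨n₃, a₃, b₃⟩ := G.exists_normal f₃ (hΦ.isOutward f₃)
  have o₁ := isOutward_add_two_pi_mul (hΦ.isOutward f₁) n₁
  have o₂ := isOutward_add_two_pi_mul (hΦ.isOutward f₂) n₂
  have o₃ := isOutward_add_two_pi_mul (hΦ.isOutward f₃) n₃
  obtain ⟨c1, c2⟩ := G.abs_normal_sub_lt e1 l1 o₁ o₂ b₁ b₂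
  obtain ⟨c3, c4⟩ := G.abs_normal_sub_lt e2 l2 o₂ o₃ b₂ b₃
  obtain ⟨c5, c6⟩ := G.abs_normal_sub_lt (e1.trans e2) (l1.trans l2) o₁ o₃ b₁ b₃
  have d12 := abs_lt.1 (hΦ.abs_sub_lt f₁ f₂ e1)
  have d23 := abs_lt.1 (hΦ.abs_sub_lt f₂ f₃ e2)
  have d13 := abs_lt.1 (hΦ.abs_sub_lt f₁ f₃ (e1.trans e2))
  have hπ := Real.pi_pos
  have int_bound : ∀ {m n : ℤ}, Real.pi * 2 * ((m : ℝ) - n) < 2 * (Real.pi * 2) →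
      -(Real.pi * 2) < Real.pi * 2 * ((m : ℝ) - n) → m - n = 0 ∨ m - n = 1 := by
    intro m n h1 h2
    have h1' : ((m - n : ℤ) : ℝ) < 2 := by push_cast; nlinarith
    have h2' : (-1 : ℝ) < ((m - n : ℤ) : ℝ) := by push_cast; nlinarith
    have h1'' : m - n < 2 := by exact_mod_cast h1'
    have h2'' : -1 < m - n := by exact_mod_cast h2'
    omega
  -- `n₁`, `n₂`, `n₃` are the full turns by which the legs exceed the framing. The first choice
  -- increases along the legs within 2π and the framing varies by less than 2π, so each difference
  -- of a later and an earlier number is 0 or 1.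
  have s12 := int_bound (m := n₂) (n := n₁) (by linarith [d12.1, d12.2]) (by linarith [d12.1, d12.2])
  have s23 := int_bound (m := n₃) (n := n₂) (by linarith [d23.1, d23.2]) (by linarith [d23.1, d23.2])
  have s13 := int_bound (m := n₃) (n := n₁) (by linarith [d13.1, d13.2]) (by linarith [d13.1, d13.2])
  rw [legAmp_eq_turn hB, legAmp_eq_turn hB, legAmp_eq_turn hB, a₁, a₂, a₃,
    halfTurns_add_two_pi_mul, halfTurns_add_two_pi_mul, halfTurns_add_two_pi_mul,
    turn_add_two_mul hB, turn_add_two_mul hB, turn_add_two_mul hB]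
  have hs : ∀ A : Matrix S S k,
      D.nakayama ^ (n₁ + 1) * A = D.nakayama ^ n₁ * (D.nakayama * A) := by
    intro A
    rw [nakayama_zpow_add hB, zpow_one, Matrix.mul_assoc]
  -- A jump before the third leg puts that leg first in the framing; a jump before the second leg
  -- puts the first one last. Two jumps would contradict `s13`.
  rcases s12 with s12 | s12 <;> rcases s23 with s23 | s23
  · obtain rfl : n₂ = n₁ := by omega
    obtain rfl : n₃ = n₂ := by omega
    rw [eq_of_mem_sortedTriples hq (f₁ := f₁) (f₂ := f₂) (f₃ := f₃) (by linarith) (by linarith) hcov,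
      vertexAmp_zpow hB hD]
  · obtain rfl : n₂ = n₁ := by omega
    obtain rfl : n₃ = n₂ + 1 := by omega
    push_cast at c6
    rw [eq_of_mem_sortedTriples hq (f₁ := f₃) (f₂ := f₁) (f₃ := f₂) (by linarith) (by linarith)
      (fun f hf => by have := hcov f hf; tauto), hs, vertexAmp_zpow hB hD, vertexAmp_rotate hB hD]
  · obtain rfl : n₂ = n₁ + 1 := by omega
    obtain rfl : n₃ = n₁ + 1 := by omega
    push_cast at c6
    rw [eq_of_mem_sortedTriples hq (f₁ := f₂) (f₂ := f₃) (f₃ := f₁) (by linarith) (by linarith)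
      (fun f hf => by have := hcov f hf; tauto), hs, hs, vertexAmp_zpow hB hD,
      vertexAmp_rotate hB hD, vertexAmp_rotate hB hD]
  · omega

open scoped Classical in
/-- The sum over the states at the edges for fixed states at the dual vertices. -/
lemma sum_edges (hB : IsUnit D.B.det) (G : DualGraph T) {Φ : T.Flag → ℝ} (hΦ : IsFraming Φ)
    (bs : Finset ℂ → S) (z : T.Flag → S) :
    ∑ y : T.Flag → S, (∏ f, D.turn (halfTurns (G.arrivalAngle (Φ f) f)) (z f) (y f)) *
      (∏ p ∈ edgePairs G, D.cornerAmp (G.lastDir p.1) (G.lastDir p.2) (y p.1) (y p.2)) *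
      (∏ f : T.Flag, if f.IsBoundary → y f = bs f.edge then 1 else 0) =
    (∏ p ∈ sortedPairs Φ, D.turn ⌊(Φ p.1 - Φ p.2) / Real.pi⌋ (z p.1) (z p.2)) *
      ∏ f : T.Flag, if f.IsBoundary then
        D.turn (halfTurns (G.arrivalAngle (Φ f) f)) (z f) (bs f.edge) else 1 := by
  -- Every factor involves the flags of a single edge, so the sum over `y` splits over the edges. A
  -- boundary edge has one flag, whose state is prescribed; an interior edge has two.
  let τ := Set.range fun f : T.Flag => f.edge
  let π : T.Flag → τ := fun f => ⟨f.edge, f, rfl⟩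
  have hπ : ∀ {f g : T.Flag}, f.edge = g.edge ↔ π f = π g := by
    exact fun {f g} => ⟨fun h => Subtype.ext h, fun h => congrArg Subtype.val h⟩
  set A : T.Flag → Matrix S S k := fun f => D.turn (halfTurns (G.arrivalAngle (Φ f) f)) with hA
  let g : τ → (T.Flag → S) → k := fun e y =>
    (∏ f with π f = e, A f (z f) (y f)) *
      (∏ p ∈ edgePairs G with π p.1 = e,
        D.cornerAmp (G.lastDir p.1) (G.lastDir p.2) (y p.1) (y p.2)) *
      (∏ f : T.Flag with π f = e, if f.IsBoundary → y f = bs f.edge then 1 else 0)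
  have hmem : ∀ p, p ∈ edgePairs G ↔ p.1.edge = p.2.edge ∧
      (G.lastDir p.1).arg < (G.lastDir p.2).arg := by
    intro p; simp [edgePairs]
  have h1 : ∀ y : T.Flag → S, (∏ f, A f (z f) (y f)) *
      (∏ p ∈ edgePairs G, D.cornerAmp (G.lastDir p.1) (G.lastDir p.2) (y p.1) (y p.2)) *
      (∏ f : T.Flag, if f.IsBoundary → y f = bs f.edge then 1 else 0) = ∏ e, g e y := by
    intro y
    simp only [g, Finset.prod_mul_distrib]
    congr 1
    · congr 1
      · rw [Finset.prod_fiberwise]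
      · rw [Finset.prod_fiberwise]
    · rw [Finset.prod_fiberwise]
  have h2 : (∏ p ∈ sortedPairs Φ, D.turn ⌊(Φ p.1 - Φ p.2) / Real.pi⌋ (z p.1) (z p.2)) *
      (∏ f : T.Flag, if f.IsBoundary then A f (z f) (bs f.edge) else 1) =
      ∏ e, (∏ p ∈ sortedPairs Φ with π p.1 = e,
          D.turn ⌊(Φ p.1 - Φ p.2) / Real.pi⌋ (z p.1) (z p.2)) *
        ∏ f : T.Flag with π f = e, if f.IsBoundary then A f (z f) (bs f.edge) else 1 := by
    rw [Finset.prod_mul_distrib, Finset.prod_fiberwise, Finset.prod_fiberwise]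
  refine (Finset.sum_congr rfl fun y _ => h1 y).trans (Eq.trans ?_ h2.symm)
  rw [sum_prod_fiber π z g]
  · refine Finset.prod_congr rfl fun e _ => ?_
    obtain ⟨_, f, rfl⟩ := e
    change ∑ ζ : {f' // π f' = π f} → S, g (π f) (fiberExtend π z (π f) ζ) =
      (∏ p ∈ sortedPairs Φ with π p.1 = π f, _) *
        ∏ f' : T.Flag with π f' = π f, _
    by_cases hf : f.IsBoundary
    · have hcov : ∀ f', π f' = π f → f' = f := fun f' h => hf f' (hπ.2 h)
      have e1 : (Finset.univ.filter fun f' => π f' = π f) = {f} := by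
        ext f'
        simp only [Finset.mem_filter, Finset.mem_univ, true_and, Finset.mem_singleton]
        exact ⟨hcov f', fun h => by rw [h]⟩
      have e2 : ((edgePairs G).filter fun p => π p.1 = π f) = ∅ := by
        rw [Finset.filter_eq_empty_iff]
        intro p hp h
        obtain ⟨q1, q2⟩ := (hmem p).1 hp
        rw [hcov _ h, hcov p.2 (by rw [← hπ.1 q1, h])] at q2
        exact lt_irrefl _ q2
      have e3 : ((sortedPairs Φ).filter fun p => π p.1 = π f) = ∅ := by
        rw [Finset.filter_eq_empty_iff]
        intro p hp h
        obtain ⟨q1, q2⟩ := mem_sortedPairs.1 hp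
        rw [hcov _ h, hcov p.2 (by rw [← hπ.1 q1, h])] at q2
        exact lt_irrefl _ q2
      simp only [g, e1, e2, e3, Finset.prod_empty, Finset.prod_singleton, hf, if_true, mul_one, one_mul,
        true_implies]
      have := sum_fun_one (k := k) (S := S) (ι := {f' // π f' = π f}) ⟨f, rfl⟩
        (fun j => Subtype.ext (hcov j j.2))
        (fun a => A f (z f) a * if a = bs f.edge then 1 else 0)
      simp only [mul_ite, mul_one, mul_zero, Finset.sum_ite_eq', Finset.mem_univ, if_true] at this
      rw [← this]
      refine Finset.sum_congr rfl fun ζ _ => ?_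
      simp [fiberExtend]
    · obtain ⟨f', hf'e, hf'⟩ : ∃ f' : T.Flag, f'.edge = f.edge ∧ f' ≠ f := by
        simp only [Flag.IsBoundary, not_forall] at hf
        obtain ⟨f', h1, h2⟩ := hf
        exact ⟨f', h1, h2⟩
      obtain ⟨a, b, hab, hae, hbe, hlt⟩ : ∃ a b : T.Flag, a ≠ b ∧ a.edge = f.edge ∧ b.edge = f.edge ∧
          (G.lastDir a).arg < (G.lastDir b).arg := by
        rcases lt_or_gt_of_ne (G.arg_lastDir_ne hf' hf'e) with h | h
        · exact ⟨f', f, hf', hf'e, rfl, h⟩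
        · exact ⟨f, f', hf'.symm, rfl, hf'e, h⟩
      have hcov : ∀ f', π f' = π f → f' = a ∨ f' = b := fun f' h =>
        Flag.eq_or_eq hab (hae.trans hbe.symm) (hae.trans (hπ.2 h).symm)
      have hna : ¬ a.IsBoundary := fun h => hab (h b (hbe.trans hae.symm)).symm
      have hnb : ¬ b.IsBoundary := fun h => hab (h a (hae.trans hbe.symm))
      have e1 : (Finset.univ.filter fun f' => π f' = π f) = {a, b} := by
        ext f'
        simp only [Finset.mem_filter, Finset.mem_univ, true_and, Finset.mem_singleton,
          Finset.mem_insert]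
        refine ⟨hcov f', ?_⟩
        rintro (rfl | rfl)
        · exact hπ.1 hae
        · exact hπ.1 hbe
      have e2 : ((edgePairs G).filter fun p => π p.1 = π f) = {(a, b)} := by
        ext ⟨p, q⟩
        simp only [Finset.mem_filter, Finset.mem_singleton, hmem]
        constructor
        · rintro ⟨⟨q1, q2⟩, h⟩
          have h' : π q = π f := by rw [← hπ.1 q1, h]
          rcases hcov p h with rfl | rfl <;> rcases hcov q h' with rfl | rfl <;>
            first | rfl | (exfalso; linarith)
        · intro h
          obtain ⟨rfl, rfl⟩ := Prod.mk.inj h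
          exact ⟨⟨hae.trans hbe.symm, hlt⟩, hπ.1 hae⟩
      have e3 : ∀ {c d : T.Flag}, (c = a ∧ d = b) ∨ (c = b ∧ d = a) → Φ c < Φ d →
          ((sortedPairs Φ).filter fun p => π p.1 = π f) = {(c, d)} := by
        intro c d hcd hlt'
        ext ⟨p, q⟩
        simp only [Finset.mem_filter, Finset.mem_singleton, mem_sortedPairs]
        constructor
        · rintro ⟨⟨q1, q2⟩, h⟩
          have h' : π q = π f := by rw [← hπ.1 q1, h]
          rcases hcov p h with rfl | rfl <;> rcases hcov q h' with rfl | rfl <;>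
            rcases hcd with ⟨rfl, rfl⟩ | ⟨rfl, rfl⟩ <;>
            first | rfl | (exfalso; linarith)
        · intro h
          obtain ⟨rfl, rfl⟩ := Prod.mk.inj h
          rcases hcd with ⟨rfl, rfl⟩ | ⟨rfl, rfl⟩
          · exact ⟨⟨hae.trans hbe.symm, hlt'⟩, hπ.1 hae⟩
          · exact ⟨⟨hbe.trans hae.symm, hlt'⟩, hπ.1 hbe⟩
      obtain ⟨N, hN, hNΦ⟩ := Flag.exists_odd hab (hae.trans hbe.symm) (hΦ.isOutward a) (hΦ.isOutward b)
      have hturn := turn_mul_cornerAmp_mul_turn hB (G.isAngle_arrivalAngle (Φ a) a)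
        (G.isAngle_arrivalAngle (Φ b) b) (G.lastDir_im_ne_zero a) (G.lastDir_im_ne_zero b) hN (by
          have b1 := abs_lt.1 (G.abs_arrivalAngle_sub_lt (hΦ.isOutward a))
          have b2 := abs_lt.1 (G.abs_arrivalAngle_sub_lt (hΦ.isOutward b))
          rw [abs_lt]
          constructor <;> linarith [b1.1, b1.2, b2.1, b2.2])
      -- The two flags may be ordered differently by the framing and by the directions at the edge.
      -- This is harmless, since transposing `turn N` gives `turn (-N)`. The floor acts on a number
      -- that is already an integer.
      have hR : (∏ p ∈ sortedPairs Φ with π p.1 = π f,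
          D.turn ⌊(Φ p.1 - Φ p.2) / Real.pi⌋ (z p.1) (z p.2)) = D.turn N (z a) (z b) := by
        have hN0 : (N : ℝ) ≠ 0 := by
          intro h
          have : N = 0 := by exact_mod_cast h
          omega
        rcases lt_or_gt_of_ne hN0 with hneg | hpos
        · rw [e3 (Or.inl ⟨rfl, rfl⟩) (by rw [hNΦ]; nlinarith [Real.pi_pos]), Finset.prod_singleton]
          have : (Φ a - Φ b) / Real.pi = N := by
            rw [hNΦ]; field_simp [Real.pi_ne_zero]; ring
          rw [this, Int.floor_intCast]
        · rw [e3 (Or.inr ⟨rfl, rfl⟩) (by rw [hNΦ]; nlinarith [Real.pi_pos]), Finset.prod_singleton]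
          have : (Φ b - Φ a) / Real.pi = ((-N : ℤ) : ℝ) := by
            rw [hNΦ]; field_simp [Real.pi_ne_zero]; push_cast; ring
          rw [this, Int.floor_intCast, ← turn_transpose hB hN, Matrix.transpose_apply]
      rw [hR, ← hturn]
      simp only [g, e1, e2, Finset.prod_pair hab, Finset.prod_singleton, hna, hnb, if_false, mul_one,
        false_implies, if_true]
      have := sum_fun_two (k := k) (S := S) (ι := {f' // π f' = π f}) ⟨a, hπ.1 hae⟩ ⟨b, hπ.1 hbe⟩
        (by simpa using hab) (fun j => by simpa [Subtype.ext_iff] using hcov j j.2)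
        (fun x y => A a (z a) x * A b (z b) y * D.cornerAmp (G.lastDir a) (G.lastDir b) x y)
      have hL : ∀ ζ : {f' // π f' = π f} → S,
          fiberExtend π z (π f) ζ a = ζ ⟨a, hπ.1 hae⟩ ∧
          fiberExtend π z (π f) ζ b = ζ ⟨b, hπ.1 hbe⟩ := by
        intro ζ
        simp [fiberExtend, hπ.1 hae, hπ.1 hbe]
      simp only [fun ζ => (hL ζ).1, fun ζ => (hL ζ).2]
      rw [this]
      simp only [Matrix.mul_apply, Matrix.transpose_apply, Finset.sum_mul, hA]
      rw [Finset.sum_comm]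
      exact Finset.sum_congr rfl fun x _ => Finset.sum_congr rfl fun y _ => by ring
  · intro e y y' h
    simp only [g]
    congr 1
    · congr 1
      · refine Finset.prod_congr rfl fun f hf => ?_
        rw [h f (Finset.mem_filter.1 hf).2]
      · refine Finset.prod_congr rfl fun p hp => ?_
        obtain ⟨hp1, hp2⟩ := Finset.mem_filter.1 hp
        rw [h _ hp2, h p.2 (by rw [← hπ.1 ((hmem p).1 hp1).1, hp2])]
    · refine Finset.prod_congr rfl fun f hf => ?_
      rw [h f (Finset.mem_filter.1 hf).2]

open scoped Classical in
/-- The state sum of a framed triangulation with given amplitudes at the boundary. -/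
def framedSum (D : Data k S) (Φ : T.Flag → ℝ) (Q : T.Flag → S → k) : k :=
  ∑ z : T.Flag → S, (∏ p ∈ sortedTriples Φ, D.C (z p.1) (z p.2.1) (z p.2.2)) *
    ((∏ p ∈ sortedPairs Φ, D.turn ⌊(Φ p.1 - Φ p.2) / Real.pi⌋ (z p.1) (z p.2)) *
      ∏ f : T.Flag, if f.IsBoundary then Q f (z f) else 1)

/-- The evaluation of a dual graph depends only on the triangulation and on the directions in
which the graph meets the boundary. -/
theorem evalGraph_eq_framedSum (hB : IsUnit D.B.det) (hD : D.IsDiagrammatic) (G : DualGraph T)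
    {Φ : T.Flag → ℝ} (hΦ : IsFraming Φ) (bs : Finset ℂ → S) :
    D.evalGraph G bs = D.framedSum Φ fun f s =>
      D.turn (halfTurns (G.arrivalAngle (Φ f) f)) s (bs f.edge) := by
  classical
  choose P hP using exists_triple (T := T) (χ := fun f => (G.firstDir f).arg)
    fun f g hfg h => G.arg_firstDir_injective hfg h
  choose P' hP' using exists_triple hΦ.injective
  -- For fixed states at the ends of the legs, the turning of the legs is replaced by arrival angles
  -- near the framing, one triangle at a time. The sum over the ends is taken only afterwards.
  have key : ∀ y : T.Flag → S,
      ∑ z : T.Flag → S, (∏ p ∈ vertexTriples G, D.C (z p.1) (z p.2.1) (z p.2.2)) *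
        ∏ f, D.legAmp G f (z f) (y f) =
      ∑ z : T.Flag → S, (∏ p ∈ sortedTriples Φ, D.C (z p.1) (z p.2.1) (z p.2.2)) *
        ∏ f, D.turn (halfTurns (G.arrivalAngle (Φ f) f)) (z f) (y f) := by
    intro y
    have e1 := sum_vertices (D := D) hP (fun f => D.legAmp G f) y
    have e2 := sum_vertices (D := D) hP' (fun f => D.turn (halfTurns (G.arrivalAngle (Φ f) f))) y
    refine Eq.trans ?_ (e1.trans (Eq.trans ?_ e2.symm))
    · congr!
    · refine Finset.prod_congr rfl fun t _ => ?_
      refine vertexAmp_arrivalAngle hB hD G hΦ y (hP t).1 (hP' t).1 ?_ ((hP t).2.1.trans (hP' t).2.1.symm)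
      intro f hf
      exact (hP t).2.2 f (hf.trans (hP' t).2.1)
  have hedge := sum_edges hB G hΦ bs
  rw [evalGraph, Finset.sum_comm]
  have h1 : ∀ y : T.Flag → S, ∑ z : T.Flag → S,
      (∏ p ∈ vertexTriples G, D.C (z p.1) (z p.2.1) (z p.2.2)) *
      (∏ f : T.Flag, D.legAmp G f (z f) (y f)) *
      (∏ p ∈ edgePairs G, D.cornerAmp (G.lastDir p.1) (G.lastDir p.2) (y p.1) (y p.2)) *
      (∏ f : T.Flag, if f.IsBoundary → y f = bs f.edge then 1 else 0) =
      ∑ z : T.Flag → S, (∏ p ∈ sortedTriples Φ, D.C (z p.1) (z p.2.1) (z p.2.2)) *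
      ((∏ f : T.Flag, D.turn (halfTurns (G.arrivalAngle (Φ f) f)) (z f) (y f)) *
      (∏ p ∈ edgePairs G, D.cornerAmp (G.lastDir p.1) (G.lastDir p.2) (y p.1) (y p.2)) *
      (∏ f : T.Flag, if f.IsBoundary → y f = bs f.edge then 1 else 0)) := by
    intro y
    rw [← Finset.sum_mul, ← Finset.sum_mul, key y, Finset.sum_mul, Finset.sum_mul]
    exact Finset.sum_congr rfl fun z _ => by ring
  refine (Finset.sum_congr (by congr!) fun y _ => Eq.trans (by congr!) (h1 y)).trans ?_
  rw [Finset.sum_comm, framedSum]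
  refine Finset.sum_congr (by congr!) fun z _ => ?_
  rw [← Finset.mul_sum]
  congr 1
  refine Eq.trans ?_ ((hedge z).trans ?_)
  · congr!
  · congr!

end Data

/-! ### Local changes of a triangulation -/

namespace Data

variable {k : Type*} [Field k] {S : Type*} [Fintype S] [DecidableEq S] {D : Data k S}
  {M : Set ℂ} {T T' : Triangulation M}

open scoped Classical in
/-- States on the flags, given on the edges outside and inside of a region. -/
def combine (I : Finset ℂ → Prop) (u : {f : T.Flag // ¬ I f.edge} → S)
    (w : {f : T.Flag // I f.edge} → S) : T.Flag → S :=
  fun f => if h : I f.edge then w ⟨f, h⟩ else u ⟨f, h⟩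

lemma combine_inner {I : Finset ℂ → Prop} (u : {f : T.Flag // ¬ I f.edge} → S)
    (w : {f : T.Flag // I f.edge} → S) {f : T.Flag} (h : I f.edge) :
    combine I u w f = w ⟨f, h⟩ := dif_pos h

lemma combine_outer {I : Finset ℂ → Prop} (u : {f : T.Flag // ¬ I f.edge} → S)
    (w : {f : T.Flag // I f.edge} → S) {f : T.Flag} (h : ¬ I f.edge) :
    combine I u w f = u ⟨f, h⟩ := dif_neg h

open scoped Classical in
/-- The part of a framed state sum with the triangles in `K` and the edges in `I`. -/
def localSum (D : Data k S) (Φ : T.Flag → ℝ) (I K : Finset ℂ → Prop)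
    (u : {f : T.Flag // ¬ I f.edge} → S) : k :=
  ∑ w : {f : T.Flag // I f.edge} → S,
    (∏ p ∈ sortedTriples Φ with K p.1.tri,
      D.C (combine I u w p.1) (combine I u w p.2.1) (combine I u w p.2.2)) *
    ∏ p ∈ sortedPairs Φ with I p.1.edge,
      D.turn ⌊(Φ p.1 - Φ p.2) / Real.pi⌋ (combine I u w p.1) (combine I u w p.2)

open scoped Classical in
/-- The part of a framed state sum with the triangles outside of `K` and the edges outside
of `I`. -/
def outerProd (D : Data k S) (Φ : T.Flag → ℝ) (Q : T.Flag → S → k) (I K : Finset ℂ → Prop)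
    (u : {f : T.Flag // ¬ I f.edge} → S) : k :=
  (∏ p : {f : T.Flag // ¬ I f.edge} × {f : T.Flag // ¬ I f.edge} × {f : T.Flag // ¬ I f.edge}
    with (p.1.1, p.2.1.1, p.2.2.1) ∈ sortedTriples Φ ∧ ¬ K p.1.1.tri,
      D.C (u p.1) (u p.2.1) (u p.2.2)) *
  ((∏ p : {f : T.Flag // ¬ I f.edge} × {f : T.Flag // ¬ I f.edge}
    with (p.1.1, p.2.1) ∈ sortedPairs Φ,
      D.turn ⌊(Φ p.1.1 - Φ p.2.1) / Real.pi⌋ (u p.1) (u p.2)) *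
    ∏ f : {f : T.Flag // ¬ I f.edge}, if f.1.IsBoundary then Q f.1 (u f) else 1)

open scoped Classical in
-- The states at inner edges enter only the triangles in `K` and the pairs in `I`, so they can be
-- summed first. The other factors are indexed by outer flags alone, which lets them be transported
-- to another triangulation.
lemma framedSum_eq_sum_outerProd (Φ : T.Flag → ℝ) (Q : T.Flag → S → k) (I K : Finset ℂ → Prop)
    (hK : ∀ f : T.Flag, ¬ K f.tri → ¬ I f.edge) (hI : ∀ f : T.Flag, I f.edge → ¬ f.IsBoundary) :
    D.framedSum Φ Q = ∑ u : {f : T.Flag // ¬ I f.edge} → S,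
      D.outerProd Φ Q I K u * D.localSum Φ I K u := by
  simp only [localSum, Finset.mul_sum]
  rw [Finset.sum_comm, ← Fintype.sum_prod_type', framedSum]
  refine Fintype.sum_equiv (Equiv.piEquivPiSubtypeProd (fun f : T.Flag => I f.edge) fun _ => S) _ _ ?_
  intro z
  set u : {f : T.Flag // ¬ I f.edge} → S := fun f => z f.1
  set w : {f : T.Flag // I f.edge} → S := fun f => z f.1
  have hz : combine I u w = z := by
    funext f
    by_cases h : I f.edge
    · rw [combine_inner u w h]
    · rw [combine_outer u w h]
  change _ = D.outerProd Φ Q I K u *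
    ((∏ p ∈ sortedTriples Φ with K p.1.tri,
      D.C (combine I u w p.1) (combine I u w p.2.1) (combine I u w p.2.2)) *
    ∏ p ∈ sortedPairs Φ with I p.1.edge,
      D.turn ⌊(Φ p.1 - Φ p.2) / Real.pi⌋ (combine I u w p.1) (combine I u w p.2))
  have e1 : ∏ p ∈ sortedTriples Φ with ¬ K p.1.tri, D.C (z p.1) (z p.2.1) (z p.2.2) =
      ∏ p : {f : T.Flag // ¬ I f.edge} × {f : T.Flag // ¬ I f.edge} × {f : T.Flag // ¬ I f.edge}
        with (p.1.1, p.2.1.1, p.2.2.1) ∈ sortedTriples Φ ∧ ¬ K p.1.1.tri,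
        D.C (u p.1) (u p.2.1) (u p.2.2) := by
    symm
    refine Finset.prod_bij (fun p _ => (p.1.1, p.2.1.1, p.2.2.1)) ?_ ?_ ?_ fun _ _ => rfl
    · intro p hp
      simpa using hp
    · rintro ⟨p1, p2, p3⟩ _ ⟨q1, q2, q3⟩ _ h
      simp only [Prod.mk.injEq, Subtype.ext_iff] at h ⊢
      exact h
    · rintro ⟨p1, p2, p3⟩ hp
      obtain ⟨hp, hpK⟩ := Finset.mem_filter.1 hp
      obtain ⟨h1, h2, -, -⟩ := mem_sortedTriples.1 hp
      simp only at h1 h2 hpK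
      exact ⟨(⟨p1, hK _ hpK⟩, ⟨p2, hK _ (h1 ▸ hpK)⟩, ⟨p3, hK _ (h2 ▸ h1 ▸ hpK)⟩),
        by simpa using ⟨hp, hpK⟩, rfl⟩
  have e2 : ∏ p ∈ sortedPairs Φ with ¬ I p.1.edge,
      D.turn ⌊(Φ p.1 - Φ p.2) / Real.pi⌋ (z p.1) (z p.2) =
      ∏ p : {f : T.Flag // ¬ I f.edge} × {f : T.Flag // ¬ I f.edge}
        with (p.1.1, p.2.1) ∈ sortedPairs Φ,
        D.turn ⌊(Φ p.1.1 - Φ p.2.1) / Real.pi⌋ (u p.1) (u p.2) := by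
    symm
    refine Finset.prod_bij (fun p _ => (p.1.1, p.2.1)) ?_ ?_ ?_ fun _ _ => rfl
    · intro p hp
      exact Finset.mem_filter.2 ⟨(Finset.mem_filter.1 hp).2, p.1.2⟩
    · rintro ⟨p1, p2⟩ _ ⟨q1, q2⟩ _ h
      simp only [Prod.mk.injEq, Subtype.ext_iff] at h ⊢
      exact h
    · rintro ⟨p1, p2⟩ hp
      obtain ⟨hp, hpK⟩ := Finset.mem_filter.1 hp
      obtain ⟨h1, -⟩ := mem_sortedPairs.1 hp
      simp only at h1 hpK
      exact ⟨(⟨p1, hpK⟩, ⟨p2, h1 ▸ hpK⟩), by simpa using hp, rfl⟩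
  have e3 : (∏ f : T.Flag, if f.IsBoundary then Q f (z f) else 1) =
      ∏ f : {f : T.Flag // ¬ I f.edge}, if f.1.IsBoundary then Q f.1 (u f) else 1 := by
    rw [← Fintype.prod_subtype_mul_prod_subtype (fun f : T.Flag => I f.edge)]
    rw [Finset.prod_eq_one (s := Finset.univ) (f := fun f : {f : T.Flag // I f.edge} =>
      if f.1.IsBoundary then Q f.1 (z f.1) else 1) fun f _ => if_neg (hI f.1 f.2), one_mul]
  rw [hz, outerProd, ← e1, ← e2, ← e3,
    ← Finset.prod_filter_mul_prod_filter_not (sortedTriples Φ) (fun p => K p.1.tri),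
    ← Finset.prod_filter_mul_prod_filter_not (sortedPairs Φ) (fun p => I p.1.edge)]
  ring

/-- Two triangulations that agree outside of a region, which has the same outer edges in both. -/
structure LocalChange (Φ : T.Flag → ℝ) (Φ' : T'.Flag → ℝ) (I I' K K' : Finset ℂ → Prop) {n : ℕ}
    (F : Fin n → T.Flag) (F' : Fin n → T'.Flag) : Prop where
  outer : ∀ f : T.Flag, ¬ K f.tri → ¬ I f.edge
  outer' : ∀ f : T'.Flag, ¬ K' f.tri → ¬ I' f.edge
  inner : ∀ f : T.Flag, I f.edge → ¬ f.IsBoundary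
  inner' : ∀ f : T'.Flag, I' f.edge → ¬ f.IsBoundary
  flags : ∀ f : T.Flag, (K f.tri ∧ ¬ I f.edge) ↔ ∃ i, f = F i
  flags' : ∀ f : T'.Flag, (K' f.tri ∧ ¬ I' f.edge) ↔ ∃ i, f = F' i
  inj : Function.Injective F
  inj' : Function.Injective F'
  edge_eq : ∀ i, (F i).edge = (F' i).edge
  normal_eq : ∀ i, Φ (F i) = Φ' (F' i)
  mem : ∀ t ∈ T.triangles, ¬ K t → t ∈ T'.triangles ∧ ¬ K' t
  mem' : ∀ t ∈ T'.triangles, ¬ K' t → t ∈ T.triangles ∧ ¬ K t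
  normal_eq' : ∀ (f : T.Flag) (f' : T'.Flag), ¬ K f.tri → f.tri = f'.tri → f.edge = f'.edge →
    Φ f = Φ' f'

variable {Φ : T.Flag → ℝ} {Φ' : T'.Flag → ℝ} {I I' K K' : Finset ℂ → Prop} {n : ℕ}
    {F : Fin n → T.Flag} {F' : Fin n → T'.Flag}

lemma LocalChange.F_outer (h : LocalChange Φ Φ' I I' K K' F F') (i : Fin n) : ¬ I (F i).edge :=
  ((h.flags _).2 ⟨i, rfl⟩).2

lemma LocalChange.F_outer' (h : LocalChange Φ Φ' I I' K K' F F') (i : Fin n) : ¬ I' (F' i).edge :=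
  ((h.flags' _).2 ⟨i, rfl⟩).2

/-- The bijection of the outer flags. -/
lemma LocalChange.exists_equiv (h : LocalChange Φ Φ' I I' K K' F F') :
    ∃ σ : {f : T.Flag // ¬ I f.edge} ≃ {f : T'.Flag // ¬ I' f.edge},
      (∀ f, (σ f).1.edge = f.1.edge) ∧ (∀ f, Φ' (σ f).1 = Φ f.1) ∧
      (∀ f, K' (σ f).1.tri ↔ K f.1.tri) ∧ (∀ f, ¬ K f.1.tri → (σ f).1.tri = f.1.tri) ∧
      ∀ i, σ ⟨F i, h.F_outer i⟩ = ⟨F' i, h.F_outer' i⟩ := by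
  classical
  -- An outer flag of a triangle away from the region keeps its triangle and edge; the others are
  -- the listed flags and correspond by their number.
  have hex : ∀ f : {f : T.Flag // ¬ I f.edge}, ∃ f' : {f : T'.Flag // ¬ I' f.edge},
      (¬ K f.1.tri ∧ ¬ K' f'.1.tri ∧ f.1.tri = f'.1.tri ∧ f.1.edge = f'.1.edge) ∨
      ∃ i, f.1 = F i ∧ f'.1 = F' i := by
    rintro ⟨f, hf⟩
    by_cases hK : K f.tri
    · obtain ⟨i, hi⟩ := (h.flags f).1 ⟨hK, hf⟩
      exact ⟨⟨F' i, h.F_outer' i⟩, Or.inr ⟨i, hi, rfl⟩⟩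
    · obtain ⟨h1, h2⟩ := h.mem _ f.tri_mem hK
      exact ⟨⟨⟨f.tri, f.edge, h1, f.edge_subset, f.edge_card⟩, h.outer' _ h2⟩,
        Or.inl ⟨hK, h2, rfl, rfl⟩⟩
  choose σ hσ using hex
  have hKF : ∀ i, K (F i).tri := fun i => ((h.flags _).2 ⟨i, rfl⟩).1
  have hKF' : ∀ i, K' (F' i).tri := fun i => ((h.flags' _).2 ⟨i, rfl⟩).1
  have hbij : Function.Bijective σ := by
    constructor
    · intro f g hfg
      rcases hσ f with ⟨a1, a2, a3, a4⟩ | ⟨i, a1, a2⟩ <;>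
        rcases hσ g with ⟨b1, b2, b3, b4⟩ | ⟨j, b1, b2⟩
      · exact Subtype.ext (Triangulation.Flag.ext (by rw [a3, b3, hfg]) (by rw [a4, b4, hfg]))
      · exact absurd (by rw [hfg, b2]; exact hKF' j) a2
      · exact absurd (by rw [← hfg, a2]; exact hKF' i) b2
      · have : i = j := h.inj' (by rw [← a2, ← b2, hfg])
        exact Subtype.ext (a1.trans ((congrArg F this).trans b1.symm))
    · rintro ⟨f', hf'⟩
      by_cases hK : K' f'.tri
      · obtain ⟨i, rfl⟩ := (h.flags' f').1 ⟨hK, hf'⟩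
        refine ⟨⟨F i, h.F_outer i⟩, ?_⟩
        rcases hσ ⟨F i, h.F_outer i⟩ with ⟨a1, -, -, -⟩ | ⟨j, a1, a2⟩
        · exact absurd (hKF i) a1
        · have : i = j := h.inj a1
          exact Subtype.ext (a2.trans (congrArg F' this.symm))
      · obtain ⟨h1, h2⟩ := h.mem' _ f'.tri_mem hK
        refine ⟨⟨⟨f'.tri, f'.edge, h1, f'.edge_subset, f'.edge_card⟩, h.outer _ h2⟩, ?_⟩
        rcases hσ ⟨⟨f'.tri, f'.edge, h1, f'.edge_subset, f'.edge_card⟩, h.outer _ h2⟩ with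
          ⟨-, -, a3, a4⟩ | ⟨j, a1, a2⟩
        · exact Subtype.ext (Triangulation.Flag.ext a3.symm a4.symm)
        · exact absurd (by rw [show f'.tri = (F j).tri from congrArg Flag.tri a1]; exact hKF j) h2
  refine ⟨Equiv.ofBijective σ hbij, ?_, ?_, ?_, ?_, ?_⟩
  · intro f
    rcases hσ f with ⟨a1, a2, a3, a4⟩ | ⟨i, a1, a2⟩
    · exact a4.symm
    · simp only [Equiv.ofBijective_apply]; rw [a1, a2, h.edge_eq]
  · intro f
    rcases hσ f with ⟨a1, a2, a3, a4⟩ | ⟨i, a1, a2⟩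
    · exact (h.normal_eq' _ _ a1 a3 a4).symm
    · simp only [Equiv.ofBijective_apply]; rw [a1, a2, h.normal_eq]
  · intro f
    rcases hσ f with ⟨a1, a2, a3, a4⟩ | ⟨i, a1, a2⟩
    · exact iff_of_false a2 a1
    · simp only [Equiv.ofBijective_apply]; rw [a1, a2]; exact iff_of_true (hKF' i) (hKF i)
  · intro f hf
    rcases hσ f with ⟨a1, a2, a3, a4⟩ | ⟨i, a1, a2⟩
    · exact a3.symm
    · exact absurd (by rw [a1]; exact hKF i) hf
  · intro i
    rcases hσ ⟨F i, h.F_outer i⟩ with ⟨a1, a2, a3, a4⟩ | ⟨j, a1, a2⟩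
    · exact absurd (hKF i) a1
    · have : i = j := h.inj a1
      exact Subtype.ext (a2.trans (congrArg F' this.symm))

/-- A local change of a triangulation changes the state sum as it changes the local part. -/
lemma LocalChange.framedSum_eq (h : LocalChange Φ Φ' I I' K K' F F') {Q : T.Flag → S → k}
    {Q' : T'.Flag → S → k}
    (hQ : ∀ (f : T.Flag) (f' : T'.Flag), f.IsBoundary → f'.IsBoundary → f.edge = f'.edge →
      Φ f = Φ' f' → Q f = Q' f')
    {loc loc' : (Fin n → S) → k} (hloc : ∀ u, D.localSum Φ I K u = loc fun i => u ⟨F i, h.F_outer i⟩)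
    (hloc' : ∀ u, D.localSum Φ' I' K' u = loc' fun i => u ⟨F' i, h.F_outer' i⟩)
    {c c' : k} (hc : ∀ v, c * loc v = c' * loc' v) :
    c * D.framedSum Φ Q = c' * D.framedSum Φ' Q' := by
  classical
  obtain ⟨σ, h1, h2, h3, h4, h5⟩ := h.exists_equiv
  rw [framedSum_eq_sum_outerProd Φ Q I K h.outer h.inner,
    framedSum_eq_sum_outerProd Φ' Q' I' K' h.outer' h.inner', Finset.mul_sum, Finset.mul_sum]
  refine Fintype.sum_equiv (σ.arrowCongr (Equiv.refl S)) _ _ fun u => ?_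
  have hu : ∀ f, (σ.arrowCongr (Equiv.refl S)) u (σ f) = u f := fun f => by
    simp [Equiv.arrowCongr]
  set u' := (σ.arrowCongr (Equiv.refl S)) u with hu'
  have hl : D.localSum Φ' I' K' u' = loc' fun i => u ⟨F i, h.F_outer i⟩ := by
    rw [hloc']
    congr 1
    funext i
    rw [← h5, hu]
  have htri : ∀ f g : {f : T.Flag // ¬ I f.edge}, ¬ K f.1.tri → f.1.tri = g.1.tri →
      (σ f).1.tri = (σ g).1.tri := fun f g hf hfg => by
    rw [h4 f hf, h4 g (hfg ▸ hf), hfg]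
  -- All flags at an outer edge are outer, so the bijection sees every flag that decides whether the
  -- edge is on the boundary.
  have hbd : ∀ f, (σ f).1.IsBoundary ↔ f.1.IsBoundary := by
    intro f
    constructor
    · intro hb g hg
      have hgI : ¬ I g.edge := hg ▸ f.2
      have := hb (σ ⟨g, hgI⟩).1 (by rw [h1, h1, hg])
      have := σ.injective (Subtype.ext this)
      exact congrArg Subtype.val this
    · intro hb g hg
      have hgI : ¬ I' g.edge := hg ▸ (σ f).2
      have h6 := hb (σ.symm ⟨g, hgI⟩).1 (by
        rw [← h1 (σ.symm ⟨g, hgI⟩), σ.apply_symm_apply, ← h1 f, hg])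
      have h7 : σ.symm ⟨g, hgI⟩ = f := Subtype.ext h6
      rw [← h7, σ.apply_symm_apply]
  have ho : D.outerProd Φ Q I K u = D.outerProd Φ' Q' I' K' u' := by
    rw [outerProd, outerProd]
    congr 1
    · refine Finset.prod_equiv (σ.prodCongr (σ.prodCongr σ)) ?_ ?_
      · rintro ⟨p1, p2, p3⟩
        simp only [Finset.mem_filter, Finset.mem_univ, true_and, mem_sortedTriples,
          Equiv.prodCongr_apply, Prod.map, h2, h3]
        constructor
        · rintro ⟨⟨a1, a2, a3⟩, a4⟩
          exact ⟨⟨htri _ _ a4 a1, htri _ _ (a1 ▸ a4) a2, a3⟩, a4⟩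
        · rintro ⟨⟨a1, a2, a3⟩, a4⟩
          have k2 : ¬ K p2.1.tri := fun hk => a4 ((h3 p1).1 (a1 ▸ (h3 p2).2 hk))
          have k3 : ¬ K p3.1.tri := fun hk => k2 ((h3 p2).1 (a2 ▸ (h3 p3).2 hk))
          rw [h4 _ a4, h4 _ k2] at a1
          rw [h4 _ k2, h4 _ k3] at a2
          exact ⟨⟨a1, a2, a3⟩, a4⟩
      · rintro ⟨p1, p2, p3⟩ _
        simp only [Equiv.prodCongr_apply, Prod.map, hu]
    · congr 1
      · refine Finset.prod_equiv (σ.prodCongr σ) ?_ ?_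
        · rintro ⟨p1, p2⟩
          simp only [Finset.mem_filter, Finset.mem_univ, true_and, mem_sortedPairs,
            Equiv.prodCongr_apply, Prod.map, h1, h2]
        · rintro ⟨p1, p2⟩ _
          simp only [Equiv.prodCongr_apply, Prod.map, hu, h2]
      · refine Fintype.prod_equiv σ _ _ fun f => ?_
        by_cases hb : f.1.IsBoundary
        · rw [if_pos hb, if_pos ((hbd f).2 hb), hu,
            hQ f.1 (σ f).1 hb ((hbd f).2 hb) (h1 f).symm (h2 f).symm]
        · rw [if_neg hb, if_neg (mt (hbd f).1 hb)]
  rw [ho, hl, hloc u, mul_left_comm, hc, mul_left_comm]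

/-- The state sum of a region whose outer edges are the boundary edges. -/
lemma framedSum_eq_sum_local (hK : ∀ f : T.Flag, K f.tri)
    (hI : ∀ f : T.Flag, I f.edge ↔ ¬ f.IsBoundary)
    (hF : Function.Injective F) (hcov : ∀ f : T.Flag, ¬ I f.edge ↔ ∃ i, f = F i)
    (Q : T.Flag → S → k) {loc : (Fin n → S) → k}
    (hloc : ∀ u, D.localSum Φ I K u = loc fun i => u ⟨F i, (hcov _).2 ⟨i, rfl⟩⟩) :
    D.framedSum Φ Q = ∑ v : Fin n → S, (∏ i, Q (F i) (v i)) * loc v := by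
  classical
  rw [framedSum_eq_sum_outerProd Φ Q I K (fun f h => absurd (hK f) h) fun f h => (hI f).1 h]
  have hbij : Function.Bijective
      (fun i => (⟨F i, (hcov _).2 ⟨i, rfl⟩⟩ : {f : T.Flag // ¬ I f.edge})) := by
    constructor
    · intro i j hij
      exact hF (congrArg Subtype.val hij)
    · rintro ⟨f, hf⟩
      obtain ⟨i, rfl⟩ := (hcov f).1 hf
      exact ⟨i, rfl⟩
  let e := Equiv.ofBijective _ hbij
  refine Fintype.sum_equiv (e.symm.arrowCongr (Equiv.refl S)) _ _ fun u => ?_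
  have hu : ∀ i, (e.symm.arrowCongr (Equiv.refl S)) u i = u ⟨F i, (hcov _).2 ⟨i, rfl⟩⟩ := fun i => rfl
  rw [hloc]
  congr 1
  rw [outerProd]
  have h1 : (Finset.univ.filter fun p : {f : T.Flag // ¬ I f.edge} × {f : T.Flag // ¬ I f.edge} ×
      {f : T.Flag // ¬ I f.edge} => (p.1.1, p.2.1.1, p.2.2.1) ∈ sortedTriples Φ ∧ ¬ K p.1.1.tri) = ∅ := by
    rw [Finset.filter_eq_empty_iff]
    intro p _ hp
    exact hp.2 (hK _)
  have hbd : ∀ f : {f : T.Flag // ¬ I f.edge}, f.1.IsBoundary := fun f =>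
    not_not.1 (mt (hI f.1).2 f.2)
  have h2 : (Finset.univ.filter fun p : {f : T.Flag // ¬ I f.edge} × {f : T.Flag // ¬ I f.edge} =>
      (p.1.1, p.2.1) ∈ sortedPairs Φ) = ∅ := by
    rw [Finset.filter_eq_empty_iff]
    intro p _ hp
    obtain ⟨a1, a2⟩ := mem_sortedPairs.1 hp
    simp only at a1 a2
    rw [hbd p.1 p.2.1 a1.symm] at a2
    exact lt_irrefl _ a2
  rw [h1, h2, Finset.prod_empty, Finset.prod_empty, one_mul, one_mul]
  refine (Fintype.prod_equiv e _ _ fun i => ?_).symm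
  rw [if_pos (hbd _), hu]
  rfl

/-- Invertible matrices at the boundary can be cancelled. -/
lemma eq_of_sum_boundary_eq {A : Fin n → Matrix S S k} (hA : ∀ i, IsUnit (A i))
    {loc loc' : (Fin n → S) → k}
    (h : ∀ x : Fin n → S, ∑ v : Fin n → S, (∏ i, A i (v i) (x i)) * loc v =
      ∑ v : Fin n → S, (∏ i, A i (v i) (x i)) * loc' v) : loc = loc' := by
  -- Contraction with the inverse matrices, one index at a time, recovers the amplitude from its
  -- transform.
  have key : ∀ (l : (Fin n → S) → k) (y : Fin n → S),
      ∑ x : Fin n → S, (∑ v : Fin n → S, (∏ i, A i (v i) (x i)) * l v) * ∏ i, (A i)⁻¹ (x i) (y i) =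
        l y := by
    intro l y
    simp only [Finset.sum_mul]
    rw [Finset.sum_comm]
    have : ∀ v : Fin n → S, ∑ x : Fin n → S,
        (∏ i, A i (v i) (x i)) * l v * ∏ i, (A i)⁻¹ (x i) (y i) = if v = y then l v else 0 := by
      intro v
      have h1 : ∀ x : Fin n → S, (∏ i, A i (v i) (x i)) * l v * ∏ i, (A i)⁻¹ (x i) (y i) =
          l v * ∏ i, A i (v i) (x i) * (A i)⁻¹ (x i) (y i) := by
        intro x
        rw [Finset.prod_mul_distrib]; ring
      simp only [h1]
      rw [← Finset.mul_sum]
      have h2 := Finset.prod_univ_sum (fun _ : Fin n => (Finset.univ : Finset S))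
        fun i s => A i (v i) s * (A i)⁻¹ s (y i)
      rw [Fintype.piFinset_univ] at h2
      rw [← h2]
      have h3 : ∀ i, ∑ s, A i (v i) s * (A i)⁻¹ s (y i) = if v i = y i then 1 else 0 := by
        intro i
        rw [← Matrix.mul_apply, Matrix.mul_nonsing_inv _ ((Matrix.isUnit_iff_isUnit_det _).1 (hA i)),
          Matrix.one_apply]
      simp only [h3]
      rw [Finset.prod_ite_zero]
      simp [funext_iff]
    simp [this]
  funext y
  rw [← key loc y, ← key loc' y]
  exact Finset.sum_congr rfl fun x _ => by rw [h x]

end Data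

/-! ### The algebra of the moves -/

namespace Data

variable {k : Type*} [Field k] {S : Type*} [Fintype S] [DecidableEq S] {D : Data k S}

/-- The amplitude of a quadrilateral cut along its first diagonal. -/
def quadAmp (D : Data k S) (a b c d : S) : k := ∑ x, ∑ y, D.C a b x * D.B x y * D.C y c d

/-- The amplitude of a quadrilateral cut along its second diagonal. -/
def quadAmp' (D : Data k S) (a b c d : S) : k := ∑ x, ∑ y, D.C b c x * D.B x y * D.C a y d

/-- The amplitude of a subdivided triangle. -/
def starAmp (D : Data k S) (a b c : S) : k :=
  ∑ x, ∑ y, ∑ z, ∑ x', ∑ w, ∑ v,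
    D.C a x y * D.C b z x' * D.C w v c * (D.B x' x * D.B z v * D.B y w)

/-- The bilinear form with matrix `B⁻¹`. -/
def form (D : Data k S) : (S → k) →ₗ[k] (S → k) →ₗ[k] k := Matrix.toLinearMap₂' k D.B⁻¹

lemma form_apply (x y : S → k) : D.form x y = ∑ a, ∑ b, x a * D.B⁻¹ a b * y b := by
  simp only [form, Matrix.toLinearMap₂'_apply]
  refine Finset.sum_congr rfl fun a _ => Finset.sum_congr rfl fun b _ => ?_
  simp only [smul_eq_mul]; ring

lemma mul_single (a b : S) :
    D.mul (Pi.single a 1) (Pi.single b 1) = fun c => ∑ d, D.C a b d * D.B d c := by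
  funext c
  simp [mul, Pi.single_apply]

lemma eq_sum_single (x : S → k) : x = ∑ a, x a • (Pi.single a 1 : S → k) := by
  simpa using pi_eq_sum_univ' x

lemma form_left_injective (hB : IsUnit D.B.det) {x y : S → k}
    (h : ∀ d, D.form x (Pi.single d 1) = D.form y (Pi.single d 1)) : x = y := by
  have h1 : Matrix.vecMul x D.B⁻¹ = Matrix.vecMul y D.B⁻¹ := by
    funext d
    simpa [form_apply, Matrix.vecMul, dotProduct, Pi.single_apply] using h d
  have h2 := congrArg (fun v => Matrix.vecMul v D.B) h1
  simpa [Matrix.vecMul_vecMul, Matrix.nonsing_inv_mul _ hB] using h2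

lemma form_right_injective (hB : IsUnit D.B.det) {x y : S → k}
    (h : ∀ d, D.form (Pi.single d 1) x = D.form (Pi.single d 1) y) : x = y := by
  have h1 : Matrix.mulVec D.B⁻¹ x = Matrix.mulVec D.B⁻¹ y := by
    funext d
    simpa [form_apply, Matrix.mulVec, dotProduct, Pi.single_apply] using h d
  have h2 := congrArg (fun v => Matrix.mulVec D.B v) h1
  simpa [Matrix.mulVec_mulVec, Matrix.mul_nonsing_inv _ hB] using h2

lemma form_mul_single (hB : IsUnit D.B.det) (a b c : S) :
    D.form (D.mul (Pi.single a 1) (Pi.single b 1)) (Pi.single c 1) = D.C a b c := by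
  rw [mul_single, form_apply]
  have h : ∀ d, ∑ x, D.B d x * D.B⁻¹ x c = if d = c then 1 else 0 := fun d => by
    rw [← Matrix.mul_apply, Matrix.mul_nonsing_inv _ hB, Matrix.one_apply]
  have h2 : ∀ x, ∑ y, (∑ d, D.C a b d * D.B d x) * D.B⁻¹ x y * (Pi.single c 1 : S → k) y =
      ∑ d, D.C a b d * (D.B d x * D.B⁻¹ x c) := by
    intro x
    simp [Pi.single_apply, Finset.sum_mul, mul_assoc]
  simp only [h2]
  rw [Finset.sum_comm]
  simp [← Finset.mul_sum, h]

/-- The index raised in the product is moved to the front by the relation between `C` and `B` and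
then lowered. Together with `form_mul_single` this is the invariance of the form. -/
lemma form_single_mul (hB : IsUnit D.B.det) (hD : D.IsDiagrammatic) (a b c : S) :
    D.form (Pi.single a 1) (D.mul (Pi.single b 1) (Pi.single c 1)) = D.C a b c := by
  rw [mul_single, form_apply]
  have h : ∀ d, ∑ x, D.B⁻¹ a x * D.B x d = if a = d then 1 else 0 := fun d => by
    rw [← Matrix.mul_apply, Matrix.nonsing_inv_mul _ hB, Matrix.one_apply]
  simp only [hD b c, Pi.single_apply, ite_mul, one_mul, zero_mul, Finset.sum_ite_irrel,
    Finset.sum_const_zero, Finset.sum_ite_eq', Finset.mem_univ, if_true, Finset.mul_sum]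
  rw [Finset.sum_comm]
  simp only [← mul_assoc, ← Finset.sum_mul, h]
  simp

lemma form_mul (hB : IsUnit D.B.det) (hD : D.IsDiagrammatic) (x y z : S → k) :
    D.form (D.mul x y) z = D.form x (D.mul y z) := by
  rw [eq_sum_single x, eq_sum_single y, eq_sum_single z]
  simp only [map_sum, map_smul, LinearMap.sum_apply, LinearMap.smul_apply, form_mul_single hB,
    form_single_mul hB hD]

lemma mul_single_eq_sum (a b : S) : D.mul (Pi.single a 1) (Pi.single b 1) =
    ∑ y, (∑ x, D.C a b x * D.B x y) • (Pi.single y 1 : S → k) := by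
  rw [mul_single]
  exact eq_sum_single _

lemma form_mul_mul_single (hB : IsUnit D.B.det) (a b c d : S) :
    D.form (D.mul (D.mul (Pi.single a 1) (Pi.single b 1)) (Pi.single c 1)) (Pi.single d 1) =
      D.quadAmp a b c d := by
  rw [mul_single_eq_sum, quadAmp, Finset.sum_comm]
  simp only [map_sum, map_smul, LinearMap.sum_apply, LinearMap.smul_apply, form_mul_single hB,
    smul_eq_mul, Finset.sum_mul]

lemma form_mul_single_mul (hB : IsUnit D.B.det) (a b c d : S) :
    D.form (D.mul (Pi.single a 1) (D.mul (Pi.single b 1) (Pi.single c 1))) (Pi.single d 1) =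
      D.quadAmp' a b c d := by
  rw [mul_single_eq_sum, quadAmp', Finset.sum_comm]
  simp only [map_sum, map_smul, LinearMap.sum_apply, LinearMap.smul_apply, form_mul_single hB,
    smul_eq_mul, Finset.sum_mul]

/-- Both amplitudes are a triple product paired with a fourth vector, and the pairing is
non-degenerate. -/
lemma quadAmp_eq_iff (hB : IsUnit D.B.det) : (∀ a b c d, D.quadAmp a b c d = D.quadAmp' a b c d) ↔
    ∀ x y z, D.mul (D.mul x y) z = D.mul x (D.mul y z) := by
  constructor
  · intro h x y z
    have hs : ∀ a b c : S, D.mul (D.mul (Pi.single a 1) (Pi.single b 1)) (Pi.single c 1) =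
        D.mul (Pi.single a 1) (D.mul (Pi.single b 1) (Pi.single c 1)) := fun a b c =>
      form_left_injective hB fun d => by
        rw [form_mul_mul_single hB, form_mul_single_mul hB, h]
    rw [eq_sum_single x, eq_sum_single y, eq_sum_single z]
    simp only [map_sum, map_smul, LinearMap.sum_apply, LinearMap.smul_apply, hs]
  · intro h a b c d
    rw [← form_mul_mul_single hB, ← form_mul_single_mul hB, h]

lemma beta_eq : D.beta = ∑ w, ∑ y, D.B w y • D.mul (Pi.single w 1) (Pi.single y 1) := by
  simp [beta, bTensor]

/-- Associativity and invariance rewrite ⟨ab, (zv)c⟩ as ⟨a(bz), vc⟩, whose expansion consists of the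
three triangles around the new vertex. Contracting `z`, `v` with `B` produces `β`. -/
lemma starAmp_eq (hB : IsUnit D.B.det) (hD : D.IsDiagrammatic)
    (h : ∀ x y z, D.mul (D.mul x y) z = D.mul x (D.mul y z)) (a b c : S) :
    D.starAmp a b c = D.form (D.mul (Pi.single a 1) (Pi.single b 1))
      (D.mul D.beta (Pi.single c 1)) := by
  have h1 : ∀ z v : S, D.form (D.mul (Pi.single a 1) (Pi.single b 1))
      (D.mul (D.mul (Pi.single z 1) (Pi.single v 1)) (Pi.single c 1)) =
      ∑ y, (∑ w, D.B y w * D.C w v c) * ∑ x, (∑ x', D.C b z x' * D.B x' x) * D.C a x y := by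
    intro z v
    rw [h, ← form_mul hB hD, h, mul_single_eq_sum v c]
    simp only [map_sum, map_smul, LinearMap.sum_apply, LinearMap.smul_apply, smul_eq_mul]
    refine Finset.sum_congr rfl fun y _ => ?_
    rw [mul_single_eq_sum b z, hD v c y]
    simp only [map_sum, map_smul, LinearMap.sum_apply, LinearMap.smul_apply, smul_eq_mul,
      form_mul_single hB]
  rw [beta_eq]
  simp only [map_sum, map_smul, LinearMap.sum_apply, LinearMap.smul_apply, smul_eq_mul, h1]
  simp only [starAmp, Finset.mul_sum, Finset.sum_mul]
  have e1 : ∀ f : S → S → S → S → S → S → k,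
      ∑ x, ∑ y, ∑ z, ∑ x', ∑ w, ∑ v, f x y z x' w v =
      ∑ z, ∑ v, ∑ y, ∑ x, ∑ x', ∑ w, f x y z x' w v := by
    intro f
    simp only [← Fintype.sum_prod_type']
    exact Fintype.sum_equiv
      ⟨fun p => ⟨p.2.2.1, p.2.2.2.2.2, p.2.1, p.1, p.2.2.2.1, p.2.2.2.2.1⟩,
        fun p => ⟨p.2.2.2.1, p.2.2.1, p.1, p.2.2.2.2.1, p.2.2.2.2.2, p.2.1⟩,
        fun _ => rfl, fun _ => rfl⟩ _ _ fun _ => rfl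
  rw [e1]
  refine Finset.sum_congr rfl fun z _ => Finset.sum_congr rfl fun v _ =>
    Finset.sum_congr rfl fun y _ => Finset.sum_congr rfl fun x _ =>
    Finset.sum_congr rfl fun x' _ => Finset.sum_congr rfl fun w _ => by ring

/-- The identity says that e_c and Rβ e_c pair equally with all products e_a e_b. Non-degeneracy of
`C`, and not only of the form, is what allows these products to be cancelled. -/
lemma C_eq_starAmp_iff (hN : D.Nondegenerate) (hB : IsUnit D.B.det) (hD : D.IsDiagrammatic)
    (h : ∀ x y z, D.mul (D.mul x y) z = D.mul x (D.mul y z)) :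
    (∀ a b c, D.C a b c = D.R * D.starAmp a b c) ↔ ∀ x, D.mul (D.R • D.beta) x = x := by
  have e : ∀ a b c, D.R * D.starAmp a b c = D.form (D.mul (Pi.single a 1) (Pi.single b 1))
      (D.mul (D.R • D.beta) (Pi.single c 1)) := by
    intro a b c
    rw [starAmp_eq hB hD h, LinearMap.map_smul₂, map_smul, smul_eq_mul]
  constructor
  · intro h13 x
    have hs : ∀ c : S, D.mul (D.R • D.beta) (Pi.single c 1) = (Pi.single c 1 : S → k) := by
      intro c
      rw [← sub_eq_zero]
      apply hN.2.2
      intro a b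
      have h2 : ∀ v : S → k, D.form (D.mul (Pi.single a 1) (Pi.single b 1)) v =
          ∑ c, D.C a b c * v c := by
        intro v
        conv_lhs => rw [eq_sum_single v]
        simp only [map_sum, map_smul, smul_eq_mul, form_mul_single hB, mul_comm]
      rw [← h2, map_sub, ← e, ← h13, form_mul_single hB, sub_self]
    conv_lhs => rw [eq_sum_single x]
    conv_rhs => rw [eq_sum_single x]
    rw [map_sum]
    refine Finset.sum_congr rfl fun a _ => ?_
    rw [map_smul, hs]
  · intro h1 a b c
    rw [e, h1, form_mul_single hB]

lemma isInverseTensor_form (hB : IsUnit D.B.det) : IsInverseTensor D.form D.bTensor := by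
  intro x
  funext c
  have h : ∀ d, ∑ x, D.B⁻¹ d x * D.B x c = if d = c then 1 else 0 := fun d => by
    rw [← Matrix.mul_apply, Matrix.nonsing_inv_mul _ hB, Matrix.one_apply]
  have h2 : ∀ a, D.form x (Pi.single a 1) = ∑ d, x d * D.B⁻¹ d a := by
    intro a
    rw [form_apply]
    simp [Pi.single_apply]
  simp only [bTensor, map_sum, map_smul, LinearMap.rTensor_tmul, TensorProduct.lid_tmul,
    Finset.sum_apply, Pi.smul_apply, smul_eq_mul, Pi.single_apply, h2]
  have h3 : ∀ a, ∑ b, D.B a b * ((∑ d, x d * D.B⁻¹ d a) * if c = b then 1 else 0) =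
      ∑ d, x d * (D.B⁻¹ d a * D.B a c) := by
    intro a
    simp only [mul_ite, mul_one, mul_zero, Finset.sum_ite_eq, Finset.mem_univ, if_true,
      Finset.mul_sum]
    exact Finset.sum_congr rfl fun d _ => by ring
  simp only [h3]
  rw [Finset.sum_comm]
  simp [← Finset.mul_sum, h]

/-- The data determine a special Frobenius algebra if and only if the amplitudes are invariant
under the two moves. -/
theorem determinesSpecialFrobenius_iff (hN : D.Nondegenerate) (hD : D.IsDiagrammatic) :
    D.DeterminesSpecialFrobenius ↔ (∀ a b c d, D.quadAmp a b c d = D.quadAmp' a b c d) ∧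
      ∀ a b c, D.C a b c = D.R * D.starAmp a b c := by
  have hB := isUnit_det hN
  constructor
  · rintro ⟨ε, hF, -, -⟩
    exact ⟨(quadAmp_eq_iff hB).2 hF.mul_assoc, (C_eq_starAmp_iff hN hB hD hF.mul_assoc).2 hF.one_mul⟩
  · rintro ⟨h22, h13⟩
    have hassoc := (quadAmp_eq_iff hB).1 h22
    have hone' := (C_eq_starAmp_iff hN hB hD hassoc).1 h13
    -- Invariance moves the unit to the other side: ⟨x1, y⟩ = ⟨x, 1y⟩ = ⟨x, y⟩.
    have hone : ∀ x, D.mul x (D.R • D.beta) = x := fun x =>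
      form_left_injective hB fun d => by rw [form_mul hB hD, hone']
    -- The functional is pairing with the unit, since ⟨xy, 1⟩ = ⟨x, y1⟩ = ⟨x, y⟩.
    have hε : D.mul.compr₂ (D.form.flip (D.R • D.beta)) = D.form := by
      refine LinearMap.ext₂ fun x y => ?_
      simp only [LinearMap.compr₂_apply, LinearMap.flip_apply]
      rw [form_mul hB hD, hone]
    refine ⟨D.form.flip (D.R • D.beta), ⟨inferInstance, hassoc, hone', hone, ?_⟩, ?_, ?_⟩
    · rw [hε]
      constructor
      · intro x hx
        refine form_left_injective hB fun d => ?_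
        rw [hx, map_zero, LinearMap.zero_apply]
      · intro x hx
        refine form_right_injective hB fun d => ?_
        rw [hx, map_zero]
    · rw [hε]
      exact isInverseTensor_form hB
    · refine ⟨D.bTensor, by rw [hε]; exact isInverseTensor_form hB, D.R⁻¹, inv_ne_zero hN.1, ?_⟩
      rw [smul_smul, inv_mul_cancel₀ hN.1, one_smul]
      rfl

end Data

/-! ### Framings with normals in a given interval -/

namespace Triangulation

variable {M : Set ℂ} {T : Triangulation M}

open scoped Classical in
/-- The argument in `[l, l + 2π)` of the outward normal of the edge `e` of the triangle `t`. -/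
def windowAngle (l : ℝ) (t e : Finset ℂ) : ℝ :=
  -- The value depends on the two sets only, so it is the same for a triangle common to two
  -- triangulations. The default 0 does not occur for flags, by `windowFraming_spec`.
  if h : ∃ Φ, l ≤ Φ ∧ Φ < l + 2 * Real.pi ∧ IsOutward t e Φ then h.choose else 0

/-- The framing by the arguments in `[l, l + 2π)`. -/
def windowFraming (T : Triangulation M) (l : ℝ) (f : T.Flag) : ℝ := windowAngle l f.tri f.edge

lemma windowFraming_spec (l : ℝ) (f : T.Flag) : l ≤ T.windowFraming l f ∧
    T.windowFraming l f < l + 2 * Real.pi ∧ IsOutward f.tri f.edge (T.windowFraming l f) := by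
  have hex : ∃ Φ, l ≤ Φ ∧ Φ < l + 2 * Real.pi ∧ IsOutward f.tri f.edge Φ := by
    obtain ⟨Φ, -, -, hΦ⟩ := f.exists_isOutward
    have hm := toIcoMod_mem_Ico Real.two_pi_pos l Φ
    refine ⟨_, hm.1, hm.2, ?_⟩
    have := isOutward_add_two_pi_mul hΦ (-toIcoDiv Real.two_pi_pos l Φ)
    rw [toIcoMod, zsmul_eq_mul]
    convert this using 1
    push_cast; ring
  rw [windowFraming, windowAngle, dif_pos hex]
  exact hex.choose_spec

lemma windowFraming_eq {l : ℝ} {f : T.Flag} {Φ : ℝ} (h : IsOutward f.tri f.edge Φ) (h1 : l ≤ Φ)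
    (h2 : Φ < l + 2 * Real.pi) : T.windowFraming l f = Φ := by
  obtain ⟨h1', h2', h'⟩ := windowFraming_spec l f
  obtain ⟨n, hn⟩ := f.exists_int_of_isOutward h h'
  have hπ := Real.pi_pos
  have b1 : ((n : ℤ) : ℝ) < 1 := by nlinarith
  have b2 : (-1 : ℝ) < n := by nlinarith
  have b1' : n < 1 := by exact_mod_cast b1
  have b2' : -1 < n := by exact_mod_cast b2
  obtain rfl : n = 0 := by omega
  simpa using hn

lemma isFraming_windowFraming (l : ℝ) : IsFraming (T.windowFraming l) where
  isOutward f := (windowFraming_spec l f).2.2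
  abs_sub_lt f g _ := by
    obtain ⟨h1, h2, -⟩ := windowFraming_spec l f
    obtain ⟨h3, h4, -⟩ := windowFraming_spec l g
    rw [abs_lt]
    constructor <;> linarith

/-- The vertices `x`, `y`, `w` of a triangle in counterclockwise order. -/
structure IsCcw (T : Triangulation M) (x y w : ℂ) : Prop where
  mem : ({x, y, w} : Finset ℂ) ∈ T.triangles
  pos : 0 < cross (y - x) (w - x)

variable {x y w : ℂ}

lemma insert_rotate (x y w : ℂ) : ({y, w, x} : Finset ℂ) = {x, y, w} := by
  ext; simp; tauto

lemma IsCcw.rotate (h : T.IsCcw x y w) : T.IsCcw y w x := by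
  refine ⟨insert_rotate x y w ▸ h.mem, ?_⟩
  have := h.pos
  simp only [cross, Complex.sub_re, Complex.sub_im] at this ⊢
  linarith

lemma IsCcw.ne (h : T.IsCcw x y w) : x ≠ y := by
  rintro rfl
  have := h.pos
  simp [cross] at this

/-- The edge from `x` to `y` of the triangle `x y w`. -/
def IsCcw.flag (h : T.IsCcw x y w) : T.Flag :=
  ⟨{x, y, w}, {x, y}, h.mem, by intro z; simp; tauto, Finset.card_pair h.ne⟩

lemma IsCcw.tri_rotate (h : T.IsCcw x y w) : h.rotate.flag.tri = h.flag.tri :=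
  insert_rotate x y w

lemma IsCcw.cover (h : T.IsCcw x y w) (f : T.Flag) (hf : f.tri = {x, y, w}) :
    f = h.flag ∨ f = h.rotate.flag ∨ f = h.rotate.rotate.flag := by
  rcases eq_pair_of_subset (hf ▸ f.edge_subset) f.edge_card with he | he | he
  · exact Or.inl (Triangulation.Flag.ext hf he)
  · exact Or.inr (Or.inl (Triangulation.Flag.ext (hf.trans h.tri_rotate.symm) he))
  · exact Or.inr (Or.inr (Triangulation.Flag.ext
      (hf.trans (h.tri_rotate.symm.trans h.rotate.tri_rotate.symm)) he))

lemma IsCcw.windowFraming_flag (h : T.IsCcw x y w) {l Φ : ℝ}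
    (hΦ : IsAngle Φ (-Complex.I * (y - x))) (h1 : l ≤ Φ) (h2 : Φ < l + 2 * Real.pi) :
    T.windowFraming l h.flag = Φ :=
  windowFraming_eq ((isOutward_iff h.pos).2 hΦ) h1 h2

/-- A triangle is determined by one edge and the side on which it lies. -/
lemma IsCcw.eq_of_eq (h : T.IsCcw x y w) {w' : ℂ} (h' : T.IsCcw x y w') : w = w' :=
  eq_of_same_side h.mem h'.mem h.pos h'.pos

end Triangulation

lemma mem_sortedTriples_iff {M : Set ℂ} {T : Triangulation M} {χ : T.Flag → ℝ} {f₁ f₂ f₃ : T.Flag}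
    {t : Finset ℂ} (h1 : f₁.tri = t) (h2 : f₂.tri = t) (h3 : f₃.tri = t) (h12 : χ f₁ < χ f₂)
    (h23 : χ f₂ < χ f₃) (hcov : ∀ f : T.Flag, f.tri = t → f = f₁ ∨ f = f₂ ∨ f = f₃)
    {p : T.Flag × T.Flag × T.Flag} :
    (p ∈ sortedTriples χ ∧ p.1.tri = t) ↔ p = (f₁, f₂, f₃) := by
  constructor
  · rintro ⟨hp, ht⟩
    exact eq_of_mem_sortedTriples hp h12 h23 fun f hf => hcov f (hf.trans ht)
  · rintro rfl
    exact ⟨mem_sortedTriples.2 ⟨h1.trans h2.symm, h2.trans h3.symm, h12, h23⟩, h1⟩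

lemma mem_sortedPairs_iff {M : Set ℂ} {T : Triangulation M} {χ : T.Flag → ℝ} {f₁ f₂ : T.Flag}
    {e : Finset ℂ} (h1 : f₁.edge = e) (h2 : f₂.edge = e) (h12 : χ f₁ < χ f₂)
    {p : T.Flag × T.Flag} : (p ∈ sortedPairs χ ∧ p.1.edge = e) ↔ p = (f₁, f₂) := by
  have hne : f₁ ≠ f₂ := by rintro rfl; exact lt_irrefl _ h12
  constructor
  · rintro ⟨hp, he⟩
    obtain ⟨e1, l1⟩ := mem_sortedPairs.1 hp
    obtain ⟨p1, p2⟩ := p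
    simp only at he e1 l1
    rcases Flag.eq_or_eq hne (h1.trans h2.symm) (h1.trans he.symm) with rfl | rfl <;>
      rcases Flag.eq_or_eq hne (h1.trans h2.symm) (h1.trans (he.symm.trans e1)) with rfl | rfl <;>
      first | rfl | (exfalso; linarith)
  · rintro rfl
    exact ⟨mem_sortedPairs.2 ⟨h1.trans h2.symm, h12⟩, h1⟩

lemma DualGraph.arrivalAngle_eq {M : Set ℂ} {T T' : Triangulation M} (G : DualGraph T)
    (G' : DualGraph T') {f : T.Flag} {f' : T'.Flag} (h : SameRay ℝ (G.lastDir f) (G'.lastDir f'))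
    (Φ : ℝ) : G.arrivalAngle Φ f = G'.arrivalAngle Φ f' := by
  have h0 : G.lastDir f ≠ 0 := fun h => G.lastDir_im_ne_zero f (by rw [h]; rfl)
  have h0' : G'.lastDir f' ≠ 0 := fun h => G'.lastDir_im_ne_zero f' (by rw [h]; rfl)
  obtain ⟨r, hr, hr'⟩ := h.exists_pos_left h0 h0'
  rw [DualGraph.arrivalAngle, DualGraph.arrivalAngle, ← hr', Complex.real_smul, ← mul_neg,
    mul_div_assoc, Complex.arg_real_mul _ hr]

/-! ### What a local change does to the evaluation -/

namespace Data

variable {k : Type*} [Field k] {S : Type*} [Fintype S] [DecidableEq S] {D : Data k S}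
  {M : Set ℂ} {T T' : Triangulation M} {n : ℕ} {loc loc' : (Fin n → S) → k}

/-- The triangulations `T`, `T'` differ by a local change, and `loc`, `loc'` are the state sums of
the region in which they differ. -/
def HasLocalChange (D : Data k S) (T T' : Triangulation M) (loc loc' : (Fin n → S) → k) : Prop :=
  ∃ (l : ℝ) (I I' K K' : Finset ℂ → Prop) (F : Fin n → T.Flag) (F' : Fin n → T'.Flag)
    (h : LocalChange (T.windowFraming l) (T'.windowFraming l) I I' K K' F F'),
    Function.Injective (fun i => (F i).edge) ∧
    (∀ u, D.localSum (T.windowFraming l) I K u = loc fun i => u ⟨F i, h.F_outer i⟩) ∧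
    ∀ u, D.localSum (T'.windowFraming l) I' K' u = loc' fun i => u ⟨F' i, h.F_outer' i⟩

/-- Both triangulations are framed by the same interval, and graphs that coincide near the boundary
have the same amplitudes there. -/
theorem HasLocalChange.evalGraph_eq (hB : IsUnit D.B.det) (hD : D.IsDiagrammatic)
    (h : D.HasLocalChange T T' loc loc') {G : DualGraph T} {G' : DualGraph T'}
    (hG : G.SameNearBoundary G') {c c' : k} (hc : ∀ v, c * loc v = c' * loc' v)
    (bs : Finset ℂ → S) : c * D.evalGraph G bs = c' * D.evalGraph G' bs := by
  obtain ⟨l, I, I', K, K', F, F', h, -, hloc, hloc'⟩ := h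
  rw [evalGraph_eq_framedSum hB hD G (isFraming_windowFraming l),
    evalGraph_eq_framedSum hB hD G' (isFraming_windowFraming l)]
  refine h.framedSum_eq ?_ hloc hloc' hc
  intro f f' hf hf' he hΦ
  funext s
  rw [hΦ, he, DualGraph.arrivalAngle_eq G G' (hG f f' hf hf' he).2]

/-- Without common triangles the region is the whole surface and its outer flags are the boundary
flags. The evaluation is then the local amplitude transformed by invertible matrices, which are the
same for both graphs. -/
theorem HasLocalChange.eq_of_evalGraph_eq [NeZero n] (hB : IsUnit D.B.det) (hD : D.IsDiagrammatic)
    (h : D.HasLocalChange T T' loc loc') (hT : ∀ t ∈ T.triangles, t ∉ T'.triangles)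
    {G : DualGraph T} {G' : DualGraph T'} (hG : G.SameNearBoundary G') {c c' : k}
    (hc : ∀ bs, c * D.evalGraph G bs = c' * D.evalGraph G' bs) (v : Fin n → S) :
    c * loc v = c' * loc' v := by
  classical
  obtain ⟨l, I, I', K, K', F, F', h, hinj, hloc, hloc'⟩ := h
  have hinj' : Function.Injective (fun i => (F' i).edge) := by simpa only [h.edge_eq] using hinj
  have hK : ∀ f : T.Flag, K f.tri := fun f => by
    by_contra hf
    exact hT _ f.tri_mem (h.mem _ f.tri_mem hf).1
  have hK' : ∀ f : T'.Flag, K' f.tri := fun f => by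
    by_contra hf
    exact hT _ (h.mem' _ f.tri_mem hf).1 f.tri_mem
  have hcov : ∀ f : T.Flag, ¬ I f.edge ↔ ∃ i, f = F i := fun f => by
    rw [← h.flags f]
    exact ⟨fun hf => ⟨hK f, hf⟩, fun hf => hf.2⟩
  have hcov' : ∀ f : T'.Flag, ¬ I' f.edge ↔ ∃ i, f = F' i := fun f => by
    rw [← h.flags' f]
    exact ⟨fun hf => ⟨hK' f, hf⟩, fun hf => hf.2⟩
  have hI : ∀ f : T.Flag, I f.edge ↔ ¬ f.IsBoundary := fun f => by
    refine ⟨h.inner f, fun hf => ?_⟩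
    by_contra hfI
    refine hf fun g hg => ?_
    obtain ⟨i, rfl⟩ := (hcov f).1 hfI
    obtain ⟨j, rfl⟩ := (hcov g).1 (hg ▸ hfI)
    rw [hinj hg]
  have hI' : ∀ f : T'.Flag, I' f.edge ↔ ¬ f.IsBoundary := fun f => by
    refine ⟨h.inner' f, fun hf => ?_⟩
    by_contra hfI
    refine hf fun g hg => ?_
    obtain ⟨i, rfl⟩ := (hcov' f).1 hfI
    obtain ⟨j, rfl⟩ := (hcov' g).1 (hg ▸ hfI)
    rw [hinj' hg]
  have hbd : ∀ i, (F i).IsBoundary := fun i => not_not.1 (mt (hI _).2 (h.F_outer i))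
  have hbd' : ∀ i, (F' i).IsBoundary := fun i => not_not.1 (mt (hI' _).2 (h.F_outer' i))
  set A : Fin n → Matrix S S k := fun i =>
    D.turn (halfTurns (G.arrivalAngle (T.windowFraming l (F i)) (F i))) with hA
  have e1 : ∀ bs : Finset ℂ → S, c * D.evalGraph G bs =
      ∑ v : Fin n → S, (∏ i, A i (v i) (bs (F i).edge)) * (c * loc v) := by
    intro bs
    rw [evalGraph_eq_framedSum hB hD G (isFraming_windowFraming l),
      framedSum_eq_sum_local hK hI h.inj hcov _ hloc, Finset.mul_sum]
    exact Finset.sum_congr rfl fun v _ => by rw [mul_left_comm]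
  have e2 : ∀ bs : Finset ℂ → S, c' * D.evalGraph G' bs =
      ∑ v : Fin n → S, (∏ i, A i (v i) (bs (F i).edge)) * (c' * loc' v) := by
    intro bs
    rw [evalGraph_eq_framedSum hB hD G' (isFraming_windowFraming l),
      framedSum_eq_sum_local hK' hI' h.inj' hcov' _ hloc', Finset.mul_sum]
    refine Finset.sum_congr rfl fun v _ => ?_
    rw [mul_left_comm]
    congr 1
    refine Finset.prod_congr rfl fun i _ => ?_
    rw [← h.normal_eq, ← h.edge_eq,
      ← DualGraph.arrivalAngle_eq G G' (hG _ _ (hbd i) (hbd' i) (h.edge_eq i)).2]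
  refine congrFun (eq_of_sum_boundary_eq (A := A) (loc := fun v => c * loc v)
    (loc' := fun v => c' * loc' v) (fun i => isUnit_turn hB _) fun x => ?_) v
  -- Distinct outer flags have distinct edges, so the states on them can be prescribed freely; the
  -- value on other edges does not matter.
  have := hc (Function.extend (fun i => (F i).edge) x fun _ => x 0)
  rw [e1, e2] at this
  simpa only [hinj.extend_apply] using this

end Data

/-! ### The moves as local changes -/

section Angles

variable {θ θ' : ℝ} {z z' : ℂ}

/-- A positive cross product means a positive sine of the difference, and in [-π, 2π] this leaves
only the interval (0, π). -/
lemma IsAngle.lt_of_cross_pos (h : IsAngle θ z) (h' : IsAngle θ' z') (hc : 0 < cross z z')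
    (h1 : θ - Real.pi ≤ θ') (h2 : θ' ≤ θ + 2 * Real.pi) : θ < θ' ∧ θ' < θ + Real.pi := by
  have hs := (h.sin_sub_pos h').2 hc
  constructor
  · by_contra! hle
    have := Real.sin_nonpos_of_nonpos_of_neg_pi_le (x := θ' - θ) (by linarith) (by linarith)
    linarith
  · by_contra! hle
    have := Real.sin_nonneg_of_nonneg_of_le_pi (x := θ' - θ - Real.pi) (by linarith) (by linarith)
    rw [Real.sin_sub_pi] at this
    linarith

lemma IsAngle.exists_of_cross_pos (h : IsAngle θ z) (hc : 0 < cross z z') :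
    ∃ θ', IsAngle θ' z' ∧ θ < θ' ∧ θ' < θ + Real.pi := by
  have hz' : z' ≠ 0 := by rintro rfl; simp [cross] at hc
  have h' := h.add_arg_div hz'
  have hb := Complex.abs_arg_le_pi (z' / z)
  rw [abs_le] at hb
  have hπ := Real.pi_pos
  exact ⟨_, h', h.lt_of_cross_pos h' hc (by linarith) (by linarith)⟩

lemma IsAngle.exists_of_cross_pos_of_cross_pos (h : IsAngle θ z) (h' : IsAngle θ' z')
    (hlt : θ < θ') (hlt' : θ' < θ + Real.pi) {w : ℂ} (hc : 0 < cross z w) (hc' : 0 < cross w z') :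
    ∃ φ, IsAngle φ w ∧ θ < φ ∧ φ < θ' := by
  obtain ⟨φ, hφ, h1, h2⟩ := h.exists_of_cross_pos hc
  have := hφ.lt_of_cross_pos h' hc' (by linarith) (by linarith [Real.pi_pos])
  exact ⟨φ, hφ, h1, this.1⟩

end Angles

lemma pair_ne_of_left {x y z w : ℂ} (h1 : x ≠ z) (h2 : x ≠ w) : ({x, y} : Finset ℂ) ≠ {z, w} := by
  intro h
  have : x ∈ ({z, w} : Finset ℂ) := h ▸ Finset.mem_insert_self _ _
  simp [h1, h2] at this

lemma pair_ne_of_right {x y z w : ℂ} (h1 : y ≠ z) (h2 : y ≠ w) : ({x, y} : Finset ℂ) ≠ {z, w} := by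
  rw [Finset.pair_comm]
  exact pair_ne_of_left h1 h2

lemma sum_fun_six {k S : Type*} [CommSemiring k] [Fintype S] (H : S → S → S → S → S → S → k) :
    ∑ w : Fin 6 → S, H (w 0) (w 1) (w 2) (w 3) (w 4) (w 5) =
      ∑ a, ∑ b, ∑ c, ∑ d, ∑ e, ∑ f, H a b c d e f := by
  simp only [← Fintype.sum_prod_type']
  exact Fintype.sum_equiv ⟨fun w => (w 0, w 1, w 2, w 3, w 4, w 5),
    fun p => ![p.1, p.2.1, p.2.2.1, p.2.2.2.1, p.2.2.2.2.1, p.2.2.2.2.2],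
    fun w => by funext i; fin_cases i <;> rfl, fun _ => rfl⟩ _ _ fun _ => rfl

namespace Data

variable {k : Type*} [Field k] {S : Type*} [Fintype S] [DecidableEq S] {D : Data k S}
  {M : Set ℂ} {T T' : Triangulation M}

/-- Makes a local sum explicit from lists of the inner flags, triples and pairs; `z` extends the
summed inner states by the outer states `u`. -/
lemma localSum_eq {Φ : T.Flag → ℝ} {I K : Finset ℂ → Prop} {m : ℕ} {E : Fin m → T.Flag}
    (hEinj : Function.Injective E) (hE : ∀ f : T.Flag, I f.edge ↔ ∃ i, f = E i)
    {P : Finset (T.Flag × T.Flag × T.Flag)}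
    (hP : ∀ p, (p ∈ sortedTriples Φ ∧ K p.1.tri) ↔ p ∈ P) {P' : Finset (T.Flag × T.Flag)}
    (hP' : ∀ p, (p ∈ sortedPairs Φ ∧ I p.1.edge) ↔ p ∈ P') (u : {f : T.Flag // ¬ I f.edge} → S) :
    ∃ z : (Fin m → S) → T.Flag → S, (∀ w i, z w (E i) = w i) ∧
      (∀ w f, ∀ h : ¬ I f.edge, z w f = u ⟨f, h⟩) ∧
      D.localSum Φ I K u = ∑ w : Fin m → S,
        (∏ p ∈ P, D.C (z w p.1) (z w p.2.1) (z w p.2.2)) *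
          ∏ p ∈ P', D.turn ⌊(Φ p.1 - Φ p.2) / Real.pi⌋ (z w p.1) (z w p.2) := by
  classical
  have hbij : Function.Bijective (fun i => (⟨E i, (hE _).2 ⟨i, rfl⟩⟩ : {f : T.Flag // I f.edge})) := by
    constructor
    · intro i j hij
      exact hEinj (congrArg Subtype.val hij)
    · rintro ⟨f, hf⟩
      obtain ⟨i, rfl⟩ := (hE f).1 hf
      exact ⟨i, rfl⟩
  let e := Equiv.ofBijective _ hbij
  refine ⟨fun w => combine I u fun f => w (e.symm f), ?_, fun w f h => combine_outer _ _ h, ?_⟩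
  · intro w i
    refine (combine_inner _ _ ((hE _).2 ⟨i, rfl⟩)).trans ?_
    exact congrArg w (e.symm_apply_apply i)
  · have h1 : (sortedTriples Φ).filter (fun p => K p.1.tri) = P := by
      ext p; rw [Finset.mem_filter, hP]
    have h2 : (sortedPairs Φ).filter (fun p => I p.1.edge) = P' := by
      ext p; rw [Finset.mem_filter, hP']
    rw [← h1, ← h2, localSum]
    refine Fintype.sum_equiv (e.symm.arrowCongr (Equiv.refl S)) _ _ fun w => ?_
    have : (fun f => (e.symm.arrowCongr (Equiv.refl S)) w (e.symm f)) = w := by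
      funext f
      simp [Equiv.arrowCongr]
    simp only [this]

/-- In the framings used for the moves the two normals at an inner edge are exactly π apart, so its
factor is `B` with the indices exchanged. -/
lemma turn_floor_neg_one (hB : IsUnit D.B.det) {x y : ℝ} (h : x + Real.pi = y) :
    D.turn ⌊(x - y) / Real.pi⌋ = D.B.transpose := by
  rw [show x - y = -Real.pi by linarith, neg_div, div_self Real.pi_ne_zero,
    show (-1 : ℝ) = ((-1 : ℤ) : ℝ) by norm_num, Int.floor_intCast, turn_neg_one hB]

end Data

namespace Triangulation

variable {M : Set ℂ} {T T' : Triangulation M}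

/-- The labels are chosen so that `a`, `c`, `b`, `d` run counterclockwise around the quadrilateral.
-/
lemma PachnerMove22.exists_isCcw (h : PachnerMove22 T T') : ∃ a b c d : ℂ,
    T.IsCcw a c b ∧ T.IsCcw a b d ∧ T'.IsCcw a c d ∧ T'.IsCcw c b d ∧ 0 < cross (b - a) (d - c) ∧
    T'.triangles = (T.triangles \ {{a, c, b}, {a, b, d}}) ∪ {{a, c, d}, {c, b, d}} := by
  have key : ∀ a b c d : ℂ, (openSegment ℝ a b ∩ openSegment ℝ c d).Nonempty →
      ({a, b, c} : Finset ℂ) ∈ T.triangles → ({a, b, d} : Finset ℂ) ∈ T.triangles →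
      T'.triangles = (T.triangles \ {{a, b, c}, {a, b, d}}) ∪ {{a, c, d}, {b, c, d}} →
      0 < cross (b - a) (d - c) → ∃ a b c d : ℂ,
      T.IsCcw a c b ∧ T.IsCcw a b d ∧ T'.IsCcw a c d ∧ T'.IsCcw c b d ∧ 0 < cross (b - a) (d - c) ∧
      T'.triangles = (T.triangles \ {{a, c, b}, {a, b, d}}) ∪ {{a, c, d}, {c, b, d}} := by
    rintro a b c d ⟨p, ⟨s', s, hs', hs, hss, rfl⟩, ⟨t', t, ht', ht, htt, hp⟩⟩ h1 h2 h3 hκ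
    have e1 := congrArg Complex.re hp
    have e2 := congrArg Complex.im hp
    obtain rfl : s' = 1 - s := by linarith
    obtain rfl : t' = 1 - t := by linarith
    simp only [Complex.add_re, Complex.add_im, Complex.real_smul, Complex.re_ofReal_mul,
      Complex.im_ofReal_mul] at e1 e2
    -- The diagonals cut each other in the ratios given by `s` and `t`. The doubled areas of the
    -- four triangles are `t`, `1 - t`, `s`, `1 - s` times the cross product of the diagonals.
    have p1 := mul_pos ht hκ
    have p2 := mul_pos ht' hκ
    have p3 := mul_pos hs hκ
    have p4 := mul_pos hs' hκ
    simp only [cross, Complex.sub_re, Complex.sub_im] at p1 p2 p3 p4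
    refine ⟨a, b, c, d, ⟨?_, ?_⟩, ⟨h2, ?_⟩, ⟨?_, ?_⟩, ⟨?_, ?_⟩, hκ, ?_⟩
    · rwa [show ({a, c, b} : Finset ℂ) = {a, b, c} by ext; simp; tauto]
    · refine p1.trans_eq ?_
      simp only [cross, Complex.sub_re, Complex.sub_im]
      linear_combination -(b.im - a.im) * e1 + (b.re - a.re) * e2
    · refine p2.trans_eq ?_
      simp only [cross, Complex.sub_re, Complex.sub_im]
      linear_combination (b.im - a.im) * e1 - (b.re - a.re) * e2
    · rw [h3]; exact Or.inr (Or.inl rfl)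
    · refine p3.trans_eq ?_
      simp only [cross, Complex.sub_re, Complex.sub_im]
      linear_combination -(d.im - c.im) * e1 + (d.re - c.re) * e2
    · rw [h3]; exact Or.inr (Or.inr (by rw [Finset.insert_comm]; rfl))
    · refine p4.trans_eq ?_
      simp only [cross, Complex.sub_re, Complex.sub_im]
      linear_combination (d.im - c.im) * e1 - (d.re - c.re) * e2
    · rw [h3, show ({a, c, b} : Finset ℂ) = {a, b, c} by ext; simp; tauto,
        show ({c, b, d} : Finset ℂ) = {b, c, d} by rw [Finset.insert_comm]]
  obtain ⟨a, b, c, d, hne, h1, h2, h3⟩ := h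
  have hκ : cross (b - a) (d - c) ≠ 0 := by
    -- Parallel diagonals with a common point would put `a`, `b`, `c` on a line.
    intro hκ
    obtain ⟨p, ⟨s', s, hs', hs, hss, rfl⟩, ⟨t', t, ht', ht, htt, hp⟩⟩ := hne
    have e1 := congrArg Complex.re hp
    have e2 := congrArg Complex.im hp
    obtain rfl : s' = 1 - s := by linarith
    obtain rfl : t' = 1 - t := by linarith
    simp only [Complex.add_re, Complex.add_im, Complex.real_smul, Complex.re_ofReal_mul,
      Complex.im_ofReal_mul] at e1 e2
    apply cross_ne_zero h1
    simp only [cross, Complex.sub_re, Complex.sub_im] at hκ ⊢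
    linear_combination (-t) * hκ - (b.im - a.im) * e1 + (b.re - a.re) * e2
  rcases lt_or_gt_of_ne hκ with hκ | hκ
  · refine key a b d c (by rwa [openSegment_symm ℝ d c]) h2 h1 ?_ ?_
    · rw [h3, Set.pair_comm ({a, b, c} : Finset ℂ), show ({a, c, d} : Finset ℂ) = {a, d, c} by ext; simp; tauto,
        show ({b, c, d} : Finset ℂ) = {b, d, c} by ext; simp; tauto]
    · simp only [cross, Complex.sub_re, Complex.sub_im] at hκ ⊢
      linarith
  · exact key a b c d hne h1 h2 h3 hκ

end Triangulation

namespace Data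

variable {k : Type*} [Field k] {S : Type*} [Fintype S] [DecidableEq S] {D : Data k S}
  {M : Set ℂ} {T T' : Triangulation M}

/-- The local state sum of two triangles with a common edge. -/
lemma localSum_pair (hB : IsUnit D.B.det) {Φ : T.Flag → ℝ} {t t' e : Finset ℂ} (htt : t ≠ t')
    {f₁ f₂ f₃ g₁ g₂ g₃ m m' : T.Flag} (hf : f₁.tri = t ∧ f₂.tri = t ∧ f₃.tri = t)
    (hfΦ : Φ f₁ < Φ f₂ ∧ Φ f₂ < Φ f₃)
    (hfc : ∀ f : T.Flag, f.tri = t → f = f₁ ∨ f = f₂ ∨ f = f₃)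
    (hg : g₁.tri = t' ∧ g₂.tri = t' ∧ g₃.tri = t') (hgΦ : Φ g₁ < Φ g₂ ∧ Φ g₂ < Φ g₃)
    (hgc : ∀ f : T.Flag, f.tri = t' → f = g₁ ∨ f = g₂ ∨ f = g₃)
    (hm : m.edge = e) (hm' : m'.edge = e) (hmm : Φ m' + Real.pi = Φ m)
    (u : {f : T.Flag // ¬ f.edge = e} → S) :
    ∃ z : S → S → T.Flag → S, (∀ x y, z x y m = x ∧ z x y m' = y) ∧
      (∀ x y f, ∀ h : ¬ f.edge = e, z x y f = u ⟨f, h⟩) ∧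
      D.localSum Φ (fun e' => e' = e) (fun s => s = t ∨ s = t') u =
        ∑ x, ∑ y, D.C (z x y f₁) (z x y f₂) (z x y f₃) * D.C (z x y g₁) (z x y g₂) (z x y g₃) *
          D.B x y := by
  classical
  have hlt : Φ m' < Φ m := by linarith [Real.pi_pos]
  have hne : m ≠ m' := by rintro rfl; exact lt_irrefl _ hlt
  have hinj : Function.Injective ![m, m'] := by
    intro i j h
    fin_cases i <;> fin_cases j <;> first | rfl | (exfalso; first | exact hne h | exact hne h.symm)
  obtain ⟨z, h1, h2, h3⟩ := localSum_eq (D := D) (Φ := Φ) (I := fun e' => e' = e)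
    (K := fun s => s = t ∨ s = t') hinj
    (fun f => by
      simp only [Fin.exists_fin_two, Matrix.cons_val_zero, Matrix.cons_val_one]
      constructor
      · intro h
        exact Flag.eq_or_eq hne (hm.trans hm'.symm) (hm.trans h.symm)
      · rintro (rfl | rfl)
        · exact hm
        · exact hm')
    (P := {(f₁, f₂, f₃), (g₁, g₂, g₃)})
    (fun p => by
      rw [and_or_left, mem_sortedTriples_iff hf.1 hf.2.1 hf.2.2 hfΦ.1 hfΦ.2 hfc,
        mem_sortedTriples_iff hg.1 hg.2.1 hg.2.2 hgΦ.1 hgΦ.2 hgc]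
      simp)
    (P' := {(m', m)})
    (fun p => by
      rw [mem_sortedPairs_iff hm' hm hlt]
      simp) u
  refine ⟨fun x y => z ![x, y], fun x y => ⟨h1 ![x, y] 0, h1 ![x, y] 1⟩,
    fun x y => h2 ![x, y], ?_⟩
  have hne' : (f₁, f₂, f₃) ≠ (g₁, g₂, g₃) := by
    intro h
    exact htt (hf.1.symm.trans ((congrArg (fun p => p.1.tri) h).trans hg.1))
  rw [h3, ← Fintype.sum_prod_type']
  refine Fintype.sum_equiv (κ := S × S) ⟨fun w => (w 0, w 1), fun p => ![p.1, p.2],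
    fun w => by funext i; fin_cases i <;> rfl, fun _ => rfl⟩ _ _ fun w => ?_
  have hw : ![w 0, w 1] = w := by
    funext i; fin_cases i <;> rfl
  have e0 : z w m = w 0 := h1 w 0
  have e1 : z w m' = w 1 := h1 w 1
  change _ = (fun w' => D.C (z w' f₁) (z w' f₂) (z w' f₃) * D.C (z w' g₁) (z w' g₂) (z w' g₃) *
    D.B (w 0) (w 1)) ![w 0, w 1]
  simp only [Finset.prod_pair hne', Finset.prod_singleton, hw, turn_floor_neg_one hB hmm,
    Matrix.transpose_apply, e0, e1]

/-- The 2-2 move is a local change. -/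
theorem hasLocalChange_of_pachnerMove22 (hB : IsUnit D.B.det) (h : PachnerMove22 T T') :
    D.HasLocalChange T T' (fun v : Fin 4 → S => D.quadAmp (v 0) (v 1) (v 2) (v 3))
      fun v => D.quadAmp' (v 0) (v 1) (v 2) (v 3) := by
  obtain ⟨a, b, c, d, hacb, habd, hacd, hcbd, hκ, hT'⟩ := h.exists_isCcw
  have hab : a ≠ b := habd.ne
  have hac : a ≠ c := hacb.ne
  have hcb : c ≠ b := hacb.rotate.ne
  have hbd : b ≠ d := habd.rotate.ne
  have hda : d ≠ a := habd.rotate.rotate.ne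
  have hcd : c ≠ d := hacd.rotate.ne
  -- the angles of the normals
  have hα0 : -Complex.I * (b - a) ≠ 0 := mul_ne_zero (by simp) (sub_ne_zero.2 hab.symm)
  -- With `α` and `δ` for the diagonals `ab` and `cd`, and `φ₁`, …, `φ₄` for the outer edges, the
  -- arguments satisfy δ - π < φ₁ < α < φ₂ < δ < φ₃ < α + π < φ₄ < δ + π. The interval that starts
  -- at `φ₁` therefore sorts the legs of all four triangles as in `quadAmp` and `quadAmp'`.
  obtain ⟨α, hα⟩ : ∃ α, IsAngle α (-Complex.I * (b - a)) := ⟨_, isAngle_arg hα0⟩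
  obtain ⟨δ, hδ, hαδ, hδα⟩ := hα.exists_of_cross_pos (z' := -Complex.I * (d - c))
    (by rwa [cross_rot])
  have hα' : IsAngle (α + Real.pi) (-Complex.I * (a - b)) := by
    convert hα.neg_add using 1; ring
  have hδ' : IsAngle (δ + Real.pi) (-Complex.I * (c - d)) := by
    convert hδ.neg_add using 1; ring
  have hδ'' : IsAngle (δ - Real.pi) (-Complex.I * (c - d)) := by
    convert hδ.neg_sub using 1; ring
  have q1 := hacb.pos
  have q2 := habd.pos
  have q3 := hacd.pos
  have q4 := hcbd.pos
  simp only [cross, Complex.sub_re, Complex.sub_im] at q1 q2 q3 q4 hκ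
  obtain ⟨φ₁, hφ₁, l1, l2⟩ := hδ''.exists_of_cross_pos_of_cross_pos hα (w := -Complex.I * (c - a))
    (by linarith) (by linarith)
    (by rw [cross_rot]; simp only [cross, Complex.sub_re, Complex.sub_im]; linarith)
    (by rw [cross_rot]; simp only [cross, Complex.sub_re, Complex.sub_im]; linarith)
  obtain ⟨φ₂, hφ₂, l3, l4⟩ := hα.exists_of_cross_pos_of_cross_pos hδ (w := -Complex.I * (b - c))
    (by linarith) (by linarith)
    (by rw [cross_rot]; simp only [cross, Complex.sub_re, Complex.sub_im]; linarith)
    (by rw [cross_rot]; simp only [cross, Complex.sub_re, Complex.sub_im]; linarith)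
  obtain ⟨φ₃, hφ₃, l5, l6⟩ := hδ.exists_of_cross_pos_of_cross_pos hα' (w := -Complex.I * (d - b))
    (by linarith) (by linarith)
    (by rw [cross_rot]; simp only [cross, Complex.sub_re, Complex.sub_im]; linarith)
    (by rw [cross_rot]; simp only [cross, Complex.sub_re, Complex.sub_im]; linarith)
  obtain ⟨φ₄, hφ₄, l7, l8⟩ := hα'.exists_of_cross_pos_of_cross_pos hδ' (w := -Complex.I * (a - d))
    (by linarith) (by linarith)
    (by rw [cross_rot]; simp only [cross, Complex.sub_re, Complex.sub_im]; linarith)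
    (by rw [cross_rot]; simp only [cross, Complex.sub_re, Complex.sub_im]; linarith)
  have w1 := hacb.windowFraming_flag (l := φ₁) hφ₁ (by linarith) (by linarith)
  have w2 := hacb.rotate.windowFraming_flag (l := φ₁) hφ₂ (by linarith) (by linarith)
  have w3 := hacb.rotate.rotate.windowFraming_flag (l := φ₁) hα' (by linarith) (by linarith)
  have w4 := habd.windowFraming_flag (l := φ₁) hα (by linarith) (by linarith)
  have w5 := habd.rotate.windowFraming_flag (l := φ₁) hφ₃ (by linarith) (by linarith)
  have w6 := habd.rotate.rotate.windowFraming_flag (l := φ₁) hφ₄ (by linarith) (by linarith)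
  have w1' := hacd.windowFraming_flag (l := φ₁) hφ₁ (by linarith) (by linarith)
  have w2' := hacd.rotate.windowFraming_flag (l := φ₁) hδ (by linarith) (by linarith)
  have w3' := hacd.rotate.rotate.windowFraming_flag (l := φ₁) hφ₄ (by linarith) (by linarith)
  have w4' := hcbd.windowFraming_flag (l := φ₁) hφ₂ (by linarith) (by linarith)
  have w5' := hcbd.rotate.windowFraming_flag (l := φ₁) hφ₃ (by linarith) (by linarith)
  have w6' := hcbd.rotate.rotate.windowFraming_flag (l := φ₁) hδ' (by linarith) (by linarith)
  -- the edges
  have n12 : ({a, c} : Finset ℂ) ≠ {c, b} := pair_ne_of_left hac hab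
  have n13 : ({a, c} : Finset ℂ) ≠ {b, d} := pair_ne_of_left hab hda.symm
  have n14 : ({a, c} : Finset ℂ) ≠ {d, a} := pair_ne_of_right hcd hac.symm
  have n23 : ({c, b} : Finset ℂ) ≠ {b, d} := pair_ne_of_left hcb hcd
  have n24 : ({c, b} : Finset ℂ) ≠ {d, a} := pair_ne_of_left hcd hac.symm
  have n34 : ({b, d} : Finset ℂ) ≠ {d, a} := pair_ne_of_left hbd hab.symm
  have m1 : ({a, c} : Finset ℂ) ≠ {a, b} := pair_ne_of_right hac.symm hcb
  have m2 : ({c, b} : Finset ℂ) ≠ {a, b} := pair_ne_of_left hac.symm hcb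
  have m3 : ({b, d} : Finset ℂ) ≠ {a, b} := pair_ne_of_right hda hbd.symm
  have m4 : ({d, a} : Finset ℂ) ≠ {a, b} := pair_ne_of_left hda hbd.symm
  have m1' : ({a, c} : Finset ℂ) ≠ {c, d} := pair_ne_of_left hac hda.symm
  have m2' : ({c, b} : Finset ℂ) ≠ {c, d} := pair_ne_of_right hcb.symm hbd
  have m3' : ({b, d} : Finset ℂ) ≠ {c, d} := pair_ne_of_left hcb.symm hbd
  have m4' : ({d, a} : Finset ℂ) ≠ {c, d} := pair_ne_of_right hac hda.symm
  have t1 : hacb.rotate.flag.tri = {a, c, b} := hacb.tri_rotate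
  have t2 : hacb.rotate.rotate.flag.tri = {a, c, b} := hacb.rotate.tri_rotate.trans t1
  have t3 : habd.rotate.flag.tri = {a, b, d} := habd.tri_rotate
  have t4 : habd.rotate.rotate.flag.tri = {a, b, d} := habd.rotate.tri_rotate.trans t3
  have t1' : hacd.rotate.flag.tri = {a, c, d} := hacd.tri_rotate
  have t2' : hacd.rotate.rotate.flag.tri = {a, c, d} := hacd.rotate.tri_rotate.trans t1'
  have t3' : hcbd.rotate.flag.tri = {c, b, d} := hcbd.tri_rotate
  have t4' : hcbd.rotate.rotate.flag.tri = {c, b, d} := hcbd.rotate.tri_rotate.trans t3'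
  have htt : ({a, c, b} : Finset ℂ) ≠ {a, b, d} := by
    intro h
    have : c ∈ ({a, b, d} : Finset ℂ) := h ▸ by simp
    simp [hac.symm, hcb, hcd] at this
  have htt' : ({a, c, d} : Finset ℂ) ≠ {c, b, d} := by
    intro h
    have : a ∈ ({c, b, d} : Finset ℂ) := h ▸ by simp
    simp [hac, hab, hda.symm] at this
  have em : hacb.rotate.rotate.flag.edge = {a, b} := Finset.pair_comm b a
  have em' : hcbd.rotate.rotate.flag.edge = {c, d} := Finset.pair_comm d c
  have hin : ∀ f : T.Flag, f.edge = {a, b} → f = hacb.rotate.rotate.flag ∨ f = habd.flag :=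
    fun f hf => Flag.eq_or_eq (fun h => htt (t2.symm.trans (congrArg Flag.tri h)))
      em (em.trans hf.symm)
  have hin' : ∀ f : T'.Flag, f.edge = {c, d} → f = hcbd.rotate.rotate.flag ∨ f = hacd.rotate.flag :=
    fun f hf => Flag.eq_or_eq (fun h => htt' (t1'.symm.trans ((congrArg Flag.tri h).symm.trans t4')))
      em' (em'.trans hf.symm)
  have hinj : Function.Injective fun i =>
      ((![hacb.flag, hacb.rotate.flag, habd.rotate.flag, habd.rotate.rotate.flag] :
        Fin 4 → T.Flag) i).edge := by
    refine Function.Injective.of_lt_imp_ne fun i j hij => ?_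
    fin_cases i <;> fin_cases j <;> first | exact absurd hij (by decide) | assumption
  have hinj' : Function.Injective fun i =>
      ((![hacd.flag, hcbd.flag, hcbd.rotate.flag, hacd.rotate.rotate.flag] :
        Fin 4 → T'.Flag) i).edge := by
    refine Function.Injective.of_lt_imp_ne fun i j hij => ?_
    fin_cases i <;> fin_cases j <;> first | exact absurd hij (by decide) | assumption
  have hlc : LocalChange (T.windowFraming φ₁) (T'.windowFraming φ₁) (fun e => e = {a, b})
      (fun e => e = {c, d}) (fun t => t = {a, c, b} ∨ t = {a, b, d})
      (fun t => t = {c, b, d} ∨ t = {a, c, d})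
      ![hacb.flag, hacb.rotate.flag, habd.rotate.flag, habd.rotate.rotate.flag]
      ![hacd.flag, hcbd.flag, hcbd.rotate.flag, hacd.rotate.rotate.flag] :=
    { outer := fun f hf he => by
        rcases hin f he with rfl | rfl
        · exact hf (Or.inl t2)
        · exact hf (Or.inr rfl)
      outer' := fun f hf he => by
        rcases hin' f he with rfl | rfl
        · exact hf (Or.inl t4')
        · exact hf (Or.inr t1')
      inner := fun f he hb => htt (by
        rw [← t2, hb hacb.rotate.rotate.flag (em.trans he.symm), ← hb habd.flag he.symm]; rfl)
      inner' := fun f he hb => htt' (by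
        rw [← t1', hb hacd.rotate.flag he.symm, ← hb hcbd.rotate.rotate.flag (em'.trans he.symm), t4'])
      flags := fun f => by
        constructor
        · rintro ⟨h | h, he⟩
          · rcases hacb.cover f h with rfl | rfl | rfl
            exacts [⟨0, rfl⟩, ⟨1, rfl⟩, absurd em he]
          · rcases habd.cover f h with rfl | rfl | rfl
            exacts [absurd rfl he, ⟨2, rfl⟩, ⟨3, rfl⟩]
        · rintro ⟨i, rfl⟩
          fin_cases i
          exacts [⟨Or.inl rfl, m1⟩, ⟨Or.inl t1, m2⟩, ⟨Or.inr t3, m3⟩, ⟨Or.inr t4, m4⟩]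
      flags' := fun f => by
        constructor
        · rintro ⟨h | h, he⟩
          · rcases hcbd.cover f h with rfl | rfl | rfl
            exacts [⟨1, rfl⟩, ⟨2, rfl⟩, absurd em' he]
          · rcases hacd.cover f h with rfl | rfl | rfl
            exacts [⟨0, rfl⟩, absurd rfl he, ⟨3, rfl⟩]
        · rintro ⟨i, rfl⟩
          fin_cases i
          exacts [⟨Or.inr rfl, m1'⟩, ⟨Or.inl rfl, m2'⟩, ⟨Or.inl t3', m3'⟩, ⟨Or.inr t2', m4'⟩]
      inj := fun i j hij => hinj (congrArg Flag.edge hij)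
      inj' := fun i j hij => hinj' (congrArg Flag.edge hij)
      edge_eq := fun i => by fin_cases i <;> rfl
      normal_eq := fun i => by
        fin_cases i
        · exact w1.trans w1'.symm
        · exact w2.trans w4'.symm
        · exact w5.trans w5'.symm
        · exact w6.trans w3'.symm
      mem := fun t ht hK => by
        refine ⟨by rw [hT']; exact Or.inl ⟨ht, hK⟩, ?_⟩
        -- A new triangle that already belonged to `T` would lie on the same side of an outer edge
        -- as an old one.
        rintro (rfl | rfl)
        · exact hda (hacb.rotate.eq_of_eq ⟨ht, hcbd.pos⟩).symm
        · exact hbd (hacb.eq_of_eq ⟨ht, hacd.pos⟩)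
      mem' := fun t ht hK => by
        rw [hT'] at ht
        rcases ht with ht | ht
        · exact ht
        · exact absurd (Or.symm ht) hK
      normal_eq' := fun f f' _ h1 h2 => by rw [windowFraming, windowFraming, h1, h2] }
  refine ⟨φ₁, _, _, _, _, _, _, hlc, hinj, fun u => ?_, fun u => ?_⟩
  · obtain ⟨z, z1, z2, e⟩ := localSum_pair hB (Φ := T.windowFraming φ₁) htt ⟨rfl, t1, t2⟩
      ⟨by rw [w1, w2]; linarith, by rw [w2, w3]; linarith⟩ hacb.cover ⟨rfl, t3, t4⟩
      ⟨by rw [w4, w5]; linarith, by rw [w5, w6]; linarith⟩ habd.cover em rfl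
      (by rw [w4, w3]) u
    simp only [e, quadAmp]
    refine Finset.sum_congr rfl fun x _ => Finset.sum_congr rfl fun y _ => ?_
    rw [(z1 x y).1, (z1 x y).2, z2 x y _ m1, z2 x y _ m2, z2 x y _ m3, z2 x y _ m4]
    exact mul_right_comm _ _ _
  · obtain ⟨z, z1, z2, e⟩ := localSum_pair hB (Φ := T'.windowFraming φ₁) htt'.symm ⟨rfl, t3', t4'⟩
      ⟨by rw [w4', w5']; linarith, by rw [w5', w6']; linarith⟩ hcbd.cover ⟨rfl, t1', t2'⟩
      ⟨by rw [w1', w2']; linarith, by rw [w2', w3']; linarith⟩ hacd.cover em' rfl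
      (by rw [w2', w6']) u
    simp only [e, quadAmp']
    refine Finset.sum_congr rfl fun x _ => Finset.sum_congr rfl fun y _ => ?_
    rw [(z1 x y).1, (z1 x y).2, z2 x y _ m2', z2 x y _ m3', z2 x y _ m1', z2 x y _ m4']
    exact mul_right_comm _ _ _

end Data

namespace Triangulation

variable {M : Set ℂ} {T T' : Triangulation M}

lemma cross_pos_of_mem_interior {x y w o : ℂ} (h : 0 < cross (y - x) (w - x))
    (ho : o ∈ interior (convexHull ℝ (({x, y, w} : Finset ℂ) : Set ℂ))) :
    0 < cross (y - x) (o - x) := by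
  have hyx : y - x ≠ 0 := by intro h'; simp [h', cross] at h
  have hΦ := isAngle_arg (mul_ne_zero (show -Complex.I ≠ 0 by simp) hyx)
  obtain ⟨c, h1, h2⟩ := (isOutward_iff h).2 hΦ
  obtain ⟨r, hr, e1, e2⟩ := hΦ.exists_re_im
  have hlt := height_lt_of_mem_interior (c := c) (fun z hz => by
    by_cases hze : z ∈ ({x, y} : Finset ℂ)
    · exact (h1 z hze).le
    · exact (h2 z hz hze).le) ho
  rw [← h1 x (by simp)] at hlt
  have hlt' := mul_lt_mul_of_pos_left hlt hr
  simp only [height, mul_add, mul_left_comm r, ← e1, ← e2] at hlt'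
  simp only [cross, Complex.sub_re, Complex.sub_im, Complex.mul_re, Complex.mul_im, Complex.neg_re,
    Complex.neg_im, Complex.I_re, Complex.I_im] at hlt' ⊢
  linarith

/-- A point in the interior of a triangle is not a vertex. -/
lemma notMem_of_mem_interior {t t' : Finset ℂ} {o : ℂ} (ht : t ∈ T.triangles)
    (ho : o ∈ interior (convexHull ℝ (t : Set ℂ))) (hot : o ∉ t) (ht' : t' ∈ T.triangles) : o ∉ t' := by
  intro hot'
  have hface : ({o} : Finset ℂ) ∈ T.faces :=
    T.down_closed ht'.1 (by simpa using hot') (Finset.singleton_nonempty o)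
  have := T.inter_subset_convexHull ht.1 hface ⟨interior_subset ho, subset_convexHull ℝ _ (by simp)⟩
  have hempty : ((t : Set ℂ) ∩ (({o} : Finset ℂ) : Set ℂ)) = ∅ := by
    ext z
    simp only [Finset.coe_singleton, Set.mem_inter_iff, Finset.mem_coe, Set.mem_singleton_iff,
      Set.mem_empty_iff_false, iff_false]
    rintro ⟨hz, rfl⟩
    exact hot hz
  rw [hempty, convexHull_empty] at this
  exact this

lemma PachnerMove13.exists_isCcw (h : PachnerMove13 T T') : ∃ a b c o : ℂ,
    T.IsCcw a b c ∧ T'.IsCcw a b o ∧ T'.IsCcw b c o ∧ T'.IsCcw c a o ∧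
    o ∈ interior (convexHull ℝ (({a, b, c} : Finset ℂ) : Set ℂ)) ∧
    T'.triangles = (T.triangles \ {{a, b, c}}) ∪ {{a, b, o}, {b, c, o}, {c, a, o}} := by
  have key : ∀ a b c o : ℂ, 0 < cross (b - a) (c - a) →
      o ∈ interior (convexHull ℝ (({a, b, c} : Finset ℂ) : Set ℂ)) →
      ({a, b, c} : Finset ℂ) ∈ T.triangles →
      T'.triangles = (T.triangles \ {{a, b, c}}) ∪ {{a, b, o}, {b, c, o}, {c, a, o}} →
      ∃ a b c o : ℂ, T.IsCcw a b c ∧ T'.IsCcw a b o ∧ T'.IsCcw b c o ∧ T'.IsCcw c a o ∧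
      o ∈ interior (convexHull ℝ (({a, b, c} : Finset ℂ) : Set ℂ)) ∧
      T'.triangles = (T.triangles \ {{a, b, c}}) ∪ {{a, b, o}, {b, c, o}, {c, a, o}} := by
    intro a b c o hpos ho h1 h2
    have habc : T.IsCcw a b c := ⟨h1, hpos⟩
    refine ⟨a, b, c, o, habc, ⟨?_, ?_⟩, ⟨?_, ?_⟩, ⟨?_, ?_⟩, ho, h2⟩
    · rw [h2]; exact Or.inr (Or.inl rfl)
    · exact cross_pos_of_mem_interior hpos ho
    · rw [h2]; exact Or.inr (Or.inr (Or.inl rfl))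
    · exact cross_pos_of_mem_interior habc.rotate.pos (by rwa [insert_rotate a b c])
    · rw [h2]; exact Or.inr (Or.inr (Or.inr rfl))
    · exact cross_pos_of_mem_interior habc.rotate.rotate.pos
        (by rwa [insert_rotate b c a, insert_rotate a b c])
  obtain ⟨a, b, c, o, ho, h1, h2⟩ := h
  rcases lt_or_gt_of_ne (cross_ne_zero h1) with hc | hc
  · refine key b a c o ?_ ?_ ?_ ?_
    · simp only [cross, Complex.sub_re, Complex.sub_im] at hc ⊢
      linarith
    · rw [Finset.insert_comm]; simpa using ho
    · rwa [Finset.insert_comm]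
    · rw [h2, Finset.insert_comm a b {c}, Finset.insert_comm a b {o},
        Finset.insert_comm b c, Finset.insert_comm c a,
        Set.pair_comm ({c, b, o} : Finset ℂ)]
  · exact key a b c o hc (by simpa using ho) h1 h2

end Triangulation

namespace Data

variable {k : Type*} [Field k] {S : Type*} [Fintype S] [DecidableEq S] {D : Data k S}
  {M : Set ℂ} {T T' : Triangulation M}

/-- The 1-3 move is a local change. -/
theorem hasLocalChange_of_pachnerMove13 (hB : IsUnit D.B.det) (h : PachnerMove13 T T') :
    D.HasLocalChange T T' (fun v : Fin 3 → S => D.C (v 0) (v 1) (v 2))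
      fun v => D.starAmp (v 0) (v 1) (v 2) := by
  classical
  obtain ⟨a, b, c, o, habc, habo, hbco, hcao, ho, hT'⟩ := h.exists_isCcw
  have hab : a ≠ b := habo.ne
  have hbc : b ≠ c := hbco.ne
  have hca : c ≠ a := hcao.ne
  have hbo : b ≠ o := habo.rotate.ne
  have hco : c ≠ o := hbco.rotate.ne
  have hao : a ≠ o := hcao.rotate.ne
  have hoT : ∀ t ∈ T.triangles, o ∉ t := fun t ht =>
    notMem_of_mem_interior habc.mem ho (by simp [hao.symm, hbo.symm, hco.symm]) ht
  -- the angles of the normals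
  have hφ0 : -Complex.I * (b - a) ≠ 0 := mul_ne_zero (by simp) (sub_ne_zero.2 hab.symm)
  obtain ⟨φ₁, hφ₁⟩ : ∃ φ, IsAngle φ (-Complex.I * (b - a)) := ⟨_, isAngle_arg hφ0⟩
  have q0 := habc.pos
  have q1 := habo.pos
  have q2 := hbco.pos
  have q3 := hcao.pos
  simp only [cross, Complex.sub_re, Complex.sub_im] at q0 q1 q2 q3
  obtain ⟨φ₂, hφ₂, l1, l2⟩ := hφ₁.exists_of_cross_pos (z' := -Complex.I * (c - b))
    (by rw [cross_rot]; simp only [cross, Complex.sub_re, Complex.sub_im]; linarith)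
  obtain ⟨φ₃, hφ₃, l3, l4⟩ := hφ₂.exists_of_cross_pos (z' := -Complex.I * (a - c))
    (by rw [cross_rot]; simp only [cross, Complex.sub_re, Complex.sub_im]; linarith)
  have hφ₁' := hφ₁.add_two_pi 1
  push_cast at hφ₁'
  obtain ⟨l5, l6⟩ := hφ₃.lt_of_cross_pos hφ₁'
    (by rw [cross_rot]; simp only [cross, Complex.sub_re, Complex.sub_im]; linarith)
    (by linarith) (by linarith)
  obtain ⟨X, hX, l7, l8⟩ := hφ₁.exists_of_cross_pos (z' := -Complex.I * (o - b))
    (by rw [cross_rot]; simp only [cross, Complex.sub_re, Complex.sub_im]; linarith)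
  obtain ⟨l9, -⟩ := hφ₂.lt_of_cross_pos hX
    (by rw [cross_rot]; simp only [cross, Complex.sub_re, Complex.sub_im]; linarith)
    (by linarith) (by linarith)
  obtain ⟨Z, hZ, l11, l12⟩ := hφ₂.exists_of_cross_pos (z' := -Complex.I * (o - c))
    (by rw [cross_rot]; simp only [cross, Complex.sub_re, Complex.sub_im]; linarith)
  obtain ⟨l13, -⟩ := hφ₃.lt_of_cross_pos hZ
    (by rw [cross_rot]; simp only [cross, Complex.sub_re, Complex.sub_im]; linarith)
    (by linarith) (by linarith)
  obtain ⟨Y, hY, l14, l15⟩ := hφ₁.exists_of_cross_pos (z' := -Complex.I * (o - a))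
    (by rw [cross_rot]; simp only [cross, Complex.sub_re, Complex.sub_im]; linarith)
  have hX' : IsAngle (X + Real.pi) (-Complex.I * (b - o)) := by
    convert hX.neg_add using 1; ring
  have hY' : IsAngle (Y + Real.pi) (-Complex.I * (a - o)) := by
    convert hY.neg_add using 1; ring
  have hZ' : IsAngle (Z - Real.pi) (-Complex.I * (c - o)) := by
    convert hZ.neg_sub using 1; ring
  obtain ⟨l16, -⟩ := hY'.lt_of_cross_pos hφ₃
    (by rw [cross_rot]; simp only [cross, Complex.sub_re, Complex.sub_im]; linarith)
    (by linarith) (by linarith)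
  -- In the interval that starts at `φ₁` the three new triangles are sorted as φ₁ < X < Y + π, φ₂ <
  -- Z < X + π and Y < Z - π < φ₃. So the outer leg comes first in two of them and last in the
  -- third, which explains the shape of `starAmp`.
  have w1 := habc.windowFraming_flag (l := φ₁) hφ₁ (by linarith) (by linarith)
  have w2 := habc.rotate.windowFraming_flag (l := φ₁) hφ₂ (by linarith) (by linarith)
  have w3 := habc.rotate.rotate.windowFraming_flag (l := φ₁) hφ₃ (by linarith) (by linarith)
  have wab := habo.windowFraming_flag (l := φ₁) hφ₁ (by linarith) (by linarith)
  have wbo := habo.rotate.windowFraming_flag (l := φ₁) hX (by linarith) (by linarith)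
  have woa := habo.rotate.rotate.windowFraming_flag (l := φ₁) hY' (by linarith) (by linarith)
  have wbc := hbco.windowFraming_flag (l := φ₁) hφ₂ (by linarith) (by linarith)
  have wco := hbco.rotate.windowFraming_flag (l := φ₁) hZ (by linarith) (by linarith)
  have wob := hbco.rotate.rotate.windowFraming_flag (l := φ₁) hX' (by linarith) (by linarith)
  have wca := hcao.windowFraming_flag (l := φ₁) hφ₃ (by linarith) (by linarith)
  have wao := hcao.rotate.windowFraming_flag (l := φ₁) hY (by linarith) (by linarith)
  have woc := hcao.rotate.rotate.windowFraming_flag (l := φ₁) hZ' (by linarith) (by linarith)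
  -- the flags
  have s0 : habc.flag.tri = {a, b, c} := rfl
  have tab : habo.flag.tri = {a, b, o} := rfl
  have tbc : hbco.flag.tri = {b, c, o} := rfl
  have tca : hcao.flag.tri = {c, a, o} := rfl
  have s1 : habc.rotate.flag.tri = {a, b, c} := habc.tri_rotate
  have s2 : habc.rotate.rotate.flag.tri = {a, b, c} := habc.rotate.tri_rotate.trans s1
  have tbo : habo.rotate.flag.tri = {a, b, o} := habo.tri_rotate
  have toa : habo.rotate.rotate.flag.tri = {a, b, o} := habo.rotate.tri_rotate.trans tbo
  have tco : hbco.rotate.flag.tri = {b, c, o} := hbco.tri_rotate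
  have tob : hbco.rotate.rotate.flag.tri = {b, c, o} := hbco.rotate.tri_rotate.trans tco
  have tao : hcao.rotate.flag.tri = {c, a, o} := hcao.tri_rotate
  have toc : hcao.rotate.rotate.flag.tri = {c, a, o} := hcao.rotate.tri_rotate.trans tao
  have n12 : ({a, b, o} : Finset ℂ) ≠ {b, c, o} := by
    intro h
    have : a ∈ ({b, c, o} : Finset ℂ) := h ▸ by simp
    simp [hab, hca.symm, hao] at this
  have n13 : ({a, b, o} : Finset ℂ) ≠ {c, a, o} := by
    intro h
    have : b ∈ ({c, a, o} : Finset ℂ) := h ▸ by simp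
    simp [hab.symm, hbc, hbo] at this
  have n23 : ({b, c, o} : Finset ℂ) ≠ {c, a, o} := by
    intro h
    have : b ∈ ({c, a, o} : Finset ℂ) := h ▸ by simp
    simp [hab.symm, hbc, hbo] at this
  have tne : ∀ {f g : T'.Flag} {t t' : Finset ℂ}, f.tri = t → g.tri = t' → t ≠ t' → f ≠ g := by
    rintro f _ t t' h1 h2 h3 rfl
    exact h3 (h1.symm.trans h2)
  have d01 : habo.rotate.flag ≠ habo.rotate.rotate.flag := fun h => by
    rw [h, woa] at wbo; linarith
  have d23 : hbco.rotate.flag ≠ hbco.rotate.rotate.flag := fun h => by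
    rw [h, wob] at wco; linarith
  have d45 : hcao.rotate.flag ≠ hcao.rotate.rotate.flag := fun h => by
    rw [h, woc] at wao; linarith
  have d02 := tne tbo tco n12
  have d03 := tne tbo tob n12
  have d04 := tne tbo tao n13
  have d05 := tne tbo toc n13
  have d12 := tne toa tco n12
  have d13 := tne toa tob n12
  have d14 := tne toa tao n13
  have d15 := tne toa toc n13
  have d24 := tne tco tao n23
  have d25 := tne tco toc n23
  have d34 := tne tob tao n23
  have d35 := tne tob toc n23
  have hK' : ∀ f : T'.Flag, ¬ (f.tri = {a, b, o} ∨ f.tri = {b, c, o} ∨ f.tri = {c, a, o}) →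
      o ∉ f.edge := by
    intro f hf hof
    have := f.tri_mem
    rw [hT'] at this
    rcases this with h1 | h1
    · exact hoT _ h1.1 (f.edge_subset hof)
    · exact hf h1
  have nab : o ∉ habo.flag.edge := by
    change o ∉ ({a, b} : Finset ℂ); simp [hao.symm, hbo.symm]
  have nbc : o ∉ hbco.flag.edge := by
    change o ∉ ({b, c} : Finset ℂ); simp [hco.symm, hbo.symm]
  have nca : o ∉ hcao.flag.edge := by
    change o ∉ ({c, a} : Finset ℂ); simp [hao.symm, hco.symm]
  have ebo : habo.rotate.flag.edge = {b, o} := rfl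
  have eob : hbco.rotate.rotate.flag.edge = {b, o} := Finset.pair_comm o b
  have eco : hbco.rotate.flag.edge = {c, o} := rfl
  have eoc : hcao.rotate.rotate.flag.edge = {c, o} := Finset.pair_comm o c
  have eao : hcao.rotate.flag.edge = {a, o} := rfl
  have eoa : habo.rotate.rotate.flag.edge = {a, o} := Finset.pair_comm o a
  set E : Fin 6 → T'.Flag := ![habo.rotate.flag, habo.rotate.rotate.flag, hbco.rotate.flag,
    hbco.rotate.rotate.flag, hcao.rotate.flag, hcao.rotate.rotate.flag] with hEdef
  have hEinj : Function.Injective E := by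
    refine Function.Injective.of_lt_imp_ne fun i j hij => ?_
    fin_cases i <;> fin_cases j <;> first | exact absurd hij (by decide) | assumption
  have hE : ∀ f : T'.Flag, o ∈ f.edge → ∃ i, f = E i := by
    intro f hof
    by_cases hf : f.tri = {a, b, o} ∨ f.tri = {b, c, o} ∨ f.tri = {c, a, o}
    · rcases hf with hf | hf | hf
      · rcases habo.cover f hf with rfl | rfl | rfl
        exacts [absurd hof nab, ⟨0, rfl⟩, ⟨1, rfl⟩]
      · rcases hbco.cover f hf with rfl | rfl | rfl
        exacts [absurd hof nbc, ⟨2, rfl⟩, ⟨3, rfl⟩]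
      · rcases hcao.cover f hf with rfl | rfl | rfl
        exacts [absurd hof nca, ⟨4, rfl⟩, ⟨5, rfl⟩]
    · exact absurd hof (hK' f hf)
  have hedge : ∀ f : T'.Flag, o ∈ f.edge ↔ f.edge = {b, o} ∨ f.edge = {c, o} ∨ f.edge = {a, o} := by
    intro f
    constructor
    · intro hof
      obtain ⟨i, rfl⟩ := hE f hof
      fin_cases i
      exacts [Or.inl ebo, Or.inr (Or.inr eoa), Or.inr (Or.inl eco), Or.inl eob, Or.inr (Or.inr eao),
        Or.inr (Or.inl eoc)]
    · rintro (h | h | h) <;> simp [h]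
  have hE' : ∀ f : T'.Flag, o ∈ f.edge ↔ ∃ i, f = E i := by
    refine fun f => ⟨hE f, ?_⟩
    rintro ⟨i, rfl⟩
    rw [hedge]
    fin_cases i
    exacts [Or.inl ebo, Or.inr (Or.inr eoa), Or.inr (Or.inl eco), Or.inl eob, Or.inr (Or.inr eao),
      Or.inr (Or.inl eoc)]
  have hinj : Function.Injective fun i =>
      ((![habc.flag, habc.rotate.flag, habc.rotate.rotate.flag] : Fin 3 → T.Flag) i).edge := by
    have n1 : ({a, b} : Finset ℂ) ≠ {b, c} := pair_ne_of_left hab hca.symm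
    have n2 : ({a, b} : Finset ℂ) ≠ {c, a} := pair_ne_of_right hbc hab.symm
    have n3 : ({b, c} : Finset ℂ) ≠ {c, a} := pair_ne_of_left hbc hab.symm
    refine Function.Injective.of_lt_imp_ne fun i j hij => ?_
    fin_cases i <;> fin_cases j <;> first | exact absurd hij (by decide) | assumption
  have hlc : LocalChange (T.windowFraming φ₁) (T'.windowFraming φ₁) (fun _ => False)
      (fun e => o ∈ e) (fun t => t = {a, b, c})
      (fun t => t = {a, b, o} ∨ t = {b, c, o} ∨ t = {c, a, o})
      ![habc.flag, habc.rotate.flag, habc.rotate.rotate.flag]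
      ![habo.flag, hbco.flag, hcao.flag] :=
    { outer := fun f _ h => h
      outer' := hK'
      inner := fun f h => h.elim
      inner' := fun f hof hb => by
        rcases (hedge f).1 hof with h | h | h
        · exact d03 ((hb _ (ebo.trans h.symm)).trans (hb _ (eob.trans h.symm)).symm)
        · exact d25 ((hb _ (eco.trans h.symm)).trans (hb _ (eoc.trans h.symm)).symm)
        · exact d14 ((hb _ (eoa.trans h.symm)).trans (hb _ (eao.trans h.symm)).symm)
      flags := fun f => by
        constructor
        · rintro ⟨h, -⟩
          rcases habc.cover f h with rfl | rfl | rfl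
          exacts [⟨0, rfl⟩, ⟨1, rfl⟩, ⟨2, rfl⟩]
        · rintro ⟨i, rfl⟩
          fin_cases i
          exacts [⟨rfl, id⟩, ⟨s1, id⟩, ⟨s2, id⟩]
      flags' := fun f => by
        constructor
        · rintro ⟨h | h | h, he⟩
          · rcases habo.cover f h with rfl | rfl | rfl
            exacts [⟨0, rfl⟩, absurd ((hE' _).2 ⟨0, rfl⟩) he, absurd ((hE' _).2 ⟨1, rfl⟩) he]
          · rcases hbco.cover f h with rfl | rfl | rfl
            exacts [⟨1, rfl⟩, absurd ((hE' _).2 ⟨2, rfl⟩) he, absurd ((hE' _).2 ⟨3, rfl⟩) he]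
          · rcases hcao.cover f h with rfl | rfl | rfl
            exacts [⟨2, rfl⟩, absurd ((hE' _).2 ⟨4, rfl⟩) he, absurd ((hE' _).2 ⟨5, rfl⟩) he]
        · rintro ⟨i, rfl⟩
          fin_cases i
          exacts [⟨Or.inl rfl, nab⟩, ⟨Or.inr (Or.inl rfl), nbc⟩, ⟨Or.inr (Or.inr rfl), nca⟩]
      inj := fun i j hij => hinj (congrArg Flag.edge hij)
      inj' := by
        have n1 := tne (f := habo.flag) (g := hbco.flag) rfl rfl n12
        have n2 := tne (f := habo.flag) (g := hcao.flag) rfl rfl n13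
        have n3 := tne (f := hbco.flag) (g := hcao.flag) rfl rfl n23
        refine Function.Injective.of_lt_imp_ne fun i j hij => ?_
        fin_cases i <;> fin_cases j <;> first | exact absurd hij (by decide) | assumption
      edge_eq := fun i => by fin_cases i <;> rfl
      normal_eq := fun i => by
        fin_cases i
        exacts [w1.trans wab.symm, w2.trans wbc.symm, w3.trans wca.symm]
      mem := fun t ht hK => by
        refine ⟨by rw [hT']; exact Or.inl ⟨ht, hK⟩, ?_⟩
        rintro (rfl | rfl | rfl) <;> exact hoT _ ht (by simp)
      mem' := fun t ht hK => by
        rw [hT'] at ht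
        rcases ht with ht | ht
        · exact ht
        · exact absurd ht hK
      normal_eq' := fun f f' _ h1 h2 => by rw [windowFraming, windowFraming, h1, h2] }
  refine ⟨φ₁, _, _, _, _, _, _, hlc, hinj, fun u => ?_, fun u => ?_⟩
  · obtain ⟨z, -, z2, e⟩ := localSum_eq (D := D) (Φ := T.windowFraming φ₁) (I := fun _ => False)
      (K := fun t => t = {a, b, c}) (E := Fin.elim0) (fun i => i.elim0) (fun f => by simp)
      (P := {(habc.flag, habc.rotate.flag, habc.rotate.rotate.flag)}) (fun p => by
        rw [mem_sortedTriples_iff s0 s1 s2 (by rw [w1, w2]; linarith) (by rw [w2, w3]; linarith)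
          habc.cover]
        simp)
      (P' := ∅) (fun p => by simp) u
    rw [e]
    simp only [Finset.prod_singleton, Finset.prod_empty, mul_one, Fintype.sum_unique]
    rw [z2 _ _ id, z2 _ _ id, z2 _ _ id]
    rfl
  · obtain ⟨z, z1, z2, e⟩ := localSum_eq (D := D) (Φ := T'.windowFraming φ₁) (I := fun e => o ∈ e)
      (K := fun t => t = {a, b, o} ∨ t = {b, c, o} ∨ t = {c, a, o}) hEinj hE'
      (P := {(habo.flag, habo.rotate.flag, habo.rotate.rotate.flag),
        (hbco.flag, hbco.rotate.flag, hbco.rotate.rotate.flag),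
        (hcao.rotate.flag, hcao.rotate.rotate.flag, hcao.flag)}) (fun p => by
        rw [and_or_left, and_or_left, mem_sortedTriples_iff tab tbo toa (by rw [wab, wbo]; linarith)
          (by rw [wbo, woa]; linarith) habo.cover, mem_sortedTriples_iff tbc tco tob
          (by rw [wbc, wco]; linarith) (by rw [wco, wob]; linarith) hbco.cover,
          mem_sortedTriples_iff tao toc tca (by rw [wao, woc]; linarith)
          (by rw [woc, wca]; linarith) (fun f hf => by have := hcao.cover f hf; tauto)]
        simp)
      (P' := {(habo.rotate.flag, hbco.rotate.rotate.flag),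
        (hcao.rotate.rotate.flag, hbco.rotate.flag), (hcao.rotate.flag, habo.rotate.rotate.flag)})
      (fun p => by
        rw [hedge, and_or_left, and_or_left, mem_sortedPairs_iff ebo eob (by rw [wbo, wob]; linarith),
          mem_sortedPairs_iff eoc eco (by rw [woc, wco]; linarith),
          mem_sortedPairs_iff eao eoa (by rw [wao, woa]; linarith)]
        simp) u
    have p1 : (habo.flag, habo.rotate.flag, habo.rotate.rotate.flag) ∉
        ({(hbco.flag, hbco.rotate.flag, hbco.rotate.rotate.flag),
          (hcao.rotate.flag, hcao.rotate.rotate.flag, hcao.flag)} : Finset _) := by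
      simp [d02, d05]
    have p2 : (hbco.flag, hbco.rotate.flag, hbco.rotate.rotate.flag) ∉
        ({(hcao.rotate.flag, hcao.rotate.rotate.flag, hcao.flag)} : Finset _) := by
      simp [d25]
    have p3 : (habo.rotate.flag, hbco.rotate.rotate.flag) ∉
        ({(hcao.rotate.rotate.flag, hbco.rotate.flag),
          (hcao.rotate.flag, habo.rotate.rotate.flag)} : Finset _) := by
      simp [d05, d04]
    have p4 : (hcao.rotate.rotate.flag, hbco.rotate.flag) ∉
        ({(hcao.rotate.flag, habo.rotate.rotate.flag)} : Finset _) := by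
      simp [d45.symm]
    have z0 : ∀ w, z w habo.rotate.flag = w 0 := fun w => z1 w 0
    have z1' : ∀ w, z w habo.rotate.rotate.flag = w 1 := fun w => z1 w 1
    have z2' : ∀ w, z w hbco.rotate.flag = w 2 := fun w => z1 w 2
    have z3 : ∀ w, z w hbco.rotate.rotate.flag = w 3 := fun w => z1 w 3
    have z4 : ∀ w, z w hcao.rotate.flag = w 4 := fun w => z1 w 4
    have z5 : ∀ w, z w hcao.rotate.rotate.flag = w 5 := fun w => z1 w 5
    rw [e]
    simp only [Finset.prod_insert p1, Finset.prod_insert p2, Finset.prod_insert p3,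
      Finset.prod_insert p4, Finset.prod_singleton, z0, z1', z2', z3, z4, z5, z2 _ _ nab, z2 _ _ nbc,
      z2 _ _ nca, turn_floor_neg_one hB (wbo.symm ▸ wob.symm ▸ rfl :
        T'.windowFraming φ₁ habo.rotate.flag + Real.pi = T'.windowFraming φ₁ hbco.rotate.rotate.flag),
      turn_floor_neg_one hB (by rw [woc, wco]; ring : T'.windowFraming φ₁ hcao.rotate.rotate.flag +
        Real.pi = T'.windowFraming φ₁ hbco.rotate.flag),
      turn_floor_neg_one hB (by rw [wao, woa] : T'.windowFraming φ₁ hcao.rotate.flag +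
        Real.pi = T'.windowFraming φ₁ habo.rotate.rotate.flag), Matrix.transpose_apply, starAmp]
    refine Eq.trans ?_ (sum_fun_six _)
    refine Finset.sum_congr rfl fun w _ => ?_
    simp only [mul_assoc]
    rfl

end Data

/-! ### The number of interior vertices -/

namespace Triangulation

variable {M : Set ℂ} {T T' : Triangulation M}

lemma singleton_mem_faces_iff {v : ℂ} : {v} ∈ T.faces ↔ ∃ t ∈ T.triangles, v ∈ t := by
  constructor
  · intro h
    obtain ⟨t, ht, h3, hvt⟩ := T.pure _ h
    exact ⟨t, ⟨ht, h3⟩, by simpa using hvt⟩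
  · rintro ⟨t, ht, hv⟩
    exact T.down_closed ht.1 (by simpa using hv) (Finset.singleton_nonempty v)

lemma PachnerMove22.numInteriorVertices_eq (h : PachnerMove22 T T') :
    T.numInteriorVertices = T'.numInteriorVertices := by
  obtain ⟨a, b, c, d, -, h1, h2, h3⟩ := h
  have m1 : ({a, c, d} : Finset ℂ) ∈ T'.triangles := by rw [h3]; exact Or.inr (Or.inl rfl)
  have m2 : ({b, c, d} : Finset ℂ) ∈ T'.triangles := by rw [h3]; exact Or.inr (Or.inr rfl)
  have : ∀ v : ℂ, {v} ∈ T.faces ↔ {v} ∈ T'.faces := by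
    intro v
    rw [singleton_mem_faces_iff, singleton_mem_faces_iff]
    constructor
    · rintro ⟨t, ht, hv⟩
      by_cases hK : t ∈ ({{a, b, c}, {a, b, d}} : Set (Finset ℂ))
      · rcases hK with rfl | rfl <;> simp only [Finset.mem_insert, Finset.mem_singleton] at hv <;>
          rcases hv with rfl | rfl | rfl <;>
          first | (refine ⟨_, m1, ?_⟩; simp; done) | (refine ⟨_, m2, ?_⟩; simp)
      · exact ⟨t, by rw [h3]; exact Or.inl ⟨ht, hK⟩, hv⟩
    · rintro ⟨t, ht, hv⟩
      rw [h3] at ht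
      rcases ht with ht | rfl | rfl
      · exact ⟨t, ht.1, hv⟩
      all_goals
        simp only [Finset.mem_insert, Finset.mem_singleton] at hv
        rcases hv with rfl | rfl | rfl <;>
          first | (refine ⟨_, h1, ?_⟩; simp; done) | (refine ⟨_, h2, ?_⟩; simp)
  simp only [numInteriorVertices, this]

/-- Only `o` is new, and it is interior to `M` because it is interior to a triangle contained in
`M`. -/
lemma PachnerMove13.numInteriorVertices_eq (h : PachnerMove13 T T') :
    T'.numInteriorVertices = T.numInteriorVertices + 1 := by
  obtain ⟨a, b, c, o, habc, habo, hbco, hcao, ho, h3⟩ := h.exists_isCcw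
  have hoT : ¬ {o} ∈ T.faces := by
    rw [singleton_mem_faces_iff]
    rintro ⟨t, ht, hot⟩
    exact notMem_of_mem_interior habc.mem ho
      (by simp [hcao.rotate.ne.symm, habo.rotate.ne.symm, hbco.rotate.ne.symm]) ht hot
  have hoM : o ∈ interior M := by
    refine interior_mono ?_ ho
    rw [← T.space_eq]
    exact T.convexHull_subset_space habc.mem.1
  have heq : {v : ℂ | {v} ∈ T'.faces ∧ v ∈ interior M} =
      insert o {v : ℂ | {v} ∈ T.faces ∧ v ∈ interior M} := by
    ext v
    simp only [Set.mem_ofPred_eq, Set.mem_insert_iff]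
    rw [singleton_mem_faces_iff, singleton_mem_faces_iff]
    constructor
    · rintro ⟨⟨t, ht, hv⟩, hM⟩
      by_cases hvo : v = o
      · exact Or.inl hvo
      · refine Or.inr ⟨?_, hM⟩
        rw [h3] at ht
        rcases ht with ht | rfl | rfl | rfl
        · exact ⟨t, ht.1, hv⟩
        all_goals
          refine ⟨_, habc.mem, ?_⟩
          simp only [Finset.mem_insert, Finset.mem_singleton] at hv ⊢
          tauto
    · rintro (rfl | ⟨⟨t, ht, hv⟩, hM⟩)
      · exact ⟨⟨_, habo.mem, by simp⟩, hoM⟩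
      · refine ⟨?_, hM⟩
        by_cases hK : t = {a, b, c}
        · subst hK
          simp only [Finset.mem_insert, Finset.mem_singleton] at hv
          rcases hv with rfl | rfl | rfl
          exacts [⟨_, habo.mem, by simp⟩, ⟨_, habo.mem, by simp⟩, ⟨_, hbco.mem, by simp⟩]
        · exact ⟨t, by rw [h3]; exact Or.inl ⟨ht, hK⟩, hv⟩
  have hfin : {v : ℂ | {v} ∈ T.faces ∧ v ∈ interior M}.Finite := by
    refine Set.Finite.subset (T.finite.preimage (f := fun v : ℂ => ({v} : Finset ℂ)) ?_)
      fun v hv => hv.1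
    exact Finset.singleton_injective.injOn
  rw [numInteriorVertices, heq, Set.ncard_insert_of_notMem (fun h => hoT h.1) hfin]
  rfl

end Triangulation

/-- Invariance of the amplitudes implies invariance of the partition function. -/
theorem Data.isPlanar_of_amplitudes {k : Type*} [Field k] {S : Type*} [Fintype S] [DecidableEq S]
    {D : Data k S} (hB : IsUnit D.B.det) (hD : D.IsDiagrammatic)
    (h22 : ∀ a b c d, D.quadAmp a b c d = D.quadAmp' a b c d)
    (h13 : ∀ a b c, D.C a b c = D.R * D.starAmp a b c) : D.IsPlanar := by
  intro M _ T T' hT G G' hG bs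
  rcases hT with hT | hT
  · refine (hasLocalChange_of_pachnerMove22 hB hT).evalGraph_eq hB hD hG (fun v => ?_) bs
    rw [hT.numInteriorVertices_eq, h22]
  · refine (hasLocalChange_of_pachnerMove13 hB hT).evalGraph_eq hB hD hG (fun v => ?_) bs
    rw [hT.numInteriorVertices_eq, h13, pow_succ, mul_assoc]

/-! ### Triangles in the plane -/

/-- The areas of the triangles spanned by `p` and the edges add up to the whole; their ratios are
the barycentric coordinates of `p`. -/
lemma cross_sum_eq (x y w p : ℂ) :
    cross (w - y) (p - y) + cross (x - w) (p - w) + cross (y - x) (p - x) =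
      cross (y - x) (w - x) := by
  simp only [cross, Complex.sub_re, Complex.sub_im]; ring

lemma mem_convexHull_of_cross_nonneg {x y w p : ℂ} (h : 0 < cross (y - x) (w - x))
    (h1 : 0 ≤ cross (y - x) (p - x)) (h2 : 0 ≤ cross (w - y) (p - y))
    (h3 : 0 ≤ cross (x - w) (p - w)) :
    p ∈ convexHull ℝ (({x, y, w} : Finset ℂ) : Set ℂ) := by
  have hs := cross_sum_eq x y w p
  have hp : p = (cross (w - y) (p - y) / cross (y - x) (w - x)) • x +
      (cross (x - w) (p - w) / cross (y - x) (w - x)) • y +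
      (cross (y - x) (p - x) / cross (y - x) (w - x)) • w := by
    have h0 := h.ne'
    apply Complex.ext
    · simp only [Complex.add_re, Complex.smul_re, smul_eq_mul]
      field_simp
      simp only [cross, Complex.sub_re, Complex.sub_im]; ring
    · simp only [Complex.add_im, Complex.smul_im, smul_eq_mul]
      field_simp
      simp only [cross, Complex.sub_re, Complex.sub_im]; ring
  have hc := convex_convexHull ℝ (({x, y, w} : Finset ℂ) : Set ℂ)
  have := hc.sum_mem (t := Finset.univ) (w := ![cross (w - y) (p - y) / cross (y - x) (w - x),
    cross (x - w) (p - w) / cross (y - x) (w - x), cross (y - x) (p - x) / cross (y - x) (w - x)])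
    (z := ![x, y, w]) (fun i _ => by fin_cases i <;> simp <;> positivity) (by
      rw [Fin.sum_univ_three]
      simp only [Matrix.cons_val_zero, Matrix.cons_val_one, Matrix.cons_val_two, Matrix.tail_cons,
        Matrix.head_cons]
      rw [← add_div, ← add_div, hs, div_self h.ne']) (fun i _ => by
      fin_cases i <;> exact subset_convexHull ℝ _ (by simp))
  rw [Fin.sum_univ_three] at this
  rw [hp]
  exact this

lemma mem_convexHull_iff_cross {x y w p : ℂ} (h : 0 < cross (y - x) (w - x)) :
    p ∈ convexHull ℝ (({x, y, w} : Finset ℂ) : Set ℂ) ↔ 0 ≤ cross (y - x) (p - x) ∧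
      0 ≤ cross (w - y) (p - y) ∧ 0 ≤ cross (x - w) (p - w) := by
  refine ⟨fun hp => ?_, fun hp => mem_convexHull_of_cross_nonneg h hp.1 hp.2.1 hp.2.2⟩
  have hlin : ∀ u z : ℂ, Convex ℝ {p | 0 ≤ cross u (p - z)} := by
    intro u z
    have : {p | 0 ≤ cross u (p - z)} = {p | cross u z ≤ cross u p} := by
      ext p
      simp only [cross, Complex.sub_re, Complex.sub_im, Set.mem_ofPred_eq]
      constructor <;> intro h <;> linarith
    rw [this]
    exact convex_halfSpace_ge (f := fun p => cross u p)
      ⟨fun p q => by simp [cross]; ring, fun r p => by simp [cross]; ring⟩ _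
  have hs := (hlin (y - x) x).inter ((hlin (w - y) y).inter (hlin (x - w) w))
  refine convexHull_min (fun q hq => ?_) hs hp
  simp only [Finset.coe_insert, Finset.coe_singleton, Set.mem_insert_iff, Set.mem_singleton_iff] at hq
  simp only [cross, Complex.sub_re, Complex.sub_im] at h
  rcases hq with rfl | rfl | rfl <;>
    simp only [Set.mem_inter_iff, Set.mem_ofPred_eq, cross, Complex.sub_re, Complex.sub_im] <;>
    refine ⟨?_, ?_, ?_⟩ <;> nlinarith

lemma mem_interior_of_cross_pos {x y w p : ℂ} (h : 0 < cross (y - x) (w - x))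
    (h1 : 0 < cross (y - x) (p - x)) (h2 : 0 < cross (w - y) (p - y))
    (h3 : 0 < cross (x - w) (p - w)) :
    p ∈ interior (convexHull ℝ (({x, y, w} : Finset ℂ) : Set ℂ)) := by
  have hopen : ∀ u z : ℂ, IsOpen {p | 0 < cross u (p - z)} := by
    intro u z
    refine isOpen_lt continuous_const ?_
    simp only [cross, Complex.sub_re, Complex.sub_im]
    fun_prop
  refine interior_maximal (s := convexHull ℝ (({x, y, w} : Finset ℂ) : Set ℂ))
    (t := {p | 0 < cross (y - x) (p - x)} ∩ ({p | 0 < cross (w - y) (p - y)} ∩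
      {p | 0 < cross (x - w) (p - w)})) ?_ ((hopen _ _).inter ((hopen _ _).inter (hopen _ _)))
    ⟨h1, h2, h3⟩
  rintro q ⟨a1, a2, a3⟩
  exact mem_convexHull_of_cross_nonneg h (le_of_lt a1) (le_of_lt a2) (le_of_lt a3)

/-- The convex hulls of two finite sets on both sides of a line meet in a common face. -/
lemma inter_convexHull_subset_of_line {t t' : Finset ℂ} (u z : ℂ)
    (h : ∀ x ∈ t, 0 ≤ cross u (x - z)) (h' : ∀ x ∈ t', cross u (x - z) ≤ 0)
    (h0 : ∀ x ∈ t, cross u (x - z) = 0 → x ∈ t') :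
    convexHull ℝ (t : Set ℂ) ∩ convexHull ℝ (t' : Set ℂ) ⊆ convexHull ℝ ((t : Set ℂ) ∩ t') := by
  rintro p ⟨hp, hp'⟩
  have hlin : ∀ (s : Finset ℂ) (w : ℂ → ℝ), ∑ y ∈ s, w y = 1 → ∑ y ∈ s, w y • y = p →
      cross u (p - z) = ∑ y ∈ s, w y * cross u (y - z) := by
    rintro s w hw rfl
    have : ∑ y ∈ s, w y • y - z = ∑ y ∈ s, w y • (y - z) := by
      simp only [smul_sub, Finset.sum_sub_distrib, ← Finset.sum_smul, hw, one_smul]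
    rw [this]
    have hL : ∀ v, cross u v = (IsLinearMap.mk' (R := ℝ) (cross u)
      ⟨fun p q => by simp [cross]; ring, fun r p => by simp [cross]; ring⟩) v := fun _ => rfl
    rw [hL, map_sum]
    refine Finset.sum_congr rfl fun y _ => ?_
    rw [map_smul, ← hL, smul_eq_mul]
  obtain ⟨w, w0, w1, wp⟩ := Finset.mem_convexHull'.1 hp
  obtain ⟨w', w0', w1', wp'⟩ := Finset.mem_convexHull'.1 hp'
  have e := hlin t w w1 wp
  have e' := hlin t' w' w1' wp'
  -- The level of `p` relative to the line is non-negative seen from `t` and non-positive seen from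
  -- `t'`, so it is zero. Then all weight in `t` sits on the line, that is on vertices shared with
  -- `t'`.
  have hz : ∑ y ∈ t, w y * cross u (y - z) = 0 := by
    refine le_antisymm ?_ (Finset.sum_nonneg fun y hy => mul_nonneg (w0 y hy) (h y hy))
    rw [← e, e']
    exact Finset.sum_nonpos fun y hy => mul_nonpos_of_nonneg_of_nonpos (w0' y hy) (h' y hy)
  have hz' := (Finset.sum_eq_zero_iff_of_nonneg fun y hy => mul_nonneg (w0 y hy) (h y hy)).1 hz
  have hvan : ∀ y ∈ t, y ∉ t' → w y = 0 := fun y hy hyt => by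
    rcases mul_eq_zero.1 (hz' y hy) with h1 | h1
    · exact h1
    · exact absurd (h0 y hy h1) hyt
  rw [← Finset.coe_inter, Finset.mem_convexHull']
  refine ⟨w, fun y hy => w0 y (Finset.mem_inter.1 hy).1, ?_, ?_⟩
  · rw [← w1]
    refine Finset.sum_subset Finset.inter_subset_left fun y hy hyn => hvan y hy fun h => hyn ?_
    exact Finset.mem_inter.2 ⟨hy, h⟩
  · rw [← wp]
    refine Finset.sum_subset Finset.inter_subset_left fun y hy hyn => ?_
    rw [hvan y hy fun h => hyn (Finset.mem_inter.2 ⟨hy, h⟩), zero_smul]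

/-! ### Triangulations from triangles, and dual graphs with straight legs -/

namespace Triangulation

/-- The triangulation with given triangles. -/
def ofTriangles {M : Set ℂ} (s : Set (Finset ℂ)) (hs : s.Finite) (hcard : ∀ t ∈ s, t.card = 3)
    (hindep : ∀ t ∈ s, AffineIndependent ℝ ((↑) : t → ℂ))
    (hinter : ∀ t ∈ s, ∀ t' ∈ s, convexHull ℝ (t : Set ℂ) ∩ convexHull ℝ (t' : Set ℂ) ⊆
      convexHull ℝ ((t : Set ℂ) ∩ t'))
    (hM : ⋃ t ∈ s, convexHull ℝ (t : Set ℂ) = M) : Triangulation M where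
  faces := {f | f.Nonempty ∧ ∃ t ∈ s, f ⊆ t}
  isRelLowerSet_faces := by
    rintro f ⟨hf, t, ht, hft⟩
    exact ⟨hf, fun g hg hgn => ⟨hgn, t, ht, hg.trans hft⟩⟩
  indep := by
    rintro f ⟨hf, t, ht, hft⟩
    exact (hindep t ht).mono hft
  inter_subset_convexHull := by
    rintro f g ⟨hf, t, ht, hft⟩ ⟨hg, t', ht', hgt⟩ p ⟨hp, hp'⟩
    -- The intersection property for triangles suffices: subsets of one affinely independent set
    -- meet in the hull of their common vertices, and this is applied first in `t` and then in `t'`.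
    have h1 : p ∈ convexHull ℝ ((t ∩ t' : Finset ℂ) : Set ℂ) := by
      rw [Finset.coe_inter]
      exact hinter t ht t' ht' ⟨convexHull_mono hft hp, convexHull_mono hgt hp'⟩
    have h2 : p ∈ convexHull ℝ ((f ∩ (t ∩ t') : Finset ℂ) : Set ℂ) := by
      rw [Finset.coe_inter, (hindep t ht).convexHull_inter hft Finset.inter_subset_left]
      exact ⟨hp, h1⟩
    have h3 : p ∈ convexHull ℝ (((f ∩ (t ∩ t')) ∩ g : Finset ℂ) : Set ℂ) := by
      rw [Finset.coe_inter, (hindep t' ht').convexHull_inter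
        (fun x hx => (Finset.mem_inter.1 (Finset.mem_inter.1 hx).2).2) hgt]
      exact ⟨h2, hp'⟩
    refine convexHull_mono (fun x hx => ?_) h3
    simp only [Finset.coe_inter, Set.mem_inter_iff] at hx
    exact ⟨hx.1.1, hx.2⟩
  finite := by
    refine (hs.biUnion fun t _ => (t.powerset.finite_toSet)).subset ?_
    rintro f ⟨-, t, ht, hft⟩
    exact Set.mem_biUnion ht (by simpa using hft)
  pure := by
    rintro f ⟨-, t, ht, hft⟩
    exact ⟨t, ⟨Finset.card_pos.1 (by rw [hcard t ht]; norm_num), t, ht, subset_rfl⟩, hcard t ht, hft⟩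
  space_eq := by
    rw [← hM]
    apply subset_antisymm
    · intro p hp
      simp only [Geometry.SimplicialComplex.space, Set.mem_iUnion] at hp ⊢
      obtain ⟨f, ⟨-, t, ht, hft⟩, hpf⟩ := hp
      exact ⟨t, ht, convexHull_mono hft hpf⟩
    · intro p hp
      simp only [Geometry.SimplicialComplex.space, Set.mem_iUnion] at hp ⊢
      obtain ⟨t, ht, hpt⟩ := hp
      exact ⟨t, ⟨Finset.card_pos.1 (by rw [hcard t ht]; norm_num), t, ht, subset_rfl⟩, hpt⟩

lemma triangles_ofTriangles {M : Set ℂ} {s : Set (Finset ℂ)} {hs : s.Finite}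
    {hcard : ∀ t ∈ s, t.card = 3} {hindep : ∀ t ∈ s, AffineIndependent ℝ ((↑) : t → ℂ)}
    {hinter : ∀ t ∈ s, ∀ t' ∈ s, convexHull ℝ (t : Set ℂ) ∩ convexHull ℝ (t' : Set ℂ) ⊆
      convexHull ℝ ((t : Set ℂ) ∩ t')}
    {hM : ⋃ t ∈ s, convexHull ℝ (t : Set ℂ) = M} :
    (ofTriangles s hs hcard hindep hinter hM).triangles = s := by
  ext f
  constructor
  · rintro ⟨⟨-, t, ht, hft⟩, hf3⟩
    rwa [Finset.eq_of_subset_of_card_le hft (by rw [hf3, hcard t ht])]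
  · intro hf
    exact ⟨⟨Finset.card_pos.1 (by rw [hcard f hf]; norm_num), f, hf, subset_rfl⟩, hcard f hf⟩

end Triangulation

/-- The dual graph with straight legs from given points in the triangles to given points on the
edges. -/
def DualGraph.straight {M : Set ℂ} (T : Triangulation M) (P E : Finset ℂ → ℂ)
    (hP : ∀ t ∈ T.triangles, P t ∈ interior (convexHull ℝ (t : Set ℂ)))
    (hE : ∀ f : T.Flag, E f.edge ∈ convexHull ℝ (f.edge : Set ℂ) \ (f.edge : Set ℂ))
    (hPE : ∀ f : T.Flag, (P f.tri).im ≠ (E f.edge).im) : DualGraph T where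
  len _ := 1
  pt f i := if i = 0 then P f.tri else E f.edge
  len_pos _ := one_pos
  start_eq f g h := by simp [h]
  end_eq f g h := by simp [h]
  end_mem f := by simpa using hE f
  mem_interior f s hs := by
    rw [Nat.cast_one] at hs
    rw [polyline_of_mem_unit _ hs.1 hs.2.le]
    have := (convex_convexHull ℝ (f.tri : Set ℂ)).combo_interior_self_mem_interior (hP _ f.tri_mem)
      (convexHull_mono f.edge_subset (hE f).1) (sub_pos.2 hs.2) hs.1 (by ring)
    convert this using 1
    simp only [if_true, one_ne_zero, if_false, Complex.real_smul, Complex.ofReal_sub,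
      Complex.ofReal_one]
    ring
  injOn f s hs s' hs' h := by
    rw [Nat.cast_one] at hs hs'
    rw [polyline_of_mem_unit _ hs.1 hs.2, polyline_of_mem_unit _ hs'.1 hs'.2] at h
    have h' := congrArg Complex.im h
    simp only [if_true, one_ne_zero, if_false, Complex.add_im, Complex.im_ofReal_mul,
      Complex.sub_im] at h'
    have h0 : (E f.edge).im - (P f.tri).im ≠ 0 := sub_ne_zero.2 (hPE f).symm
    exact mul_right_cancel₀ h0 (add_left_cancel h')
  disjoint f g hfg hne s hs s' hs' h := by
    rw [Nat.cast_one] at hs hs'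
    rw [polyline_of_mem_unit _ hs.1 hs.2, polyline_of_mem_unit _ hs'.1 hs'.2] at h
    simp only [if_true, one_ne_zero, if_false, ← hfg, add_right_inj, ← Complex.real_smul] at h
    -- In the direction of its own normal each end is higher than the other one. If two legs had a
    -- common point other than the dual vertex, this would give `s < s'` and `s' < s`.
    have key : ∀ f g : T.Flag, f.tri = g.tri → f ≠ g → ∃ Φ,
        0 < height Φ (E f.edge - P f.tri) ∧
          height Φ (E g.edge - P f.tri) < height Φ (E f.edge - P f.tri) := by
      intro f g hfg hne
      obtain ⟨Φ, -, -, c, h1, h2⟩ := f.exists_isOutward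
      have hle : ∀ y ∈ f.tri, height Φ y ≤ c := fun y hy => by
        by_cases hye : y ∈ f.edge
        · exact (h1 y hye).le
        · exact (h2 y hy hye).le
      have e1 := height_eq_of_mem_convexHull h1 (hE f).1
      have e2 := height_lt_of_mem_interior hle (hP _ f.tri_mem)
      have e3 := height_lt_of_mem_edge h1 h2 f.edge_card g.edge_card (hfg ▸ g.edge_subset)
        (fun h => hne (Triangulation.Flag.ext hfg h.symm)) (hE g)
      refine ⟨Φ, ?_, ?_⟩
      · rw [height_sub]; linarith
      · rw [height_sub, height_sub]; linarith
    obtain ⟨Φ, a1, a2⟩ := key f g hfg hne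
    obtain ⟨Ψ, b1, b2⟩ := key g f hfg.symm hne.symm
    rw [← hfg] at b1 b2
    have e1 := congrArg (height Φ) h
    have e2 := congrArg (height Ψ) h
    rw [height_smul, height_smul] at e1 e2
    have hs0 := hs.1
    have hs0' := hs'.1
    rcases hs0.eq_or_lt with rfl | hpos
    · refine ⟨rfl, ?_⟩
      rw [zero_mul] at e2
      rcases mul_eq_zero.1 e2.symm with h | h
      · exact h
      · exact absurd h b1.ne'
    · exfalso
      have hpos' : 0 < s' := by
        rcases hs0'.eq_or_lt with rfl | h
        · rw [zero_mul] at e1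
          exact absurd e1 (mul_pos hpos a1).ne'
        · exact h
      have i1 := mul_lt_mul_of_pos_left a2 hpos'
      have i2 := mul_lt_mul_of_pos_left b2 hpos
      have l1 : s < s' := lt_of_mul_lt_mul_right (by linarith) a1.le
      have l2 : s' < s := lt_of_mul_lt_mul_right (by linarith) b1.le
      linarith
  not_horizontal f i hi := by
    obtain rfl : i = 0 := by omega
    simpa using hPE f

lemma DualGraph.sameNearBoundary_straight {M : Set ℂ} {T T' : Triangulation M} {P P' E : Finset ℂ → ℂ}
    {hP : ∀ t ∈ T.triangles, P t ∈ interior (convexHull ℝ (t : Set ℂ))}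
    {hE : ∀ f : T.Flag, E f.edge ∈ convexHull ℝ (f.edge : Set ℂ) \ (f.edge : Set ℂ)}
    {hPE : ∀ f : T.Flag, (P f.tri).im ≠ (E f.edge).im}
    {hP' : ∀ t ∈ T'.triangles, P' t ∈ interior (convexHull ℝ (t : Set ℂ))}
    {hE' : ∀ f : T'.Flag, E f.edge ∈ convexHull ℝ (f.edge : Set ℂ) \ (f.edge : Set ℂ)}
    {hPE' : ∀ f : T'.Flag, (P' f.tri).im ≠ (E f.edge).im}
    (h : ∀ (f : T.Flag) (f' : T'.Flag), f.edge = f'.edge →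
      SameRay ℝ (P f.tri - E f.edge) (P' f'.tri - E f'.edge)) :
    (DualGraph.straight T P E hP hE hPE).SameNearBoundary
      (DualGraph.straight T' P' E hP' hE' hPE') := by
  intro f f' _ _ he
  exact ⟨by simp [DualGraph.straight, he], by simpa [DualGraph.straight, DualGraph.lastDir] using h f f' he⟩

/-! ### Examples of the moves -/

lemma card_of_cross_pos {x y w : ℂ} (h : 0 < cross (y - x) (w - x)) :
    ({x, y, w} : Finset ℂ).card = 3 := by
  refine Finset.card_eq_three.2 ⟨x, y, w, ?_, ?_, ?_, rfl⟩ <;> rintro rfl <;> simp [cross] at h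
  linarith

/-- Two triangles on both sides of a common edge meet only there. -/
lemma inter_convexHull_of_adjacent {x y w w' : ℂ} (h : 0 < cross (y - x) (w - x))
    (h' : cross (y - x) (w' - x) < 0) :
    convexHull ℝ (({x, y, w} : Finset ℂ) : Set ℂ) ∩ convexHull ℝ (({x, y, w'} : Finset ℂ) : Set ℂ) ⊆
      convexHull ℝ ((({x, y, w} : Finset ℂ) : Set ℂ) ∩ (({x, y, w'} : Finset ℂ) : Set ℂ)) := by
  have hx : cross (y - x) (x - x) = 0 := by simp [cross]
  have hy : cross (y - x) (y - x) = 0 := by simp [cross]; ring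
  refine inter_convexHull_subset_of_line (y - x) x ?_ ?_ ?_ <;> intro p hp <;>
    simp only [Finset.mem_insert, Finset.mem_singleton] at hp ⊢ <;> rcases hp with rfl | rfl | rfl
  · exact hx.ge
  · exact hy.ge
  · exact h.le
  · exact hx.le
  · exact hy.le
  · exact h'.le
  · exact fun _ => Or.inl rfl
  · exact fun _ => Or.inr (Or.inl rfl)
  · exact fun h0 => absurd h0 h.ne'

lemma inter_convexHull_of_adjacent' {x y w w' : ℂ} (h : 0 < cross (y - x) (w - x))
    (h' : cross (y - x) (w' - x) < 0) :
    convexHull ℝ (({x, y, w'} : Finset ℂ) : Set ℂ) ∩ convexHull ℝ (({x, y, w} : Finset ℂ) : Set ℂ) ⊆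
      convexHull ℝ ((({x, y, w'} : Finset ℂ) : Set ℂ) ∩ (({x, y, w} : Finset ℂ) : Set ℂ)) := by
  rw [Set.inter_comm, Set.inter_comm (({x, y, w'} : Finset ℂ) : Set ℂ)]
  exact inter_convexHull_of_adjacent h h'

namespace Triangulation

lemma exists_of_triangle {x y w : ℂ} (h : 0 < cross (y - x) (w - x)) :
    ∃ T : Triangulation (convexHull ℝ (({x, y, w} : Finset ℂ) : Set ℂ)),
      T.triangles = {{x, y, w}} := by
  refine ⟨ofTriangles {{x, y, w}} (Set.finite_singleton _) ?_ ?_ ?_ (by simp), triangles_ofTriangles⟩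
  · rintro t rfl
    exact card_of_cross_pos h
  · rintro t rfl
    exact affineIndependent_of_cross_ne_zero h.ne'
  · rintro t rfl t' rfl
    rw [Set.inter_self, Set.inter_self]

lemma exists_of_adjacent {x y w w' : ℂ} (h : 0 < cross (y - x) (w - x))
    (h' : cross (y - x) (w' - x) < 0) {M : Set ℂ}
    (hM : convexHull ℝ (({x, y, w} : Finset ℂ) : Set ℂ) ∪
      convexHull ℝ (({x, y, w'} : Finset ℂ) : Set ℂ) = M) :
    ∃ T : Triangulation M, T.triangles = {{x, y, w}, {x, y, w'}} := by
  refine ⟨ofTriangles {{x, y, w}, {x, y, w'}} (Set.toFinite _) ?_ ?_ ?_ ?_, triangles_ofTriangles⟩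
  · rintro t (rfl | rfl)
    · exact card_of_cross_pos h
    · rw [Finset.insert_comm]
      refine card_of_cross_pos ?_
      simp only [cross, Complex.sub_re, Complex.sub_im] at h' ⊢
      linarith
  · rintro t (rfl | rfl)
    · exact affineIndependent_of_cross_ne_zero h.ne'
    · exact affineIndependent_of_cross_ne_zero h'.ne
  · rintro t (rfl | rfl) t' (rfl | rfl)
    · rw [Set.inter_self, Set.inter_self]
    · exact inter_convexHull_of_adjacent h h'
    · exact inter_convexHull_of_adjacent' h h'
    · rw [Set.inter_self, Set.inter_self]
  · rw [← hM, Set.biUnion_insert, Set.biUnion_singleton]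

/-- Any two of the triangles share an edge at `o` and lie on opposite sides of it. -/
lemma exists_of_star {a b c o : ℂ} (h1 : 0 < cross (b - a) (o - a)) (h2 : 0 < cross (c - b) (o - b))
    (h3 : 0 < cross (a - c) (o - c)) {M : Set ℂ}
    (hM : convexHull ℝ (({a, b, o} : Finset ℂ) : Set ℂ) ∪
      (convexHull ℝ (({b, c, o} : Finset ℂ) : Set ℂ) ∪
        convexHull ℝ (({c, a, o} : Finset ℂ) : Set ℂ)) = M) :
    ∃ T : Triangulation M, T.triangles = {{a, b, o}, {b, c, o}, {c, a, o}} := by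
  refine ⟨ofTriangles {{a, b, o}, {b, c, o}, {c, a, o}} (Set.toFinite _) ?_ ?_ ?_ ?_,
    triangles_ofTriangles⟩
  · rintro t (rfl | rfl | rfl)
    exacts [card_of_cross_pos h1, card_of_cross_pos h2, card_of_cross_pos h3]
  · rintro t (rfl | rfl | rfl)
    exacts [affineIndependent_of_cross_ne_zero h1.ne', affineIndependent_of_cross_ne_zero h2.ne',
      affineIndependent_of_cross_ne_zero h3.ne']
  · have e1 : ({a, b, o} : Finset ℂ) = {b, o, a} := (insert_rotate a b o).symm
    have e2 : ({b, c, o} : Finset ℂ) = {b, o, c} := by ext; simp; tauto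
    have e3 : ({b, c, o} : Finset ℂ) = {c, o, b} := (insert_rotate b c o).symm
    have e4 : ({c, a, o} : Finset ℂ) = {c, o, a} := by ext; simp; tauto
    have e5 : ({c, a, o} : Finset ℂ) = {a, o, c} := (insert_rotate c a o).symm
    have e6 : ({a, b, o} : Finset ℂ) = {a, o, b} := by ext; simp; tauto
    have g : ∀ x y z : ℂ, 0 < cross (y - x) (o - x) → 0 < cross (z - y) (o - y) →
        0 < cross (o - y) (x - y) ∧ cross (o - y) (z - y) < 0 := by
      intro x y z hx hy
      simp only [cross, Complex.sub_re, Complex.sub_im] at *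
      constructor <;> linarith
    obtain ⟨g1, g2⟩ := g a b c h1 h2
    obtain ⟨g3, g4⟩ := g b c a h2 h3
    obtain ⟨g5, g6⟩ := g c a b h3 h1
    rintro t (rfl | rfl | rfl) t' (rfl | rfl | rfl)
    · rw [Set.inter_self, Set.inter_self]
    · rw [e1, e2]; exact inter_convexHull_of_adjacent g1 g2
    · rw [e6, e5]; exact inter_convexHull_of_adjacent' g5 g6
    · rw [e1, e2]; exact inter_convexHull_of_adjacent' g1 g2
    · rw [Set.inter_self, Set.inter_self]
    · rw [e3, e4]; exact inter_convexHull_of_adjacent g3 g4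
    · rw [e6, e5]; exact inter_convexHull_of_adjacent g5 g6
    · rw [e3, e4]; exact inter_convexHull_of_adjacent' g3 g4
    · rw [Set.inter_self, Set.inter_self]
  · rw [← hM, Set.biUnion_insert, Set.biUnion_insert, Set.biUnion_singleton]

end Triangulation

/-- The midpoint of an edge. -/
def edgeMidpoint (e : Finset ℂ) : ℂ := (∑ x ∈ e, x) / 2

lemma edgeMidpoint_pair {x y : ℂ} (h : x ≠ y) : edgeMidpoint {x, y} = (x + y) / 2 := by
  rw [edgeMidpoint, Finset.sum_pair h]

lemma edgeMidpoint_mem {M : Set ℂ} {T : Triangulation M} (f : T.Flag) :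
    edgeMidpoint f.edge ∈ convexHull ℝ (f.edge : Set ℂ) \ (f.edge : Set ℂ) := by
  obtain ⟨x, y, hxy, he⟩ := Finset.card_eq_two.1 f.edge_card
  rw [he, edgeMidpoint_pair hxy]
  constructor
  · rw [Finset.coe_pair, convexHull_pair]
    refine ⟨1 / 2, 1 / 2, by norm_num, by norm_num, by norm_num, ?_⟩
    simp only [Complex.real_smul]
    push_cast; ring
  · simp only [Finset.coe_pair, Set.mem_insert_iff, Set.mem_singleton_iff, not_or]
    constructor
    · intro h
      apply hxy
      linear_combination 2 * (-h)
    · intro h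
      apply hxy
      linear_combination 2 * h

lemma sameRay_of_re_im {u v : ℂ} (r : ℝ) (hr : 0 < r) (h1 : v.re = r * u.re) (h2 : v.im = r * u.im) :
    SameRay ℝ u v := by
  have : v = r • u := Complex.ext (by simpa using h1) (by simpa using h2)
  rw [this]
  exact SameRay.sameRay_pos_smul_right u hr

/-- A 2-2 move on a square, with dual graphs. -/
lemma exists_pachnerMove22 : ∃ (M : Set ℂ) (T T' : Triangulation M) (G : DualGraph T)
    (G' : DualGraph T'), IsCompact M ∧ PachnerMove22 T T' ∧ (∀ t ∈ T.triangles, t ∉ T'.triangles) ∧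
      G.SameNearBoundary G' := by
  obtain ⟨a, a1, a2⟩ : ∃ a : ℂ, a.re = -1 ∧ a.im = -1 := ⟨⟨-1, -1⟩, rfl, rfl⟩
  obtain ⟨c, c1, c2⟩ : ∃ a : ℂ, a.re = 1 ∧ a.im = -1 := ⟨⟨1, -1⟩, rfl, rfl⟩
  obtain ⟨b, b1, b2⟩ : ∃ a : ℂ, a.re = 1 ∧ a.im = 1 := ⟨⟨1, 1⟩, rfl, rfl⟩
  obtain ⟨d, d1, d2⟩ : ∃ a : ℂ, a.re = -1 ∧ a.im = 1 := ⟨⟨-1, 1⟩, rfl, rfl⟩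
  have nre : ∀ {x y : ℂ}, x.re ≠ y.re → x ≠ y := fun h h' => h (by rw [h'])
  have nim : ∀ {x y : ℂ}, x.im ≠ y.im → x ≠ y := fun h h' => h (by rw [h'])
  have hab : a ≠ b := nre (by rw [a1, b1]; norm_num)
  have hac : a ≠ c := nre (by rw [a1, c1]; norm_num)
  have had : a ≠ d := nim (by rw [a2, d2]; norm_num)
  have hbc : b ≠ c := nim (by rw [b2, c2]; norm_num)
  have hbd : b ≠ d := nre (by rw [b1, d1]; norm_num)
  have hcd : c ≠ d := nre (by rw [c1, d1]; norm_num)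
  have p1 : 0 < cross (b - a) (d - a) := by simp [cross, *] <;> norm_num
  have p2 : cross (b - a) (c - a) < 0 := by simp [cross, *] <;> norm_num
  have p2' : 0 < cross (a - b) (c - b) := by simp [cross, *] <;> norm_num
  have p3 : 0 < cross (d - c) (a - c) := by simp [cross, *] <;> norm_num
  have p4 : cross (d - c) (b - c) < 0 := by simp [cross, *] <;> norm_num
  have p4' : 0 < cross (c - d) (b - d) := by simp [cross, *] <;> norm_num
  have hM : convexHull ℝ (({c, d, a} : Finset ℂ) : Set ℂ) ∪
      convexHull ℝ (({c, d, b} : Finset ℂ) : Set ℂ) =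
      convexHull ℝ (({a, b, d} : Finset ℂ) : Set ℂ) ∪
      convexHull ℝ (({a, b, c} : Finset ℂ) : Set ℂ) := by
    rw [Finset.insert_comm c d {b}, Finset.insert_comm a b {c}]
    ext p
    simp only [Set.mem_union, mem_convexHull_iff_cross p1, mem_convexHull_iff_cross p2',
      mem_convexHull_iff_cross p3, mem_convexHull_iff_cross p4', cross, Complex.sub_re,
      Complex.sub_im, a1, a2, b1, b2, c1, c2, d1, d2]
    constructor
    · intro h
      rcases le_total p.re p.im with h' | h'
      · left; rcases h with h | h <;> refine ⟨?_, ?_, ?_⟩ <;> linarith [h.1, h.2.1, h.2.2]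
      · right; rcases h with h | h <;> refine ⟨?_, ?_, ?_⟩ <;> linarith [h.1, h.2.1, h.2.2]
    · intro h
      rcases le_total p.re (-p.im) with h' | h'
      · left; rcases h with h | h <;> refine ⟨?_, ?_, ?_⟩ <;> linarith [h.1, h.2.1, h.2.2]
      · right; rcases h with h | h <;> refine ⟨?_, ?_, ?_⟩ <;> linarith [h.1, h.2.1, h.2.2]
  obtain ⟨T, hT⟩ := exists_of_adjacent p1 p2 rfl
  obtain ⟨T', hT'⟩ := exists_of_adjacent p3 p4 hM
  have ba : b ∉ ({c, d, a} : Finset ℂ) := by simp [hab.symm, hbc, hbd]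
  have ab : a ∉ ({c, d, b} : Finset ℂ) := by simp [hab, hac, had]
  have cb : c ∉ ({a, b, d} : Finset ℂ) := by simp [hac.symm, hbc.symm, hcd]
  -- The old and the new dual vertex next to an outer edge have to lie on one ray from its midpoint.
  -- These four points achieve this, with ratios 2 and 1/2, and leave no leg horizontal.
  obtain ⟨P₁, r1, r2⟩ : ∃ a : ℂ, a.re = -1 / 5 ∧ a.im = -2 / 5 := ⟨⟨_, _⟩, rfl, rfl⟩
  obtain ⟨P₂, r3, r4⟩ : ∃ a : ℂ, a.re = 1 / 5 ∧ a.im = 2 / 5 := ⟨⟨_, _⟩, rfl, rfl⟩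
  obtain ⟨Q₁, s1, s2⟩ : ∃ a : ℂ, a.re = -2 / 5 ∧ a.im = 1 / 5 := ⟨⟨_, _⟩, rfl, rfl⟩
  obtain ⟨Q₂, s3, s4⟩ : ∃ a : ℂ, a.re = 2 / 5 ∧ a.im = -1 / 5 := ⟨⟨_, _⟩, rfl, rfl⟩
  let P : Finset ℂ → ℂ := fun t => if c ∈ t then P₁ else P₂
  let Q : Finset ℂ → ℂ := fun t => if a ∈ t then Q₁ else Q₂
  have hPc : P {a, b, c} = P₁ := if_pos (by simp)
  have hPd : P {a, b, d} = P₂ := if_neg cb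
  have hQa : Q {c, d, a} = Q₁ := if_pos (by simp)
  have hQb : Q {c, d, b} = Q₂ := if_neg ab
  have mab : edgeMidpoint {a, b} = (a + b) / 2 := edgeMidpoint_pair hab
  have mbc : edgeMidpoint {b, c} = (b + c) / 2 := edgeMidpoint_pair hbc
  have mca : edgeMidpoint {c, a} = (c + a) / 2 := edgeMidpoint_pair hac.symm
  have mbd : edgeMidpoint {b, d} = (b + d) / 2 := edgeMidpoint_pair hbd
  have mda : edgeMidpoint {d, a} = (d + a) / 2 := edgeMidpoint_pair had.symm
  have mcd : edgeMidpoint {c, d} = (c + d) / 2 := edgeMidpoint_pair hcd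
  have mdb : edgeMidpoint {d, b} = (d + b) / 2 := edgeMidpoint_pair hbd.symm
  have mac : edgeMidpoint {a, c} = (a + c) / 2 := edgeMidpoint_pair hac
  have hP : ∀ t ∈ T.triangles, P t ∈ interior (convexHull ℝ (t : Set ℂ)) := by
    rw [hT]
    rintro t (rfl | rfl)
    · rw [hPd]
      apply mem_interior_of_cross_pos p1 <;> simp [cross, *] <;> norm_num
    · rw [hPc, Finset.insert_comm]
      apply mem_interior_of_cross_pos p2' <;> simp [cross, *] <;> norm_num
  have hQ : ∀ t ∈ T'.triangles, Q t ∈ interior (convexHull ℝ (t : Set ℂ)) := by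
    rw [hT']
    rintro t (rfl | rfl)
    · rw [hQa]
      apply mem_interior_of_cross_pos p3 <;> simp [cross, *] <;> norm_num
    · rw [hQb, Finset.insert_comm]
      apply mem_interior_of_cross_pos p4' <;> simp [cross, *] <;> norm_num
  have hcases : ∀ f : T.Flag, (f.tri = {a, b, d} ∧ (f.edge = {a, b} ∨ f.edge = {b, d} ∨
      f.edge = {d, a})) ∨ (f.tri = {a, b, c} ∧ (f.edge = {a, b} ∨ f.edge = {b, c} ∨
      f.edge = {c, a})) := by
    intro f
    have hm := f.tri_mem
    rw [hT] at hm
    rcases hm with hm | hm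
    · exact Or.inl ⟨hm, eq_pair_of_subset (f.edge_subset.trans_eq hm) f.edge_card⟩
    · exact Or.inr ⟨hm, eq_pair_of_subset (f.edge_subset.trans_eq hm) f.edge_card⟩
  have hcases' : ∀ f : T'.Flag, (f.tri = {c, d, a} ∧ (f.edge = {c, d} ∨ f.edge = {d, a} ∨
      f.edge = {a, c})) ∨ (f.tri = {c, d, b} ∧ (f.edge = {c, d} ∨ f.edge = {d, b} ∨
      f.edge = {b, c})) := by
    intro f
    have hm := f.tri_mem
    rw [hT'] at hm
    rcases hm with hm | hm
    · exact Or.inl ⟨hm, eq_pair_of_subset (f.edge_subset.trans_eq hm) f.edge_card⟩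
    · exact Or.inr ⟨hm, eq_pair_of_subset (f.edge_subset.trans_eq hm) f.edge_card⟩
  have hPE : ∀ f : T.Flag, (P f.tri).im ≠ (edgeMidpoint f.edge).im := by
    intro f
    rcases hcases f with ⟨h, h' | h' | h'⟩ | ⟨h, h' | h' | h'⟩ <;> rw [h, h'] <;>
      simp only [hPc, hPd, mab, mbd, mda, mbc, mca, Complex.div_ofNat_im, Complex.add_im, a2, b2, c2,
        d2, r2, r4] <;> norm_num
  have hQE : ∀ f : T'.Flag, (Q f.tri).im ≠ (edgeMidpoint f.edge).im := by
    intro f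
    rcases hcases' f with ⟨h, h' | h' | h'⟩ | ⟨h, h' | h' | h'⟩ <;> rw [h, h'] <;>
      simp only [hQa, hQb, mcd, mda, mac, mdb, mbc, Complex.div_ofNat_im, Complex.add_im, a2, b2, c2,
        d2, s2, s4] <;> norm_num
  refine ⟨_, T, T', DualGraph.straight T P edgeMidpoint hP edgeMidpoint_mem hPE,
    DualGraph.straight T' Q edgeMidpoint hQ edgeMidpoint_mem hQE, ?_, ?_, ?_, ?_⟩
  · exact ((Finset.finite_toSet _).isCompact_convexHull ℝ).union
      ((Finset.finite_toSet _).isCompact_convexHull ℝ)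
  · refine ⟨a, b, c, d, ⟨0, ⟨1 / 2, 1 / 2, by norm_num, by norm_num, by norm_num, ?_⟩,
      ⟨1 / 2, 1 / 2, by norm_num, by norm_num, by norm_num, ?_⟩⟩, ?_, ?_, ?_⟩
    · apply Complex.ext <;> simp [*]
    · apply Complex.ext <;> simp [*]
    · rw [hT]; exact Or.inr rfl
    · rw [hT]; exact Or.inl rfl
    · rw [hT, hT', Set.pair_comm ({a, b, c} : Finset ℂ), Set.sdiff_self, Set.empty_union,
        insert_rotate a c d, insert_rotate b c d]
  · rw [hT, hT']
    have hbm : ∀ t ∈ ({{a, b, d}, {a, b, c}} : Set (Finset ℂ)), a ∈ t ∧ b ∈ t := by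
      rintro t (rfl | rfl) <;> simp
    rintro t ht (rfl | rfl)
    · exact ba (hbm _ ht).2
    · exact ab (hbm _ ht).1
  · apply DualGraph.sameNearBoundary_straight
    intro f f' he
    have hsub := f'.edge_subset
    rw [← he] at hsub ⊢
    have key : ∀ {t t' e : Finset ℂ}, f.tri = t → f.edge = e → f'.tri = t' → ∀ r : ℝ, 0 < r →
        (Q t' - edgeMidpoint e).re = r * (P t - edgeMidpoint e).re →
        (Q t' - edgeMidpoint e).im = r * (P t - edgeMidpoint e).im →
        SameRay ℝ (P f.tri - edgeMidpoint f.edge) (Q f'.tri - edgeMidpoint f.edge) := by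
      rintro t t' e h1 h2 h3 r hr h4 h5
      rw [h1, h2, h3]
      exact sameRay_of_re_im r hr h4 h5
    have hf' : f'.tri = {c, d, a} ∨ f'.tri = {c, d, b} := by
      have := f'.tri_mem; rwa [hT'] at this
    rcases hcases f with ⟨h, h' | h' | h'⟩ | ⟨h, h' | h' | h'⟩ <;> rcases hf' with h'' | h'' <;>
      rw [h', h''] at hsub
    · exact absurd (hsub (by simp)) ba
    · exact absurd (hsub (by simp)) ab
    · exact absurd (hsub (by simp)) ba
    · refine key h h' h'' 2 (by norm_num) ?_ ?_ <;> rw [hPd, hQb, mbd] <;>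
        simp [b1, b2, d1, d2, r3, r4, s3, s4] <;> norm_num
    · refine key h h' h'' (1 / 2) (by norm_num) ?_ ?_ <;> rw [hPd, hQa, mda] <;>
        simp [a1, a2, d1, d2, r3, r4, s1, s2] <;> norm_num
    · exact absurd (hsub (by simp)) ab
    · exact absurd (hsub (by simp)) ba
    · exact absurd (hsub (by simp)) ab
    · exact absurd (hsub (by simp)) ba
    · refine key h h' h'' (1 / 2) (by norm_num) ?_ ?_ <;> rw [hPc, hQb, mbc] <;>
        simp [b1, b2, c1, c2, r1, r2, s3, s4] <;> norm_num
    · refine key h h' h'' 2 (by norm_num) ?_ ?_ <;> rw [hPc, hQa, mca] <;>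
        simp [a1, a2, c1, c2, r1, r2, s1, s2] <;> norm_num
    · exact absurd (hsub (by simp)) ab

/-- The centroid of a triangle. -/
def centroid (t : Finset ℂ) : ℂ := (∑ x ∈ t, x) / 3

lemma centroid_triple {x y z : ℂ} (h : ({x, y, z} : Finset ℂ).card = 3) :
    centroid {x, y, z} = (x + y + z) / 3 := by
  have h1 : x ∉ ({y, z} : Finset ℂ) := fun h' => by
    rw [Finset.insert_eq_of_mem h'] at h
    exact absurd (h.symm.trans_le Finset.card_le_two) (by norm_num)
  have h2 : y ≠ z := by
    rintro rfl
    rw [Finset.pair_eq_singleton] at h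
    exact absurd (h.symm.trans_le Finset.card_le_two) (by norm_num)
  rw [centroid, Finset.sum_insert h1, Finset.sum_pair h2, add_assoc]

lemma centroid_mem_interior {x y z : ℂ} (h : 0 < cross (y - x) (z - x)) :
    centroid {x, y, z} ∈ interior (convexHull ℝ (({x, y, z} : Finset ℂ) : Set ℂ)) := by
  rw [centroid_triple (card_of_cross_pos h)]
  apply mem_interior_of_cross_pos h <;>
    simp only [cross, Complex.sub_re, Complex.sub_im, Complex.div_ofNat_re, Complex.div_ofNat_im,
      Complex.add_re, Complex.add_im] at h ⊢ <;> nlinarith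

/-- A 1-3 move, with dual graphs. -/
lemma exists_pachnerMove13 : ∃ (M : Set ℂ) (T T' : Triangulation M) (G : DualGraph T)
    (G' : DualGraph T'), IsCompact M ∧ PachnerMove13 T T' ∧ (∀ t ∈ T.triangles, t ∉ T'.triangles) ∧
      G.SameNearBoundary G' := by
  obtain ⟨a, a1, a2⟩ : ∃ a : ℂ, a.re = 0 ∧ a.im = 0 := ⟨⟨_, _⟩, rfl, rfl⟩
  obtain ⟨b, b1, b2⟩ : ∃ a : ℂ, a.re = 1 ∧ a.im = 1 := ⟨⟨_, _⟩, rfl, rfl⟩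
  obtain ⟨c, c1, c2⟩ : ∃ a : ℂ, a.re = 0 ∧ a.im = 8 := ⟨⟨_, _⟩, rfl, rfl⟩
  -- `o` is the centroid of `a b c`, and the triangle is skewed so that no segment from a centroid
  -- to the midpoint of an edge is horizontal.
  obtain ⟨o, o1, o2⟩ : ∃ a : ℂ, a.re = 1 / 3 ∧ a.im = 3 := ⟨⟨_, _⟩, rfl, rfl⟩
  have nim : ∀ {x y : ℂ}, x.im ≠ y.im → x ≠ y := fun h h' => h (by rw [h'])
  have hab : a ≠ b := nim (by rw [a2, b2]; norm_num)
  have hac : a ≠ c := nim (by rw [a2, c2]; norm_num)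
  have hao : a ≠ o := nim (by rw [a2, o2]; norm_num)
  have hbc : b ≠ c := nim (by rw [b2, c2]; norm_num)
  have hbo : b ≠ o := nim (by rw [b2, o2]; norm_num)
  have hco : c ≠ o := nim (by rw [c2, o2]; norm_num)
  have p0 : 0 < cross (b - a) (c - a) := by simp [cross, *]
  have p1 : 0 < cross (b - a) (o - a) := by simp [cross, *] <;> norm_num
  have p2 : 0 < cross (c - b) (o - b) := by simp [cross, *] <;> norm_num
  have p3 : 0 < cross (a - c) (o - c) := by simp [cross, *] <;> norm_num
  have hM : convexHull ℝ (({a, b, o} : Finset ℂ) : Set ℂ) ∪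
      (convexHull ℝ (({b, c, o} : Finset ℂ) : Set ℂ) ∪
        convexHull ℝ (({c, a, o} : Finset ℂ) : Set ℂ)) =
      convexHull ℝ (({a, b, c} : Finset ℂ) : Set ℂ) := by
    ext p
    simp only [Set.mem_union, mem_convexHull_iff_cross p0, mem_convexHull_iff_cross p1,
      mem_convexHull_iff_cross p2, mem_convexHull_iff_cross p3, cross, Complex.sub_re,
      Complex.sub_im, a1, a2, b1, b2, c1, c2, o1, o2]
    constructor
    · rintro (h | h | h) <;> refine ⟨?_, ?_, ?_⟩ <;> linarith [h.1, h.2.1, h.2.2]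
    · rintro ⟨h1, h2, h3⟩
      -- The three lines through `o` and a vertex decide which of the small triangles contains the
      -- point.
      rcases le_total (p.im) (9 * p.re) with ha | ha <;>
      rcases le_total (3 * p.re + p.im) 4 with hb | hb <;>
      rcases le_total (15 * p.re + p.im) 8 with hc | hc <;>
      first
      | (left; refine ⟨?_, ?_, ?_⟩ <;> linarith)
      | (right; left; refine ⟨?_, ?_, ?_⟩ <;> linarith)
      | (right; right; refine ⟨?_, ?_, ?_⟩ <;> linarith)
  obtain ⟨T, hT⟩ := exists_of_triangle p0
  obtain ⟨T', hT'⟩ := exists_of_star p1 p2 p3 hM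
  have oabc : o ∉ ({a, b, c} : Finset ℂ) := by simp [hao.symm, hbo.symm, hco.symm]
  have eo : centroid {a, b, c} = o := by
    rw [centroid_triple (card_of_cross_pos p0)]
    apply Complex.ext <;> simp [*] <;> norm_num
  have e1 := centroid_triple (card_of_cross_pos p1)
  have e2 := centroid_triple (card_of_cross_pos p2)
  have e3 := centroid_triple (card_of_cross_pos p3)
  have mab : edgeMidpoint {a, b} = (a + b) / 2 := edgeMidpoint_pair hab
  have mbc : edgeMidpoint {b, c} = (b + c) / 2 := edgeMidpoint_pair hbc
  have mca : edgeMidpoint {c, a} = (c + a) / 2 := edgeMidpoint_pair hac.symm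
  have mbo : edgeMidpoint {b, o} = (b + o) / 2 := edgeMidpoint_pair hbo
  have mob : edgeMidpoint {o, b} = (o + b) / 2 := edgeMidpoint_pair hbo.symm
  have mao : edgeMidpoint {a, o} = (a + o) / 2 := edgeMidpoint_pair hao
  have moa : edgeMidpoint {o, a} = (o + a) / 2 := edgeMidpoint_pair hao.symm
  have mco : edgeMidpoint {c, o} = (c + o) / 2 := edgeMidpoint_pair hco
  have moc : edgeMidpoint {o, c} = (o + c) / 2 := edgeMidpoint_pair hco.symm
  have hP : ∀ t ∈ T.triangles, centroid t ∈ interior (convexHull ℝ (t : Set ℂ)) := by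
    rw [hT]
    rintro t rfl
    exact centroid_mem_interior p0
  have hQ : ∀ t ∈ T'.triangles, centroid t ∈ interior (convexHull ℝ (t : Set ℂ)) := by
    rw [hT']
    rintro t (rfl | rfl | rfl)
    exacts [centroid_mem_interior p1, centroid_mem_interior p2, centroid_mem_interior p3]
  have htri : ∀ f : T.Flag, f.tri = {a, b, c} := fun f => by
    have := f.tri_mem; rwa [hT] at this
  have hedge : ∀ f : T.Flag, f.edge = {a, b} ∨ f.edge = {b, c} ∨ f.edge = {c, a} := fun f =>
    eq_pair_of_subset (f.edge_subset.trans_eq (htri f)) f.edge_card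
  have hcases' : ∀ f : T'.Flag,
      (f.tri = {a, b, o} ∧ (f.edge = {a, b} ∨ f.edge = {b, o} ∨ f.edge = {o, a})) ∨
      (f.tri = {b, c, o} ∧ (f.edge = {b, c} ∨ f.edge = {c, o} ∨ f.edge = {o, b})) ∨
      (f.tri = {c, a, o} ∧ (f.edge = {c, a} ∨ f.edge = {a, o} ∨ f.edge = {o, c})) := by
    intro f
    have hm := f.tri_mem
    rw [hT'] at hm
    rcases hm with hm | hm | hm
    · exact Or.inl ⟨hm, eq_pair_of_subset (f.edge_subset.trans_eq hm) f.edge_card⟩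
    · exact Or.inr (Or.inl
        ⟨hm, eq_pair_of_subset (f.edge_subset.trans_eq hm) f.edge_card⟩)
    · exact Or.inr (Or.inr
        ⟨hm, eq_pair_of_subset (f.edge_subset.trans_eq hm) f.edge_card⟩)
  have hPE : ∀ f : T.Flag, (centroid f.tri).im ≠ (edgeMidpoint f.edge).im := by
    intro f
    rcases hedge f with h' | h' | h' <;> rw [htri, h', eo] <;>
      simp only [mab, mbc, mca, Complex.div_ofNat_im, Complex.add_im, a2, b2, c2, o2] <;> norm_num
  have hQE : ∀ f : T'.Flag, (centroid f.tri).im ≠ (edgeMidpoint f.edge).im := by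
    intro f
    rcases hcases' f with ⟨h, h' | h' | h'⟩ | ⟨h, h' | h' | h'⟩ | ⟨h, h' | h' | h'⟩ <;>
      rw [h, h'] <;>
      simp only [e1, e2, e3, mab, mbc, mca, mao, moa, mbo, mob, mco, moc, Complex.div_ofNat_im,
        Complex.add_im, a2, b2, c2, o2] <;> norm_num
  refine ⟨_, T, T', DualGraph.straight T centroid edgeMidpoint hP edgeMidpoint_mem hPE,
    DualGraph.straight T' centroid edgeMidpoint hQ edgeMidpoint_mem hQE, ?_, ?_, ?_, ?_⟩
  · exact (Finset.finite_toSet _).isCompact_convexHull ℝ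
  · refine ⟨a, b, c, o, ?_, ?_, ?_⟩
    · have := centroid_mem_interior p0
      rw [eo] at this
      simpa using this
    · rw [hT]; rfl
    · rw [hT, hT', Set.sdiff_self, Set.empty_union]
  · rw [hT, hT']
    rintro t rfl (h | h | h) <;> exact oabc (by rw [h]; simp)
  · apply DualGraph.sameNearBoundary_straight
    intro f f' he
    have ho : o ∉ f'.edge := fun h => oabc (by
      rw [← he] at h
      exact f.edge_subset.trans_eq (htri f) h)
    -- The centroid of `x y o` lies on the median from the midpoint of `x y` to `o`, at a third of
    -- the way.
    have key : ∀ x y : ℂ, SameRay ℝ (o - (x + y) / 2) ((x + y + o) / 3 - (x + y) / 2) := by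
      intro x y
      have : (x + y + o) / 3 - (x + y) / 2 = (1 / 3 : ℝ) • (o - (x + y) / 2) := by
        rw [Complex.real_smul]; push_cast; ring
      rw [this]
      exact SameRay.sameRay_pos_smul_right _ (by norm_num)
    rw [htri f, eo, he]
    rcases hcases' f' with ⟨h, h' | h' | h'⟩ | ⟨h, h' | h' | h'⟩ | ⟨h, h' | h' | h'⟩ <;>
      first
      | (exfalso; apply ho; rw [h']; simp; done)
      | rw [h, h']
    · rw [e1, mab]; exact key a b
    · rw [e2, mbc]; exact key b c
    · rw [e3, mca]; exact key c a

/-- A single example of each move yields the identities, as boundary states are arbitrary and the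
power of `R` common to both sides cancels. -/
theorem Data.isPlanar_iff_amplitudes {k : Type*} [Field k] {S : Type*} [Fintype S] [DecidableEq S]
    {D : Data k S} (hN : D.Nondegenerate) (hD : D.IsDiagrammatic) :
    D.IsPlanar ↔ (∀ a b c d, D.quadAmp a b c d = D.quadAmp' a b c d) ∧
      ∀ a b c, D.C a b c = D.R * D.starAmp a b c := by
  have hB := isUnit_det hN
  refine ⟨fun h => ⟨?_, ?_⟩, fun h => isPlanar_of_amplitudes hB hD h.1 h.2⟩
  · obtain ⟨M, T, T', G, G', hM, hT, hdisj, hG⟩ := exists_pachnerMove22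
    intro a b c d
    have := (hasLocalChange_of_pachnerMove22 hB hT).eq_of_evalGraph_eq hB hD hdisj hG
      (h M hM T T' (Or.inl hT) G G' hG) ![a, b, c, d]
    rw [hT.numInteriorVertices_eq] at this
    exact mul_left_cancel₀ (pow_ne_zero _ hN.1) this
  · obtain ⟨M, T, T', G, G', hM, hT, hdisj, hG⟩ := exists_pachnerMove13
    intro a b c
    have := (hasLocalChange_of_pachnerMove13 hB hT).eq_of_evalGraph_eq hB hD hdisj hG
      (h M hM T T' (Or.inr hT) G G' hG) ![a, b, c]
    rw [hT.numInteriorVertices_eq, pow_succ, mul_assoc] at this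
    exact mul_left_cancel₀ (pow_ne_zero _ hN.1) this

end PlanarStateSum

end

theorem mainTheorem2 {k : Type*} [Field k] {S : Type*} [Fintype S] [DecidableEq S]
    (D : PlanarStateSum.Data k S) (hD : D.Nondegenerate) (hBC : D.IsDiagrammatic) :
    D.IsPlanar ↔ D.DeterminesSpecialFrobenius :=
  (PlanarStateSum.Data.isPlanar_iff_amplitudes hD hBC).trans
    (PlanarStateSum.Data.determinesSpecialFrobenius_iff hD hBC).symm
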